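/- An instance of Multiagent Path Finding (MAPF) consists of a finite simple undirected graph $G=(V,E)$ with $n$ vertices and $m$ edges, a finite set $A$ of $k$ agents, injective maps $s_0,t\colon A\to V$ (starting and target positions) and a positive integer $\ell$ (the makespan). A solution is a sequence $s_1,\dots,s_\ell\colon A\to V$ of injective maps with $s_\ell=t$ such that for every $i\in\{1,\dots,\ell\}$ and every agent $a$, either $s_i(a)=s_{i-1}(a)$ or $s_i(a)$ is a neighbour of $s_{i-1}(a)$ in $G$. In the version without swaps it is moreover required that for no $i$ there are two distinct agents $a,b$ with $s_i(a)=s_{i-1}(b)$ and $s_i(b)=s_{i-1}(a)$. The question is whether a solution exists. An instance is given by the numbers $n,m,k,\ell$, the list of the edges, and the lists of the starting and target positions. **Theorem.** For each of the two versions of MAPF (swaps allowed, swaps forbidden): 1. The problem is fixed-parameter tractable when parameterised by $k+\ell$: there are an algorithm, a computable function $f\colon\mathbb N\to\mathbb N$ and a polynomial $p$ such that the algorithm decides, for every word $x$ and every $\kappa\in\mathbb N$, in time $f(\kappa)\cdot p(|x|)$ whether $x$ encodes a yes-instance with $k+\ell=\kappa$. 2. More precisely, there is an algorithm that decides every instance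 in $O(2^{O(k\ell)}\cdot m\cdot\log n)$ time (where $m$ and $\log n$ are read as at least $1$), with absolute constants in both $O$'s. Time is the number of steps of a random access machine with unit-cost addition, truncated subtraction, multiplication, integer division, comparison and indirect addressing. All numbers that occur have at most $f(\kappa)\cdot p(|x|)$ bits in part 1, and $O(k\ell+\log(n+\ell)+1)$ bits in part 2. -/

import Mathlib

/-! ### A random access machine with unit-cost steps

Finitely many registers (those a program mentions) and a memory of cells, all holding natural
numbers. Arithmetic on unbounded numbers at unit cost would be unrealistic, so the number of bits
of every value that ever occurs is accounted for together with the number of steps. -/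

namespace RAM

/-- Instructions; `d`, `a`, `b` are register names, `t` is a position in the program. -/
inductive Instr where
  /-- `R[d] := c` -/
  | const (d c : ℕ)
  /-- `R[d] := R[a] + R[b]` -/
  | add (d a b : ℕ)
  /-- `R[d] := max (R[a] - R[b]) 0` -/
  | sub (d a b : ℕ)
  /-- `R[d] := R[a] * R[b]` -/
  | mul (d a b : ℕ)
  /-- `R[d] := ⌊R[a] / R[b]⌋`, and `0` if `R[b] = 0` -/
  | div (d a b : ℕ)
  /-- `R[d] := M[R[a]]` -/
  | load (d a : ℕ)
  /-- `M[R[a]] := R[b]` -/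
  | store (a b : ℕ)
  /-- go to `t` -/
  | jump (t : ℕ)
  /-- if `R[a] < R[b]` go to `t` -/
  | jumpLt (a b t : ℕ)
  /-- if `R[a] = R[b]` go to `t` -/
  | jumpEq (a b t : ℕ)

abbrev Program := List Instr

structure Config where
  pc : ℕ
  reg : ℕ → ℕ
  mem : ℕ → ℕ

/-- Assign a register and go to the next instruction. -/
def Config.setReg (c : Config) (d v : ℕ) : Config :=
  ⟨c.pc + 1, Function.update c.reg d v, c.mem⟩

def Instr.exec : Instr → Config → Config
  | .const d v, c => c.setReg d v
  | .add d a b, c => c.setReg d (c.reg a + c.reg b)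
  | .sub d a b, c => c.setReg d (c.reg a - c.reg b)
  | .mul d a b, c => c.setReg d (c.reg a * c.reg b)
  | .div d a b, c => c.setReg d (c.reg a / c.reg b)
  | .load d a, c => c.setReg d (c.mem (c.reg a))
  | .store a b, c => ⟨c.pc + 1, c.reg, Function.update c.mem (c.reg a) (c.reg b)⟩
  | .jump t, c => ⟨t, c.reg, c.mem⟩
  | .jumpLt a b t, c => ⟨if c.reg a < c.reg b then t else c.pc + 1, c.reg, c.mem⟩
  | .jumpEq a b t, c => ⟨if c.reg a = c.reg b then t else c.pc + 1, c.reg, c.mem⟩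

/-- The machine halts when the program counter leaves the program. -/
def Program.Halted (P : Program) (c : Config) : Prop := P.length ≤ c.pc

/-- One step; a halted configuration stays as it is. -/
def Program.step (P : Program) (c : Config) : Config :=
  match P[c.pc]? with
  | some i => i.exec c
  | none => c

/-- The input is written to the memory cells `0, 1, …`, its length to register `0`;
everything else is `0`. -/
def init (x : List ℕ) : Config :=
  ⟨0, fun r => if r = 0 then x.length else 0, fun j => x.getD j 0⟩

/-- The configuration after `s` steps on input `x`. -/
def Program.run (P : Program) (x : List ℕ) (s : ℕ) : Config := P.step^[s] (init x)

/-- On input `x` the program halts after at most `T` steps with the truth value of `b`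
(`1` or `0`) in register `0`, and all values occurring on the way have at most `B` bits. -/
def Program.DecidesWithin (P : Program) (x : List ℕ) (b : Prop) (T B : ℕ) : Prop :=
  ∃ s ≤ T, P.Halted (P.run x s) ∧
    ((b ∧ (P.run x s).reg 0 = 1) ∨ (¬ b ∧ (P.run x s).reg 0 = 0)) ∧
    ∀ r ≤ s, ∀ j, (P.run x r).reg j < 2 ^ B ∧ (P.run x r).mem j < 2 ^ B

end RAM

/-! ### Fixed-parameter tractability -/

/-- The length of a finite sequence of naturals, written in binary with a delimiter after each
of them. -/
def bitLength (x : List ℕ) : ℕ := (x.map fun a => Nat.size a + 1).sum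

/-- A parameterized problem: a set of pairs (word, parameter), where a word is a finite sequence
of naturals, i.e. a string over `{0, 1, #}`. -/
abbrev ParamProblem := Set (List ℕ × ℕ)

/-- A parameterized problem is fixed-parameter tractable if some program decides, for every
pair `(x, κ)`, whether it belongs to the problem within `f(κ) · poly(|x|)` steps, on numbers with
`f(κ) · poly(|x|)` bits, for a computable `f`. -/
def ParamProblem.InFPT (L : ParamProblem) : Prop :=
  ∃ (P : RAM.Program) (f : ℕ → ℕ) (p : Polynomial ℕ), Computable f ∧
    ∀ (x : List ℕ) (κ : ℕ),
      P.DecidesWithin (κ :: x) ((x, κ) ∈ L)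
        (f κ * p.eval (bitLength x)) (f κ * p.eval (bitLength x))

/-! ### Multiagent path finding -/

/-- `⟨G, A, s₀, t, ℓ⟩` with vertex set `V` and set of agents `A`. -/
structure MAPFInstance (V A : Type) where
  G : SimpleGraph V
  s₀ : A → V
  t : A → V
  ℓ : ℕ
  s₀_injective : Function.Injective s₀
  t_injective : Function.Injective t
  ℓ_pos : 0 < ℓ

/-- The two versions of the problem: swaps allowed or forbidden. -/
inductive SwapRule where
  | swaps
  | noSwaps

namespace MAPFInstance

variable {V A : Type}

/-- The positions `s'` may follow the positions `s` in one turn: every agent stays or moves to a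
neighbour, every vertex hosts at most one agent, and, if swaps are forbidden, no two agents
exchange their positions. -/
def Feasible (I : MAPFInstance V A) (r : SwapRule) (s s' : A → V) : Prop :=
  (∀ a, s' a = s a ∨ I.G.Adj (s a) (s' a)) ∧
  Function.Injective s' ∧
  (r = SwapRule.noSwaps → ¬ ∃ a b, a ≠ b ∧ s' a = s b ∧ s' b = s a)

/-- There is a solution of makespan `ℓ`. -/
def Solvable (I : MAPFInstance V A) (r : SwapRule) : Prop :=
  ∃ s : ℕ → A → V, s 0 = I.s₀ ∧ s I.ℓ = I.t ∧ ∀ i < I.ℓ, I.Feasible r (s i) (s (i + 1))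

/-- `E` lists every edge of `G` exactly once, with its ends in either order. -/
def IsEdgeList (G : SimpleGraph V) (E : List (V × V)) : Prop :=
  (E.map fun e => s(e.1, e.2)).Nodup ∧
  ∀ e : Sym2 V, e ∈ (E.map fun e => s(e.1, e.2)) ↔ e ∈ G.edgeSet

/-- The encoding of an instance with vertices `0, …, n - 1`, agents `0, …, k - 1` and edge
list `E`: the numbers `n, m, k, ℓ`, then the ends of the edges, the starting positions and the
targets. -/
def encode {n k : ℕ} (I : MAPFInstance (Fin n) (Fin k)) (E : List (Fin n × Fin n)) : List ℕ :=
  [n, E.length, k, I.ℓ] ++ E.flatMap (fun e => [(e.1 : ℕ), (e.2 : ℕ)]) ++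
    List.ofFn (fun a => (I.s₀ a : ℕ)) ++ List.ofFn (fun a => (I.t a : ℕ))

end MAPFInstance

/-- Multiagent path finding, parameterized by the number of agents plus the makespan. -/
def MAPF (r : SwapRule) : ParamProblem :=
  {q | ∃ (n k : ℕ) (I : MAPFInstance (Fin n) (Fin k)) (E : List (Fin n × Fin n)),
    MAPFInstance.IsEdgeList I.G E ∧ q.1 = I.encode E ∧ q.2 = k + I.ℓ ∧ I.Solvable r}

/-! A solution consists of `k` walks of length `l` without conflicts. Every step of a walk is one of
`4 * m + k` moves: an edge in either direction, a pause at an end of an edge, or a pause at a start.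
A move made in step `i` carries two numbers, its tokens. The token `Y` names the vertex entered; the
token `X` names the edge used or, for a pause, again the vertex. Tokens of different steps come from
disjoint intervals. Agents that enter the same vertex share a token `Y`. If both directions of an
edge have the same token `X`, two agents that swap share it; if the two directions have different
tokens, swaps go unnoticed. Hence a family of walks with the right ends is a solution iff the list
of its `2 * k * l` tokens has no repetition (`Data.exists_nodup_iff_solvable`).

Repetitions are detected by exterior algebra. Let `K = 2 * (k * l)`, let `p` be a prime above all
tokens, and send the token `z` to the vector `(1, z, …, z ^ (K - 1))` over `ZMod p`. The exterior
product of the `K` vectors of a list vanishes if a token is repeated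
(`wedgeList_eq_zero_of_not_nodup`) and is otherwise a nonzero Vandermonde determinant
(`wedgeList_pow_ne_zero`). So a solution exists iff the span of the products of all families of
walks is not the zero space (`tokenSpan_eq_bot_iff`). Taking spans instead of sums excludes
cancellation, so no randomness is needed.

These spans obey a dynamic programme over agents, steps and vertices. Appending a move is a linear
map applied to the span at its first vertex, and the contributions of all moves into one vertex are
summed as subspaces (`tokenSpan_extend_succ`). All spaces live in dimension `2 ^ K`. A basis in
echelon form, kept up to date by Gaussian elimination (`insertStmt_spec`), therefore replaces the
huge set of partial solutions, and each move costs `2 ^ O(k * l)` steps.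

The running time must not grow linearly with `n`. Only ends of edges and starts receive labels,
which are below `2 * m + k`; thus all tokens are below `N = 3 * (2 * m + k) * l`. A prime in `(N, 2
* N]` exists by Bertrand's postulate and is found with a sieve, whose harmonic sum is the only
source of the factor `log n`. Storage for other vertices is never initialised, because memory starts
out as zero.

The algorithm is written in a language with bounded loops. Its compiler is correct with exact
account of the steps (`Stmt.runs`), and programs are verified by Hoare-style rules for `Spec` that
bound the cost as well. If the variables and cells are at most `V`, all values on the machine are at
most `V ^ 64`. For fixed-parameter tractability the input is an arbitrary word, so a quadratic test
that it is an encoding comes before the main algorithm (`validStmt_spec`,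
`ValidInput.exists_encode`); then `k * l ≤ κ ^ 2` bounds the exponent. The numerals in the cost
bounds have no meaning beyond being large enough. -/

set_option linter.constructorNameAsVariable false

/-! ### A structured language with bounded loops, compiled to the random access machine -/

namespace RAM

/-- The variables of the structured language. -/
inductive Var where
  | len | n | m | k | l | kk | d | dd | aa | uu | nn | n2 | p | rr
  | i | j | e | a | b | u | v | src | dst | x | y | s | h | t | r | pw | bit | acc | sg | c | f
  | ptr | g | ok | kap | u2 | v2
  deriving DecidableEq

/-- The arrays of the structured language. -/
inductive Arr where
  | mark | lab | fr | tgt | tok | blk | vf | vh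
  deriving DecidableEq

/-- The order of the constructors matters: `len` comes first and hence is register `0`, in which the
machine receives the length of the input and returns the answer. -/
def Var.reg (x : Var) : ℕ := x.ctorIdx

def Arr.idx (a : Arr) : ℕ := a.ctorIdx

theorem Var.reg_injective : Function.Injective Var.reg := by
  intro x y h
  have h' : x.ctorIdx = y.ctorIdx := h
  rw [← Var.ofNat_ctorIdx x, ← Var.ofNat_ctorIdx y, h']

theorem Arr.idx_injective : Function.Injective Arr.idx := by
  intro x y h
  have h' : x.ctorIdx = y.ctorIdx := h
  rw [← Arr.ofNat_ctorIdx x, ← Arr.ofNat_ctorIdx y, h']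

/-- Registers `98` and `99` are kept for the constants `0` and the length of the input; those from
`100` on are scratch space for expressions. -/
theorem Var.reg_lt (x : Var) : x.reg < 98 := by cases x <;> decide

/-- The arrays are interleaved behind the input with stride `16`, so that each of them is unbounded
and no two of them overlap. -/
theorem Arr.idx_lt (a : Arr) : a.idx < 16 := by cases a <;> decide

/-- Contents of the variables and of the arrays. -/
structure State where
  var : Var → ℕ
  arr : Arr → ℕ → ℕ

def State.set (σ : State) (x : Var) (v : ℕ) : State :=
  ⟨fun y => if y = x then v else σ.var y, σ.arr⟩

def State.put (σ : State) (a : Arr) (i v : ℕ) : State :=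
  ⟨σ.var, fun b j => if b = a ∧ j = i then v else σ.arr b j⟩

section
variable (σ : State) (x y : Var) (a b : Arr) (i j v : ℕ)

@[simp] theorem State.set_var : (σ.set x v).var y = if y = x then v else σ.var y := rfl
@[simp] theorem State.set_arr : (σ.set x v).arr = σ.arr := rfl
@[simp] theorem State.put_var : (σ.put a i v).var = σ.var := rfl
@[simp] theorem State.put_arr :
    (σ.put a i v).arr b j = if b = a ∧ j = i then v else σ.arr b j := rfl

theorem State.put_arr_of_ne (h : b ≠ a) : (σ.put a i v).arr b = σ.arr b := by
  funext j; simp [h]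

end

inductive Expr where
  | lit (c : ℕ)
  | var (x : Var)
  | get (a : Arr) (e : Expr)
  | add (e₁ e₂ : Expr)
  | sub (e₁ e₂ : Expr)
  | mul (e₁ e₂ : Expr)
  | div (e₁ e₂ : Expr)

namespace Expr

instance : Add Expr := ⟨Expr.add⟩
instance : Sub Expr := ⟨Expr.sub⟩
instance : Mul Expr := ⟨Expr.mul⟩
instance : Div Expr := ⟨Expr.div⟩
instance (c : ℕ) : OfNat Expr c := ⟨Expr.lit c⟩
instance : Coe Var Expr := ⟨Expr.var⟩

/-- The remainder of `e₁` modulo `e₂`. -/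
def mod (e₁ e₂ : Expr) : Expr := e₁ - e₁ / e₂ * e₂

def eval (σ : State) : Expr → ℕ
  | lit c => c
  | var x => σ.var x
  | get a e => σ.arr a (e.eval σ)
  | add e₁ e₂ => e₁.eval σ + e₂.eval σ
  | sub e₁ e₂ => e₁.eval σ - e₂.eval σ
  | mul e₁ e₂ => e₁.eval σ * e₂.eval σ
  | div e₁ e₂ => e₁.eval σ / e₂.eval σ

section
variable (σ : State) (e₁ e₂ : Expr)
@[simp] theorem eval_lit (c : ℕ) : (lit c).eval σ = c := rfl
@[simp] theorem eval_ofNat (c : ℕ) :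
    (no_index (OfNat.ofNat c : Expr)).eval σ = OfNat.ofNat c := rfl
@[simp] theorem eval_var (x : Var) : (var x).eval σ = σ.var x := rfl
@[simp] theorem eval_get (a : Arr) : (get a e₁).eval σ = σ.arr a (e₁.eval σ) := rfl
@[simp] theorem eval_add : (e₁ + e₂).eval σ = e₁.eval σ + e₂.eval σ := rfl
@[simp] theorem eval_sub : (e₁ - e₂).eval σ = e₁.eval σ - e₂.eval σ := rfl
@[simp] theorem eval_mul : (e₁ * e₂).eval σ = e₁.eval σ * e₂.eval σ := rfl
@[simp] theorem eval_div : (e₁ / e₂).eval σ = e₁.eval σ / e₂.eval σ := rfl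
@[simp] theorem eval_mod : (mod e₁ e₂).eval σ = e₁.eval σ % e₂.eval σ := by
  have h := Nat.div_add_mod (e₁.eval σ) (e₂.eval σ)
  simp only [mod, eval_sub, eval_mul, eval_div]
  rw [mul_comm (e₁.eval σ / e₂.eval σ)]
  omega
end

/-- All values that occur in the evaluation are at most `V ^ deg`. -/
def deg : Expr → ℕ
  | lit _ => 1
  | var _ => 1
  | get _ e => e.deg + 2
  | add e₁ e₂ => max e₁.deg e₂.deg + 1
  | sub e₁ e₂ => max e₁.deg e₂.deg
  | mul e₁ e₂ => e₁.deg + e₂.deg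
  | div e₁ e₂ => max e₁.deg e₂.deg

def litsSmall : Expr → Bool
  | lit c => c ≤ 16
  | var _ => true
  | get _ e => e.litsSmall
  | add e₁ e₂ | sub e₁ e₂ | mul e₁ e₂ | div e₁ e₂ => e₁.litsSmall && e₂.litsSmall

/-- The bound on the degree keeps intermediate values below `V ^ 64`, which multiplies the number of
bits only by a constant. Literals up to `16` are harmless once `16 ≤ V`. -/
def wf (e : Expr) : Bool := e.litsSmall && e.deg ≤ 64

/-- Code that leaves the address `L + 16 * R[t] + a` in register `t`, using register `t + 1`. -/
def addrCode (a : Arr) (t : ℕ) : List Instr :=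
  [.const (t + 1) 16, .mul t t (t + 1), .add t t 99, .const (t + 1) a.idx, .add t t (t + 1)]

/-- Code that leaves the value in register `t`, using only registers from `t` on. Register `98`
holds `0`, register `99` the length of the input. -/
def code : Expr → ℕ → List Instr
  | lit c, t => [.const t c]
  | var x, t => [.add t x.reg 98]
  | get a e, t => e.code t ++ (addrCode a t ++ [.load t t])
  | add e₁ e₂, t => e₁.code t ++ (e₂.code (t + 1) ++ [.add t t (t + 1)])
  | sub e₁ e₂, t => e₁.code t ++ (e₂.code (t + 1) ++ [.sub t t (t + 1)])
  | mul e₁ e₂, t => e₁.code t ++ (e₂.code (t + 1) ++ [.mul t t (t + 1)])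
  | div e₁ e₂, t => e₁.code t ++ (e₂.code (t + 1) ++ [.div t t (t + 1)])

def cost : Expr → ℕ
  | lit _ => 1
  | var _ => 1
  | get _ e => e.cost + 6
  | add e₁ e₂ | sub e₁ e₂ | mul e₁ e₂ | div e₁ e₂ => e₁.cost + e₂.cost + 1

section
variable (e₁ e₂ : Expr)
@[simp] theorem cost_ofNat (c : ℕ) : (no_index (OfNat.ofNat c : Expr)).cost = 1 := rfl
@[simp] theorem cost_lit (c : ℕ) : (lit c).cost = 1 := rfl
@[simp] theorem cost_var (x : Var) : (var x).cost = 1 := rfl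
@[simp] theorem cost_get (a : Arr) : (get a e₁).cost = e₁.cost + 6 := rfl
@[simp] theorem cost_add : (e₁ + e₂).cost = e₁.cost + e₂.cost + 1 := rfl
@[simp] theorem cost_sub : (e₁ - e₂).cost = e₁.cost + e₂.cost + 1 := rfl
@[simp] theorem cost_mul : (e₁ * e₂).cost = e₁.cost + e₂.cost + 1 := rfl
@[simp] theorem cost_div : (e₁ / e₂).cost = e₁.cost + e₂.cost + 1 := rfl
@[simp] theorem cost_mod : (mod e₁ e₂).cost = e₁.cost + (e₁.cost + e₂.cost + 1 + e₂.cost + 1) + 1 :=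
  rfl
end

theorem length_code (e : Expr) (t : ℕ) : (e.code t).length = e.cost := by
  induction e generalizing t <;> simp [code, cost, addrCode, *] <;> omega

theorem one_le_deg (e : Expr) : 1 ≤ e.deg := by
  induction e <;> simp [deg] <;> omega

end Expr

/-- Statements. `ite e₁ e₂ s₁ s₂` is `if e₁ < e₂ then s₁ else s₂`; `loop i x s` runs `s` for
`i = 0, …, x - 1`. -/
inductive Stmt where
  | skip
  | assign (x : Var) (e : Expr)
  | input (x : Var) (e : Expr)
  | store (a : Arr) (e₁ e₂ : Expr)
  | seq (s₁ s₂ : Stmt)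
  | ite (e₁ e₂ : Expr) (s₁ s₂ : Stmt)
  | loop (i x : Var) (s : Stmt)

infixr:60 ";;" => Stmt.seq
infix:62 "≔" => Stmt.assign

namespace Stmt

/-- The variables a statement may change. -/
def vars : Stmt → List Var
  | skip => []
  | assign x _ => [x]
  | input x _ => [x]
  | store _ _ _ => []
  | seq s₁ s₂ => s₁.vars ++ s₂.vars
  | ite _ _ s₁ s₂ => s₁.vars ++ s₂.vars
  | loop i _ s => i :: s.vars

/-- The arrays a statement may change. -/
def arrs : Stmt → List Arr
  | skip => []
  | assign _ _ => []
  | input _ _ => []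
  | store a _ _ => [a]
  | seq s₁ s₂ => s₁.arrs ++ s₂.arrs
  | ite _ _ s₁ s₂ => s₁.arrs ++ s₂.arrs
  | loop _ _ s => s.arrs

/-- The body of a loop may change neither its counter nor its bound, so the number of rounds is
fixed on entry. -/
def wf : Stmt → Bool
  | skip => true
  | assign _ e => e.wf
  | input _ e => e.wf
  | store _ e₁ e₂ => e₁.wf && e₂.wf && e₁.deg + 2 ≤ 64
  | seq s₁ s₂ => s₁.wf && s₂.wf
  | ite e₁ e₂ s₁ s₂ => e₁.wf && e₂.wf && s₁.wf && s₂.wf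
  | loop i x s => s.wf && i ≠ x && i ∉ s.vars && x ∉ s.vars

variable (inp : ℕ → ℕ)

/-- One round of a loop with counter `i`. -/
def round (i : Var) (f : State → State) (σ : State) : State := (f σ).set i ((f σ).var i + 1)

def exec : Stmt → State → State
  | skip, σ => σ
  | assign x e, σ => σ.set x (e.eval σ)
  | input x e, σ => σ.set x (inp (e.eval σ))
  | store a e₁ e₂, σ => σ.put a (e₁.eval σ) (e₂.eval σ)
  | seq s₁ s₂, σ => s₂.exec (s₁.exec σ)
  | ite e₁ e₂ s₁ s₂, σ => if e₁.eval σ < e₂.eval σ then s₁.exec σ else s₂.exec σ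
  | loop i x s, σ => (round i s.exec)^[σ.var x] (σ.set i 0)

def cost : Stmt → State → ℕ
  | skip, _ => 0
  | assign _ e, _ => e.cost + 1
  | input _ e, _ => e.cost + 1
  | store _ e₁ e₂, _ => e₁.cost + e₂.cost + 6
  | seq s₁ s₂, σ => s₁.cost σ + s₂.cost (s₁.exec inp σ)
  | ite e₁ e₂ s₁ s₂, σ => e₁.cost + e₂.cost + 2 +
      if e₁.eval σ < e₂.eval σ then s₁.cost σ else s₂.cost σ
  | loop i x s, σ => (∑ t ∈ Finset.range (σ.var x),
      (s.cost ((round i (s.exec inp))^[t] (σ.set i 0)) + 4)) + 3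

/-- All values assigned are at most `V`, and only the first `L` cells of the input are read. -/
def Safe (L V : ℕ) : Stmt → State → Prop
  | skip, _ => True
  | assign _ e, σ => e.eval σ ≤ V
  | input _ e, σ => e.eval σ < L
  | store _ _ e₂, σ => e₂.eval σ ≤ V
  | seq s₁ s₂, σ => s₁.Safe L V σ ∧ s₂.Safe L V (s₁.exec inp σ)
  | ite e₁ e₂ s₁ s₂, σ => if e₁.eval σ < e₂.eval σ then s₁.Safe L V σ else s₂.Safe L V σ
  | loop i x s, σ => ∀ t < σ.var x, s.Safe L V ((round i (s.exec inp))^[t] (σ.set i 0))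

def size : Stmt → ℕ
  | skip => 0
  | assign _ e => e.cost + 1
  | input _ e => e.cost + 1
  | store _ e₁ e₂ => e₁.cost + e₂.cost + 6
  | seq s₁ s₂ => s₁.size + s₂.size
  | ite e₁ e₂ s₁ s₂ => e₁.cost + e₂.cost + 2 + s₁.size + s₂.size
  | loop _ _ s => s.size + 6

/-- Code to be placed at position `o` of a program. -/
def code : Stmt → ℕ → List Instr
  | skip, _ => []
  | assign x e, _ => e.code 100 ++ [.add x.reg 100 98]
  | input x e, _ => e.code 100 ++ [.load x.reg 100]
  | store a e₁ e₂, _ => e₁.code 100 ++ (Expr.addrCode a 100 ++ (e₂.code 101 ++ [.store 100 101]))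
  | seq s₁ s₂, o => s₁.code o ++ s₂.code (o + s₁.size)
  | ite e₁ e₂ s₁ s₂, o =>
      let o' := o + e₁.cost + e₂.cost + 1
      e₁.code 100 ++ (e₂.code 101 ++ (.jumpLt 100 101 (o' + s₂.size + 1) ::
        (s₂.code o' ++ (.jump (o' + s₂.size + 1 + s₁.size) :: s₁.code (o' + s₂.size + 1)))))
  | loop i x s, o =>
      .const i.reg 0 :: .jumpLt i.reg x.reg (o + 3) :: .jump (o + s.size + 6) ::
        (s.code (o + 3) ++ [.const 100 1, .add i.reg i.reg 100, .jump (o + 1)])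

theorem length_code (s : Stmt) (o : ℕ) : (s.code o).length = s.size := by
  induction s generalizing o <;>
    simp [code, size, Expr.length_code, Expr.addrCode, *] <;> omega

end Stmt

/-! #### Running pieces of code -/

def Program.Has (P : Program) : ℕ → List Instr → Prop
  | _, [] => True
  | o, i :: C => P[o]? = some i ∧ P.Has (o + 1) C

theorem Program.has_append (P : Program) (o : ℕ) (C C' : List Instr) :
    P.Has o (C ++ C') ↔ P.Has o C ∧ P.Has (o + C.length) C' := by
  induction C generalizing o with
  | nil => simp [Program.Has]
  | cons i C ih => simp [Program.Has, ih, and_assoc, add_assoc, add_comm 1]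

theorem Program.has_of_append (A C : List Instr) : Program.Has (A ++ C) A.length C := by
  induction C generalizing A with
  | nil => trivial
  | cons i C ih =>
    refine ⟨by simp, ?_⟩
    have := ih (A ++ [i])
    simpa using this

/-- All values are at most `W`. -/
def Config.Bdd (W : ℕ) (c : Config) : Prop := ∀ j, c.reg j ≤ W ∧ c.mem j ≤ W

/-- `c'` is reached from `c` in `t` steps with all values at most `W`. -/
structure Program.Reach (P : Program) (W : ℕ) (c : Config) (t : ℕ) (c' : Config) : Prop where
  eq : P.step^[t] c = c'
  bdd : ∀ r ≤ t, (P.step^[r] c).Bdd W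

section
variable {P : Program} {W : ℕ} {c c' c'' : Config}

theorem Program.Reach.refl (h : c.Bdd W) : P.Reach W c 0 c :=
  ⟨rfl, fun r hr => by obtain rfl : r = 0 := by omega
                       exact h⟩

theorem Program.Reach.trans {t t' : ℕ} (h : P.Reach W c t c') (h' : P.Reach W c' t' c'') :
    P.Reach W c (t + t') c'' := by
  refine ⟨by rw [add_comm, Function.iterate_add_apply, h.eq, h'.eq], fun r hr => ?_⟩
  rcases le_total r t with hrt | hrt
  · exact h.bdd r hrt
  · obtain ⟨d, rfl⟩ := Nat.exists_eq_add_of_le hrt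
    rw [add_comm, Function.iterate_add_apply, h.eq]
    exact h'.bdd d (by omega)

theorem Program.Reach.bdd_right {t : ℕ} (h : P.Reach W c t c') : c'.Bdd W :=
  h.eq ▸ h.bdd t le_rfl

theorem Program.Reach.one {i : Instr} (hi : P[c.pc]? = some i) (h : c.Bdd W)
    (h' : (i.exec c).Bdd W) : P.Reach W c 1 (i.exec c) := by
  have hs : P.step c = i.exec c := by simp [Program.step, hi]
  refine ⟨by simpa using hs, fun r hr => ?_⟩
  interval_cases r
  · exact h
  · simpa [hs] using h'

theorem Config.Bdd.setReg (h : c.Bdd W) {d v : ℕ} (hv : v ≤ W) : (c.setReg d v).Bdd W := by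
  intro j
  refine ⟨?_, (h j).2⟩
  simp only [Config.setReg, Function.update_apply]
  split_ifs
  · exact hv
  · exact (h j).1

theorem Config.Bdd.store (h : c.Bdd W) {q i v : ℕ} (hv : v ≤ W) :
    (Config.mk q c.reg (Function.update c.mem i v)).Bdd W := by
  intro j
  refine ⟨(h j).1, ?_⟩
  simp only [Function.update_apply]
  split_ifs
  · exact hv
  · exact (h j).2

end

/-- All variables and array cells are at most `V`. -/
def State.Bdd (V : ℕ) (σ : State) : Prop := (∀ x, σ.var x ≤ V) ∧ ∀ a j, σ.arr a j ≤ V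

/-- The configuration `c` represents the state `σ`. -/
structure Sim (inp : ℕ → ℕ) (L : ℕ) (σ : State) (c : Config) : Prop where
  var : ∀ x : Var, c.reg x.reg = σ.var x
  zero : c.reg 98 = 0
  base : c.reg 99 = L
  input : ∀ j < L, c.mem j = inp j
  arr : ∀ a j, c.mem (L + 16 * j + a.idx) = σ.arr a j

theorem Sim.of_agree {inp : ℕ → ℕ} {L : ℕ} {σ : State} {c c' : Config} (h : Sim inp L σ c)
    (hr : ∀ r < 100, c'.reg r = c.reg r) (hm : c'.mem = c.mem) : Sim inp L σ c' where
  var x := by rw [hr _ (by have := x.reg_lt; omega), h.var]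
  zero := by rw [hr _ (by omega), h.zero]
  base := by rw [hr _ (by omega), h.base]
  input := by rw [hm]; exact h.input
  arr := by rw [hm]; exact h.arr

/-! ### Correctness of compiled expressions and the size of their values -/

theorem Expr.eval_le {V : ℕ} (hV : 16 ≤ V) {σ : State} (hσ : σ.Bdd V) :
    ∀ e : Expr, e.litsSmall → e.eval σ ≤ V ^ e.deg := by
  have mono : ∀ {v a b : ℕ}, v ≤ V ^ a → a ≤ b → v ≤ V ^ b := fun h hab =>
    h.trans (Nat.pow_le_pow_right (by omega) hab)
  intro e
  induction e with
  | lit c => intro h; simp [litsSmall] at h; simp [deg, eval]; omega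
  | var x => intro h; simpa [deg, eval] using hσ.1 x
  | get a e ih =>
    intro h
    exact mono (by simpa [eval] using hσ.2 a (e.eval σ) : _ ≤ V ^ 1) (by simp [deg])
  | add e₁ e₂ h₁ h₂ =>
    intro h
    simp only [litsSmall, Bool.and_eq_true] at h
    have a := mono (h₁ h.1) (le_max_left e₁.deg e₂.deg)
    have b := mono (h₂ h.2) (le_max_right e₁.deg e₂.deg)
    simp only [deg, eval, pow_succ]
    nlinarith
  | sub e₁ e₂ h₁ h₂ =>
    intro h
    simp only [litsSmall, Bool.and_eq_true] at h
    have a := mono (h₁ h.1) (le_max_left e₁.deg e₂.deg)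
    simp only [deg, eval]
    omega
  | mul e₁ e₂ h₁ h₂ =>
    intro h
    simp only [litsSmall, Bool.and_eq_true] at h
    simp only [deg, eval, pow_add]
    exact Nat.mul_le_mul (h₁ h.1) (h₂ h.2)
  | div e₁ e₂ h₁ h₂ =>
    intro h
    simp only [litsSmall, Bool.and_eq_true] at h
    have a := mono (h₁ h.1) (le_max_left e₁.deg e₂.deg)
    simp only [deg, eval]
    exact (Nat.div_le_self _ _).trans a

/-- What a run of the code of an expression with value `v` and target register `t` does. -/
structure Computes (P : Program) (W : ℕ) (c : Config) (t v len : ℕ) (c' : Config) : Prop where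
  reach : P.Reach W c len c'
  pc : c'.pc = c.pc + len
  mem : c'.mem = c.mem
  reg : ∀ r < t, c'.reg r = c.reg r
  val : c'.reg t = v

theorem Computes.setReg {P : Program} {W : ℕ} {c c' : Config} {t v len w : ℕ} {i : Instr}
    (h : Computes P W c t v len c') (hi : P[c.pc + len]? = some i)
    (he : i.exec c' = c'.setReg t w) (hw : w ≤ W) :
    Computes P W c t w (len + 1) (c'.setReg t w) := by
  refine ⟨h.reach.trans (he ▸ Program.Reach.one (by rw [h.pc]; exact hi) h.reach.bdd_right
    (he ▸ h.reach.bdd_right.setReg hw)), ?_, h.mem, fun r hr => ?_, ?_⟩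
  · simp [Config.setReg, h.pc, add_assoc]
  · simp [Config.setReg, hr.ne, h.reg r hr]
  · simp [Config.setReg]

theorem Computes.setScratch {P : Program} {W : ℕ} {c c' : Config} {t v len w : ℕ}
    (h : Computes P W c t v len c') (hi : P[c.pc + len]? = some (.const (t + 1) w))
    (hw : w ≤ W) :
    Computes P W c t v (len + 1) (c'.setReg (t + 1) w) := by
  refine ⟨h.reach.trans (Program.Reach.one (i := .const (t + 1) w) (by rw [h.pc]; exact hi)
    h.reach.bdd_right (h.reach.bdd_right.setReg hw)), ?_, h.mem, fun r hr => ?_, ?_⟩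
  · simp [Config.setReg, h.pc, add_assoc]
  · simp [Config.setReg, (show r ≠ t + 1 by omega), h.reg r hr]
  · simp [Config.setReg, h.val]

section
variable {P : Program} {V : ℕ} {inp : ℕ → ℕ} {L : ℕ} {σ : State}

theorem Computes.addr {W : ℕ} {c c' : Config} {t v len : ℕ} (a : Arr) (ht : 100 ≤ t)
    (h : Computes P W c t v len c') (hs : Sim inp L σ c) (hW : L + 16 * v + 16 ≤ W)
    (hP : P.Has (c.pc + len) (Expr.addrCode a t)) :
    ∃ c'', Computes P W c t (L + 16 * v + a.idx) (len + 5) c'' := by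
  simp only [Expr.addrCode, Program.Has, and_true] at hP
  obtain ⟨h1, h2, h3, h4, h5⟩ := hP
  have ha := a.idx_lt
  have g1 := h.setScratch (w := 16) h1 (by omega)
  have g2 := g1.setReg (i := .mul t t (t + 1)) (w := 16 * v) h2
    (by simp only [Instr.exec]; rw [g1.val]; simp [Config.setReg, mul_comm]) (by omega)
  have g3 := g2.setReg (i := .add t t 99) (w := L + 16 * v) h3
    (by simp only [Instr.exec]; rw [g2.val, g2.reg 99 (by omega), hs.base, add_comm L]) (by omega)
  have g4 := g3.setScratch (w := a.idx) h4 (by omega)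
  have g5 := g4.setReg (i := .add t t (t + 1)) (w := L + 16 * v + a.idx) h5
    (by simp only [Instr.exec]; rw [g4.val]; simp [Config.setReg]) (by omega)
  exact ⟨_, g5⟩

/-- This is the reason for the summand `2` in the degree of an array access: the address exceeds the
index by a factor and a summand that two powers of `V` absorb. -/
theorem addr_le (hV : 16 ≤ V) (hL : L ≤ V) {v d : ℕ} (hd : 1 ≤ d) (hv : v ≤ V ^ d) :
    L + 16 * v + 16 ≤ V ^ (d + 2) := by
  have h1 : V ≤ V ^ d := Nat.le_self_pow (by omega) V
  have h2 : V ^ (d + 2) = V ^ d * (V * V) := by ring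
  have h3 : 256 ≤ V * V := by nlinarith
  rw [h2]
  nlinarith

theorem Computes.binop {W : ℕ} {c c₁ c₂ : Config} {t v₁ v₂ w l₁ l₂ : ℕ} {i : Instr}
    (h₁ : Computes P W c t v₁ l₁ c₁) (h₂ : Computes P W c₁ (t + 1) v₂ l₂ c₂)
    (hi : P[c.pc + l₁ + l₂]? = some i)
    (he : ∀ c : Config, c.reg t = v₁ → c.reg (t + 1) = v₂ → i.exec c = c.setReg t w)
    (hw : w ≤ W) : ∃ c', Computes P W c t w (l₁ + l₂ + 1) c' := by
  have g : Computes P W c t v₁ (l₁ + l₂) c₂ :=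
    ⟨h₁.reach.trans h₂.reach, by rw [h₂.pc, h₁.pc, add_assoc], by rw [h₂.mem, h₁.mem],
      fun r hr => by rw [h₂.reg r (by omega), h₁.reg r hr], by rw [h₂.reg t (by omega), h₁.val]⟩
  exact ⟨_, g.setReg (by rw [← add_assoc]; exact hi) (he _ g.val h₂.val) hw⟩

theorem Expr.computes (hV : 16 ≤ V) (hL : L ≤ V) (hσ : σ.Bdd V) :
    ∀ (e : Expr) (t : ℕ) (c : Config), 100 ≤ t → e.litsSmall → e.deg ≤ 64 → Sim inp L σ c →
      c.Bdd (V ^ 64) → P.Has c.pc (e.code t) →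
      ∃ c', Computes P (V ^ 64) c t (e.eval σ) e.cost c' := by
  intro e
  have bound : ∀ {e : Expr}, e.litsSmall → e.deg ≤ 64 → e.eval σ ≤ V ^ 64 := fun {e} h h' =>
    (e.eval_le hV hσ h).trans (Nat.pow_le_pow_right (by omega) h')
  induction e with
  | lit v =>
    intro t c ht hl hd hs hc hP
    have g : Computes P (V ^ 64) c t (c.reg t) 0 c :=
      ⟨.refl hc, rfl, rfl, fun _ _ => rfl, rfl⟩
    exact ⟨_, g.setReg (i := .const t v) hP.1 rfl (bound hl hd)⟩
  | var x =>
    intro t c ht hl hd hs hc hP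
    have g : Computes P (V ^ 64) c t (c.reg t) 0 c :=
      ⟨.refl hc, rfl, rfl, fun _ _ => rfl, rfl⟩
    exact ⟨_, g.setReg (i := .add t x.reg 98) hP.1
      (by simp only [Instr.exec]; rw [hs.var, hs.zero]; rfl) (bound hl hd)⟩
  | get a e ih =>
    intro t c ht hl hd hs hc hP
    simp only [Expr.code, Program.has_append, Expr.length_code] at hP
    simp only [deg] at hd
    obtain ⟨c₁, h₁⟩ := ih t c ht hl (by omega) hs hc hP.1
    obtain ⟨c₂, h₂⟩ := h₁.addr a ht hs ((addr_le hV hL e.one_le_deg (e.eval_le hV hσ hl)).trans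
      (Nat.pow_le_pow_right (by omega) hd)) hP.2.1
    exact ⟨_, h₂.setReg (i := .load t t) hP.2.2.1
      (by simp only [Instr.exec]; rw [h₂.val, h₂.mem, hs.arr]; rfl)
      ((hσ.2 _ _).trans (Nat.le_self_pow (by omega) V))⟩
  | add e₁ e₂ ih₁ ih₂ =>
    intro t c ht hl hd hs hc hP
    have hb := bound hl hd
    simp only [Expr.code, Program.has_append, Expr.length_code] at hP
    simp only [deg] at hd
    simp only [litsSmall, Bool.and_eq_true] at hl
    obtain ⟨c₁, h₁⟩ := ih₁ t c ht hl.1 (by omega) hs hc hP.1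
    obtain ⟨c₂, h₂⟩ := ih₂ (t + 1) c₁ (by omega) hl.2 (by omega)
      (hs.of_agree (fun r hr => h₁.reg r (by omega)) h₁.mem) h₁.reach.bdd_right
      (by rw [h₁.pc]; exact hP.2.1)
    exact h₁.binop h₂ hP.2.2.1 (fun c h h' => by simp [Instr.exec, h, h', eval]) hb
  | sub e₁ e₂ ih₁ ih₂ =>
    intro t c ht hl hd hs hc hP
    have hb := bound hl hd
    simp only [Expr.code, Program.has_append, Expr.length_code] at hP
    simp only [deg] at hd
    simp only [litsSmall, Bool.and_eq_true] at hl
    obtain ⟨c₁, h₁⟩ := ih₁ t c ht hl.1 (by omega) hs hc hP.1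
    obtain ⟨c₂, h₂⟩ := ih₂ (t + 1) c₁ (by omega) hl.2 (by omega)
      (hs.of_agree (fun r hr => h₁.reg r (by omega)) h₁.mem) h₁.reach.bdd_right
      (by rw [h₁.pc]; exact hP.2.1)
    exact h₁.binop h₂ hP.2.2.1 (fun c h h' => by simp [Instr.exec, h, h', eval]) hb
  | mul e₁ e₂ ih₁ ih₂ =>
    intro t c ht hl hd hs hc hP
    have hb := bound hl hd
    simp only [Expr.code, Program.has_append, Expr.length_code] at hP
    simp only [deg] at hd
    simp only [litsSmall, Bool.and_eq_true] at hl
    obtain ⟨c₁, h₁⟩ := ih₁ t c ht hl.1 (by omega) hs hc hP.1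
    obtain ⟨c₂, h₂⟩ := ih₂ (t + 1) c₁ (by omega) hl.2 (by omega)
      (hs.of_agree (fun r hr => h₁.reg r (by omega)) h₁.mem) h₁.reach.bdd_right
      (by rw [h₁.pc]; exact hP.2.1)
    exact h₁.binop h₂ hP.2.2.1 (fun c h h' => by simp [Instr.exec, h, h', eval]) hb
  | div e₁ e₂ ih₁ ih₂ =>
    intro t c ht hl hd hs hc hP
    have hb := bound hl hd
    simp only [Expr.code, Program.has_append, Expr.length_code] at hP
    simp only [deg] at hd
    simp only [litsSmall, Bool.and_eq_true] at hl
    obtain ⟨c₁, h₁⟩ := ih₁ t c ht hl.1 (by omega) hs hc hP.1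
    obtain ⟨c₂, h₂⟩ := ih₂ (t + 1) c₁ (by omega) hl.2 (by omega)
      (hs.of_agree (fun r hr => h₁.reg r (by omega)) h₁.mem) h₁.reach.bdd_right
      (by rw [h₁.pc]; exact hP.2.1)
    exact h₁.binop h₂ hP.2.2.1 (fun c h h' => by simp [Instr.exec, h, h', eval]) hb

end

/-! ### What a statement leaves unchanged -/

theorem Stmt.exec_var_of_notMem (inp : ℕ → ℕ) {y : Var} :
    ∀ (s : Stmt) (σ : State), y ∉ s.vars → (s.exec inp σ).var y = σ.var y := by
  intro s
  induction s with
  | skip => intro σ _; rfl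
  | assign x e => intro σ h; simp [Stmt.vars] at h; simp [Stmt.exec, h]
  | input x e => intro σ h; simp [Stmt.vars] at h; simp [Stmt.exec, h]
  | store a e₁ e₂ => intro σ _; rfl
  | seq s₁ s₂ h₁ h₂ =>
    intro σ h
    simp only [Stmt.vars, List.mem_append, not_or] at h
    simp only [Stmt.exec]
    rw [h₂ _ h.2, h₁ _ h.1]
  | ite e₁ e₂ s₁ s₂ h₁ h₂ =>
    intro σ h
    simp only [Stmt.vars, List.mem_append, not_or] at h
    simp only [Stmt.exec]
    split_ifs
    · exact h₁ _ h.1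
    · exact h₂ _ h.2
  | loop i x s ih =>
    intro σ h
    simp only [Stmt.vars, List.mem_cons, not_or] at h
    simp only [Stmt.exec]
    generalize σ.var x = t
    induction t with
    | zero => simp [h.1]
    | succ t iht =>
      rw [Function.iterate_succ_apply', Stmt.round, State.set_var, if_neg h.1, ih _ h.2, iht]

theorem Stmt.exec_arr_of_notMem (inp : ℕ → ℕ) {a : Arr} :
    ∀ (s : Stmt) (σ : State), a ∉ s.arrs → (s.exec inp σ).arr a = σ.arr a := by
  intro s
  induction s with
  | skip => intro σ _; rfl
  | assign x e => intro σ h; rfl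
  | input x e => intro σ h; rfl
  | store b e₁ e₂ =>
    intro σ h
    exact State.put_arr_of_ne _ _ _ _ _ (by simpa [Stmt.arrs] using h)
  | seq s₁ s₂ h₁ h₂ =>
    intro σ h
    simp only [Stmt.arrs, List.mem_append, not_or] at h
    simp only [Stmt.exec]
    rw [h₂ _ h.2, h₁ _ h.1]
  | ite e₁ e₂ s₁ s₂ h₁ h₂ =>
    intro σ h
    simp only [Stmt.arrs, List.mem_append, not_or] at h
    simp only [Stmt.exec]
    split_ifs
    · exact h₁ _ h.1
    · exact h₂ _ h.2
  | loop i x s ih =>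
    intro σ h
    simp only [Stmt.exec]
    generalize σ.var x = t
    induction t with
    | zero => rfl
    | succ t iht =>
      rw [Function.iterate_succ_apply', Stmt.round, State.set_arr, ih _ h, iht]

theorem State.Bdd.set {V : ℕ} {σ : State} (h : σ.Bdd V) {x : Var} {v : ℕ} (hv : v ≤ V) :
    (σ.set x v).Bdd V := by
  refine ⟨fun y => ?_, h.2⟩
  rw [State.set_var]
  split_ifs
  · exact hv
  · exact h.1 y

theorem State.Bdd.put {V : ℕ} {σ : State} (h : σ.Bdd V) {a : Arr} {i v : ℕ} (hv : v ≤ V) :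
    (σ.put a i v).Bdd V := by
  refine ⟨h.1, fun b j => ?_⟩
  rw [State.put_arr]
  split_ifs
  · exact hv
  · exact h.2 b j

/-! ### Simulation of statements by the machine -/

section
variable {P : Program} {V : ℕ} {inp : ℕ → ℕ} {L : ℕ} {σ : State}

theorem Sim.setReg {c : Config} (h : Sim inp L σ c) (x : Var) (v : ℕ) :
    Sim inp L (σ.set x v) (c.setReg x.reg v) where
  var y := by
    simp only [Config.setReg, Function.update_apply, State.set_var, Var.reg_injective.eq_iff, h.var]
  zero := by
    have := x.reg_lt
    simp only [Config.setReg, Function.update_apply]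
    rw [if_neg (by omega), h.zero]
  base := by
    have := x.reg_lt
    simp only [Config.setReg, Function.update_apply]
    rw [if_neg (by omega), h.base]
  input := h.input
  arr := h.arr

theorem Sim.store {c : Config} (h : Sim inp L σ c) (a : Arr) (i v q : ℕ) :
    Sim inp L (σ.put a i v)
      ⟨q, c.reg, Function.update c.mem (L + 16 * i + a.idx) v⟩ where
  var := h.var
  zero := h.zero
  base := h.base
  input j hj := by
    simp only [Function.update_apply]
    rw [if_neg (by omega), h.input j hj]
  arr b j := by
    have ha := a.idx_lt
    have hb := b.idx_lt
    simp only [Function.update_apply, State.put_arr, h.arr]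
    refine if_congr ⟨fun e => ?_, ?_⟩ rfl rfl
    · exact ⟨Arr.idx_injective (by omega), by omega⟩
    · rintro ⟨rfl, rfl⟩; rfl

/-- The effect of running a piece of code from `c` that should lead to the state `σ'`. -/
structure Runs (P : Program) (inp : ℕ → ℕ) (L V : ℕ) (c : Config) (T q : ℕ) (σ' : State)
    (c' : Config) : Prop where
  reach : ∃ t ≤ T, P.Reach (V ^ 64) c t c'
  pc : c'.pc = q
  sim : Sim inp L σ' c'
  bdd : σ'.Bdd V

theorem Runs.cbdd {c c' : Config} {T q : ℕ} {σ' : State} (h : Runs P inp L V c T q σ' c') :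
    c'.Bdd (V ^ 64) := by
  obtain ⟨t, -, h⟩ := h.reach
  exact h.bdd_right

theorem Runs.prepend {c c₁ c' : Config} {t T q : ℕ} {σ' : State}
    (h₁ : P.Reach (V ^ 64) c t c₁) (h : Runs P inp L V c₁ T q σ' c') :
    Runs P inp L V c (t + T) q σ' c' := by
  obtain ⟨⟨t', ht', hr⟩, h2, h3, h4⟩ := h
  exact ⟨⟨t + t', by omega, h₁.trans hr⟩, h2, h3, h4⟩

theorem Runs.trans {c c₁ c' : Config} {T₁ T q₁ q : ℕ} {σ₁ σ' : State}
    (h₁ : Runs P inp L V c T₁ q₁ σ₁ c₁) (h : Runs P inp L V c₁ T q σ' c') :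
    Runs P inp L V c (T₁ + T) q σ' c' := by
  obtain ⟨⟨t, ht, hr⟩, -⟩ := h₁
  obtain ⟨⟨t', ht', hr'⟩, h2, h3, h4⟩ := h
  exact ⟨⟨t + t', by omega, hr.trans hr'⟩, h2, h3, h4⟩

theorem Runs.mono {c c' : Config} {T T' q : ℕ} {σ' : State}
    (h : Runs P inp L V c T q σ' c') (hT : T ≤ T') : Runs P inp L V c T' q σ' c' := by
  obtain ⟨⟨t, ht, hr⟩, h2, h3, h4⟩ := h
  exact ⟨⟨t, by omega, hr⟩, h2, h3, h4⟩

theorem Runs.jump {c c' : Config} {T q q' : ℕ} {σ' : State}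
    (h : Runs P inp L V c T q σ' c') (hi : P[q]? = some (.jump q')) :
    Runs P inp L V c (T + 1) q' σ' ⟨q', c'.reg, c'.mem⟩ := by
  have hb := h.cbdd
  obtain ⟨⟨t, ht, hr⟩, h2, h3, h4⟩ := h
  exact ⟨⟨t + 1, by omega, hr.trans (.one (i := .jump q') (by rw [h2]; exact hi) hb hb)⟩,
    rfl, ⟨h3.var, h3.zero, h3.base, h3.input, h3.arr⟩, h4⟩

/-- Induction on the statement. `Sim` ignores the registers from `100` on and expressions write only
there, so evaluating an expression preserves the represented state. Jumps are absolute, which is why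
the code is required to sit at the position for which it was generated. -/
theorem Stmt.runs (hV : 16 ≤ V) (hL : L ≤ V) (hinp : ∀ j < L, inp j ≤ V) :
    ∀ (s : Stmt) (σ : State) (c : Config), s.wf → s.Safe inp L V σ → σ.Bdd V → Sim inp L σ c →
      c.Bdd (V ^ 64) → P.Has c.pc (s.code c.pc) →
      ∃ c', Runs P inp L V c (s.cost inp σ) (c.pc + s.size) (s.exec inp σ) c' := by
  have hVW : V ≤ V ^ 64 := Nat.le_self_pow (by omega) V
  intro s
  induction s with
  | skip =>
    intro σ c _ _ hσ hs hc _
    exact ⟨c, ⟨0, le_rfl, .refl hc⟩, rfl, hs, hσ⟩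
  | assign x e =>
    intro σ c hw hsafe hσ hs hc hP
    simp only [Stmt.wf, Expr.wf, Bool.and_eq_true, decide_eq_true_eq] at hw
    simp only [Stmt.Safe] at hsafe
    simp only [Stmt.code, Program.has_append, Expr.length_code] at hP
    obtain ⟨c₁, h₁⟩ := e.computes hV hL hσ 100 c le_rfl hw.1 hw.2 hs hc hP.1
    have hs₁ := hs.of_agree (fun r hr => h₁.reg r (by omega)) h₁.mem
    have he : (Instr.add x.reg 100 98).exec c₁ = c₁.setReg x.reg (e.eval σ) := by
      simp only [Instr.exec]; rw [h₁.val, hs₁.zero, add_zero]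
    have hb := h₁.reach.bdd_right
    have hr := Program.Reach.one (P := P) (i := .add x.reg 100 98) (by rw [h₁.pc]; exact hP.2.1) hb
      (he ▸ hb.setReg (hsafe.trans hVW))
    rw [he] at hr
    refine ⟨_, ⟨_, le_rfl, h₁.reach.trans hr⟩, ?_, hs₁.setReg x _, hσ.set hsafe⟩
    simp [Config.setReg, h₁.pc, Stmt.size, add_assoc]
  | input x e =>
    intro σ c hw hsafe hσ hs hc hP
    simp only [Stmt.wf, Expr.wf, Bool.and_eq_true, decide_eq_true_eq] at hw
    simp only [Stmt.Safe] at hsafe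
    simp only [Stmt.code, Program.has_append, Expr.length_code] at hP
    obtain ⟨c₁, h₁⟩ := e.computes hV hL hσ 100 c le_rfl hw.1 hw.2 hs hc hP.1
    have hs₁ := hs.of_agree (fun r hr => h₁.reg r (by omega)) h₁.mem
    have he : (Instr.load x.reg 100).exec c₁ = c₁.setReg x.reg (inp (e.eval σ)) := by
      simp only [Instr.exec]; rw [h₁.val, hs₁.input _ hsafe]
    have hb := h₁.reach.bdd_right
    have hv := hinp _ hsafe
    have hr := Program.Reach.one (P := P) (i := .load x.reg 100) (by rw [h₁.pc]; exact hP.2.1) hb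
      (he ▸ hb.setReg (hv.trans hVW))
    rw [he] at hr
    refine ⟨_, ⟨_, le_rfl, h₁.reach.trans hr⟩, ?_, hs₁.setReg x _, hσ.set hv⟩
    simp [Config.setReg, h₁.pc, Stmt.size, add_assoc]
  | store a e₁ e₂ =>
    intro σ c hw hsafe hσ hs hc hP
    simp only [Stmt.wf, Expr.wf, Bool.and_eq_true, decide_eq_true_eq] at hw
    simp only [Stmt.Safe] at hsafe
    simp only [Stmt.code, Program.has_append, Expr.length_code] at hP
    obtain ⟨⟨⟨hl₁, hd₁⟩, hl₂, hd₂⟩, hd₃⟩ := hw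
    obtain ⟨c₁, h₁⟩ := e₁.computes hV hL hσ 100 c le_rfl hl₁ hd₁ hs hc hP.1
    obtain ⟨c₂, h₂⟩ := h₁.addr a le_rfl hs ((addr_le hV hL e₁.one_le_deg
      (e₁.eval_le hV hσ hl₁)).trans (Nat.pow_le_pow_right (by omega) hd₃)) hP.2.1
    have hs₂ := hs.of_agree (fun r hr => h₂.reg r (by omega)) h₂.mem
    obtain ⟨c₃, h₃⟩ := e₂.computes hV hL hσ 101 c₂ (by omega) hl₂ hd₂ hs₂ h₂.reach.bdd_right
      (by rw [h₂.pc]; exact hP.2.2.1)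
    have hs₃ := hs₂.of_agree (fun r hr => h₃.reg r (by omega)) h₃.mem
    have hb := h₃.reach.bdd_right
    have he : (Instr.store 100 101).exec c₃ =
        ⟨c₃.pc + 1, c₃.reg, Function.update c₃.mem (L + 16 * e₁.eval σ + a.idx) (e₂.eval σ)⟩ := by
      simp only [Instr.exec]; rw [h₃.val, h₃.reg 100 (by omega), h₂.val]
    have hr := Program.Reach.one (P := P) (i := .store 100 101)
      (by rw [h₃.pc, h₂.pc]; exact hP.2.2.2.1) hb (he ▸ hb.store (hsafe.trans hVW))
    rw [he] at hr
    refine ⟨_, ⟨_, ?_, (h₂.reach.trans h₃.reach).trans hr⟩, ?_, hs₃.store a _ _ _, hσ.put hsafe⟩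
    · simp only [Stmt.cost]; omega
    · simp only [h₃.pc, h₂.pc, Stmt.size]; omega
  | seq s₁ s₂ ih₁ ih₂ =>
    intro σ c hw hsafe hσ hs hc hP
    simp only [Stmt.wf, Bool.and_eq_true] at hw
    simp only [Stmt.code, Program.has_append, Stmt.length_code] at hP
    obtain ⟨c₁, h₁⟩ := ih₁ σ c hw.1 hsafe.1 hσ hs hc hP.1
    obtain ⟨c₂, h₂⟩ := ih₂ _ c₁ hw.2 hsafe.2 h₁.bdd h₁.sim h₁.cbdd (by rw [h₁.pc]; exact hP.2)
    refine ⟨c₂, ?_⟩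
    have := h₁.trans h₂
    rwa [h₁.pc, add_assoc] at this
  | ite e₁ e₂ s₁ s₂ ih₁ ih₂ =>
    intro σ c hw hsafe hσ hs hc hP
    simp only [Stmt.wf, Expr.wf, Bool.and_eq_true, decide_eq_true_eq] at hw
    obtain ⟨⟨⟨⟨hl₁, hd₁⟩, hl₂, hd₂⟩, hw₁⟩, hw₂⟩ := hw
    simp only [Stmt.code, Program.has_append, Expr.length_code, Program.Has,
      Stmt.length_code] at hP
    obtain ⟨hP₁, hP₂, hj, hP₃, hj', hP₄⟩ := hP
    obtain ⟨c₁, h₁⟩ := e₁.computes hV hL hσ 100 c le_rfl hl₁ hd₁ hs hc hP₁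
    have hs₁ := hs.of_agree (fun r hr => h₁.reg r (by omega)) h₁.mem
    obtain ⟨c₂, h₂⟩ := e₂.computes hV hL hσ 101 c₁ (by omega) hl₂ hd₂ hs₁ h₁.reach.bdd_right
      (by rw [h₁.pc]; exact hP₂)
    have hs₂ := hs₁.of_agree (fun r hr => h₂.reg r (by omega)) h₂.mem
    have hb := h₂.reach.bdd_right
    have hpc : c₂.pc = c.pc + e₁.cost + e₂.cost := by rw [h₂.pc, h₁.pc]
    have h100 : c₂.reg 100 = e₁.eval σ := by rw [h₂.reg 100 (by omega), h₁.val]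
    have hr := (h₁.reach.trans h₂.reach).trans
      (Program.Reach.one (P := P)
        (i := .jumpLt 100 101 (c.pc + e₁.cost + e₂.cost + 1 + s₂.size + 1))
        (by rw [hpc]; exact hj) hb hb)
    simp only [Instr.exec, h100, h₂.val, hpc] at hr
    simp only [Stmt.Safe] at hsafe
    simp only [Stmt.cost, Stmt.exec, Stmt.size]
    split_ifs with hlt
    · rw [if_pos hlt] at hr hsafe
      obtain ⟨c₃, h₃⟩ := ih₁ σ ⟨c.pc + e₁.cost + e₂.cost + 1 + s₂.size + 1, c₂.reg, c₂.mem⟩ hw₁ hsafe hσ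
        ⟨hs₂.var, hs₂.zero, hs₂.base, hs₂.input, hs₂.arr⟩ hb
        (by convert hP₄ using 1)
      refine ⟨c₃, ?_⟩
      have := (h₃.prepend hr).mono (show _ ≤ e₁.cost + e₂.cost + 2 + s₁.cost inp σ by omega)
      convert this using 1
      simp only; omega
    · rw [if_neg hlt] at hr hsafe
      obtain ⟨c₃, h₃⟩ := ih₂ σ ⟨c.pc + e₁.cost + e₂.cost + 1, c₂.reg, c₂.mem⟩ hw₂ hsafe hσ
        ⟨hs₂.var, hs₂.zero, hs₂.base, hs₂.input, hs₂.arr⟩ hb hP₃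
      have := (h₃.prepend hr).jump hj'
      rw [show c.pc + (e₁.cost + e₂.cost + 2 + s₁.size + s₂.size) =
        c.pc + e₁.cost + e₂.cost + 1 + s₂.size + 1 + s₁.size by omega]
      exact ⟨_, this.mono (by omega)⟩
  | loop i x s ih =>
    intro σ c hw hsafe hσ hs hc hP
    simp only [Stmt.wf, Bool.and_eq_true, decide_eq_true_eq] at hw
    obtain ⟨⟨⟨hw, hix⟩, his⟩, hxs⟩ := hw
    simp only [Stmt.Safe] at hsafe
    simp only [Stmt.code, Program.has_append, Program.Has, Stmt.length_code] at hP
    obtain ⟨hp0, hp1, hp2, hp3, hp4, hp5, hp6, -⟩ := hP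
    have hX := hσ.1 x
    -- After `t` rounds the machine stands at the test of the loop, with `t` in the counter and the
    -- bound unchanged. A round adds four instructions to the body: test, constant, increment and
    -- jump back. The initialisation counted here, the failing test and the exit jump make up the
    -- final `3` of the cost.
    have key : ∀ t ≤ σ.var x, ∃ c', Runs P inp L V c
        ((∑ t ∈ Finset.range t,
          (s.cost inp ((Stmt.round i (s.exec inp))^[t] (σ.set i 0)) + 4)) + 1)
        (c.pc + 1) ((Stmt.round i (s.exec inp))^[t] (σ.set i 0)) c' ∧
        ((Stmt.round i (s.exec inp))^[t] (σ.set i 0)).var i = t ∧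
        ((Stmt.round i (s.exec inp))^[t] (σ.set i 0)).var x = σ.var x := by
      intro t
      induction t with
      | zero =>
        intro _
        have hr := Program.Reach.one hp0 hc (hc.setReg (d := i.reg) (Nat.zero_le _))
        refine ⟨_, ⟨⟨_, le_rfl, hr⟩, rfl, hs.setReg i 0, hσ.set (Nat.zero_le _)⟩, by simp, ?_⟩
        simp [Ne.symm hix]
      | succ t iht =>
        intro ht
        obtain ⟨c₁, h₁, hi₁, hx₁⟩ := iht (by omega)
        generalize hτ : (Stmt.round i (s.exec inp))^[t] (σ.set i 0) = τ at h₁ hi₁ hx₁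
        have hb₁ := h₁.cbdd
        have hr := Program.Reach.one (P := P) (i := .jumpLt i.reg x.reg (c.pc + 3))
          (by rw [h₁.pc]; exact hp1) hb₁ hb₁
        simp only [Instr.exec, h₁.sim.var, hi₁, hx₁] at hr
        rw [if_pos (by omega)] at hr
        obtain ⟨c₂, h₂⟩ := ih τ ⟨c.pc + 3, c₁.reg, c₁.mem⟩ hw (hτ ▸ hsafe t (by omega)) h₁.bdd
          ⟨h₁.sim.var, h₁.sim.zero, h₁.sim.base, h₁.sim.input, h₁.sim.arr⟩ hb₁ hp3
        have hb₂ := h₂.cbdd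
        have hi₂ : (s.exec inp τ).var i = t := by rw [s.exec_var_of_notMem inp τ his, hi₁]
        have hx₂ : (s.exec inp τ).var x = σ.var x := by rw [s.exec_var_of_notMem inp τ hxs, hx₁]
        have hr₃ := Program.Reach.one (P := P) (i := .const 100 1) (by rw [h₂.pc]; exact hp4) hb₂
          (hb₂.setReg (d := 100) (v := 1) (by omega))
        have hb₃ := hr₃.bdd_right
        simp only [Instr.exec] at hr₃ hb₃
        have hs₃ : Sim inp L (s.exec inp τ) (c₂.setReg 100 1) :=
          h₂.sim.of_agree (fun r hr => by simp [Config.setReg, hr.ne]) rfl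
        have he : (Instr.add i.reg i.reg 100).exec (c₂.setReg 100 1) =
            (c₂.setReg 100 1).setReg i.reg (t + 1) := by
          simp only [Instr.exec]; rw [hs₃.var, hi₂]; simp [Config.setReg]
        have hr₄ := Program.Reach.one (P := P) (c := c₂.setReg 100 1)
          (i := .add i.reg i.reg 100) (by rw [Config.setReg, h₂.pc]; exact hp5) hb₃
          (he ▸ hb₃.setReg (by omega))
        rw [he] at hr₄
        have hs₄ := hs₃.setReg i (t + 1)
        have hrun : Runs P inp L V c _ (c.pc + 3 + s.size + 1 + 1)
            ((s.exec inp τ).set i (t + 1)) ((c₂.setReg 100 1).setReg i.reg (t + 1)) :=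
          h₁.trans ((h₂.prepend hr).trans ⟨⟨_, le_rfl, hr₃.trans hr₄⟩,
            by simp [Config.setReg, h₂.pc], hs₄, h₂.bdd.set (by omega)⟩)
        have hrun' := hrun.jump hp6
        rw [Function.iterate_succ_apply', hτ]
        simp only [Stmt.round, hi₂]
        refine ⟨_, hrun'.mono ?_, by simp, by simp [Ne.symm hix, hx₂]⟩
        rw [Finset.sum_range_succ, hτ]
        omega
    obtain ⟨c₁, h₁, hi₁, hx₁⟩ := key (σ.var x) le_rfl
    simp only [Stmt.cost, Stmt.exec, Stmt.size]
    generalize (Stmt.round i (s.exec inp))^[σ.var x] (σ.set i 0) = τ at h₁ hi₁ hx₁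
    have hb₁ := h₁.cbdd
    have hr := Program.Reach.one (P := P) (i := .jumpLt i.reg x.reg (c.pc + 3))
          (by rw [h₁.pc]; exact hp1) hb₁ hb₁
    simp only [Instr.exec, h₁.sim.var, hi₁, hx₁] at hr
    rw [if_neg (by omega), h₁.pc] at hr
    have hrun : Runs P inp L V c _ (c.pc + 1 + 1) τ ⟨c.pc + 1 + 1, c₁.reg, c₁.mem⟩ :=
      h₁.trans ⟨⟨_, le_rfl, hr⟩, rfl,
        ⟨h₁.sim.var, h₁.sim.zero, h₁.sim.base, h₁.sim.input, h₁.sim.arr⟩, h₁.bdd⟩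
    have := hrun.jump hp2
    rw [add_assoc] at this
    exact ⟨_, this⟩

end

/-- The program that runs `s`. -/
def Stmt.program (s : Stmt) : Program := .add 99 0 98 :: s.code 1

/-- The state in which programs start. -/
def State.start (L : ℕ) : State := ⟨fun x => if x = Var.len then L else 0, fun _ _ => 0⟩

/-- A single instruction, copying the length to register `99`, makes the initial configuration
represent `State.start`: register `98` and the memory behind the input are `0` from the outset. -/
theorem Stmt.decidesWithin (s : Stmt) (hw : s.wf) (x : List ℕ) (b : Prop) {V T B : ℕ}
    (hV : 16 ≤ V) (hL : x.length ≤ V) (hx : ∀ y ∈ x, y ≤ V)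
    (hsafe : s.Safe (fun j => x.getD j 0) x.length V (.start x.length))
    (hT : s.cost (fun j => x.getD j 0) (.start x.length) + 1 ≤ T)
    (hB : V ^ 64 < 2 ^ B)
    (hb : (b ∧ (s.exec (fun j => x.getD j 0) (.start x.length)).var .len = 1) ∨
      (¬ b ∧ (s.exec (fun j => x.getD j 0) (.start x.length)).var .len = 0)) :
    s.program.DecidesWithin x b T B := by
  have hVW : V ≤ V ^ 64 := Nat.le_self_pow (by omega) V
  have hget : ∀ j, x.getD j 0 ≤ V := by
    intro j
    rcases lt_or_ge j x.length with hj | hj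
    · rw [List.getD_eq_getElem _ _ hj]; exact hx _ (List.getElem_mem hj)
    · rw [List.getD_eq_default _ _ hj]; omega
  have hc0 : (init x).Bdd (V ^ 64) := by
    intro j
    refine ⟨?_, (hget j).trans hVW⟩
    simp only [init]
    split_ifs <;> omega
  have hhas : s.program.Has 1 (s.code 1) := Program.has_of_append [_] _
  have hr : s.program.Reach (V ^ 64) (init x) 1 ((init x).setReg 99 x.length) := by
    have he : (Instr.add 99 0 98).exec (init x) = (init x).setReg 99 x.length := by
      simp [Instr.exec, init]
    exact he ▸ Program.Reach.one (i := .add 99 0 98) (by simp [Stmt.program, init]) hc0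
      (he ▸ hc0.setReg (hL.trans hVW))
  have hsim : Sim (fun j => x.getD j 0) x.length (.start x.length)
      ((init x).setReg 99 x.length) := by
    refine ⟨fun y => ?_, by simp [Config.setReg, init], by simp [Config.setReg],
      fun _ _ => rfl, fun a j => ?_⟩
    · have := y.reg_lt
      simp only [Config.setReg, Function.update_apply, init, State.start]
      rw [if_neg (by omega)]
      exact if_congr (Var.reg_injective.eq_iff (b := Var.len)) rfl rfl
    · simp only [Config.setReg, init, State.start]
      exact List.getD_eq_default _ _ (by omega)
  have hσ : (State.start x.length).Bdd V := by
    refine ⟨fun y => ?_, fun _ _ => Nat.zero_le _⟩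
    simp only [State.start]
    split_ifs <;> omega
  obtain ⟨c, hc⟩ := s.runs hV hL (fun j _ => hget j) _ _ hw hsafe hσ hsim hr.bdd_right hhas
  obtain ⟨t, ht, hc'⟩ := (hc.prepend hr).reach
  have hlen : c.reg 0 = (s.exec (fun j => x.getD j 0) (.start x.length)).var .len :=
    hc.sim.var .len
  refine ⟨t, by omega, ?_, ?_, fun r hrt j => ?_⟩
  · rw [Program.run, hc'.eq, Program.Halted, hc.pc]
    simp [Stmt.program, Stmt.length_code, Config.setReg, init, add_comm]
  · rw [Program.run, hc'.eq, hlen]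
    exact hb
  · have := hc'.bdd r hrt j
    exact ⟨this.1.trans_lt hB, this.2.trans_lt hB⟩

end RAM

/-! ### Exterior products as functions on bit masks -/

section Wedge

variable {F : Type*} [CommRing F]

/-- The exterior product of the vector `w` in `F ^ K` with the element `f` of the exterior algebra,
where `f S` is the coefficient at the set of the positions of the binary digits `1` of `S`. -/
def wedge : ℕ → (ℕ → F) → (ℕ → F) → ℕ → F
  | 0, _, _, _ => 0
  | K + 1, w, f, S =>
    if S % 2 = 0 then wedge K (fun j => w (j + 1)) (fun r => f (2 * r)) (S / 2)
    else w 0 * f (2 * (S / 2)) - wedge K (fun j => w (j + 1)) (fun r => f (2 * r + 1)) (S / 2)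

theorem wedge_two_mul (K : ℕ) (w f : ℕ → F) (r : ℕ) :
    wedge (K + 1) w f (2 * r) = wedge K (fun j => w (j + 1)) (fun r => f (2 * r)) r := by
  rw [wedge, if_pos (by omega)]; congr 1; omega

theorem wedge_two_mul_add_one (K : ℕ) (w f : ℕ → F) (r : ℕ) :
    wedge (K + 1) w f (2 * r + 1) =
      w 0 * f (2 * r) - wedge K (fun j => w (j + 1)) (fun r => f (2 * r + 1)) r := by
  rw [wedge, if_neg (by omega), show (2 * r + 1) / 2 = r by omega]

theorem wedge_add_smul (K : ℕ) (w f g : ℕ → F) (c d : F) (S : ℕ) :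
    wedge K w (fun S => c * f S + d * g S) S = c * wedge K w f S + d * wedge K w g S := by
  induction K generalizing w f g S with
  | zero => simp [wedge]
  | succ K ih => simp only [wedge, ih]; split_ifs <;> ring

theorem wedge_add_smul_left (K : ℕ) (w v f : ℕ → F) (c d : F) (S : ℕ) :
    wedge K (fun j => c * w j + d * v j) f S = c * wedge K w f S + d * wedge K v f S := by
  induction K generalizing w v f S with
  | zero => simp [wedge]
  | succ K ih => simp only [wedge, ih]; split_ifs <;> ring

theorem wedge_congr {K : ℕ} {w v : ℕ → F} (h : ∀ j < K, w j = v j) (f : ℕ → F) :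
    wedge K w f = wedge K v f := by
  induction K generalizing w v f with
  | zero => rfl
  | succ K ih =>
    funext S
    simp only [wedge, h 0 (by omega),
      ih (w := fun j => w (j + 1)) (v := fun j => v (j + 1)) (fun j hj => h _ (by omega))]

theorem wedge_zero_left (K : ℕ) (f : ℕ → F) (S : ℕ) : wedge K (fun _ => 0) f S = 0 := by
  simpa using wedge_add_smul_left K (fun _ => 0) (fun _ => 0) f 0 0 S

/-- Induction on the lowest digit of `S`. If it is `0`, the claim is that for the shortened vector.
If it is `1`, the two terms with the factor `w 0` cancel by linearity, and what remains is again a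
double product with the shortened vector. -/
theorem wedge_self (K : ℕ) (w f : ℕ → F) (S : ℕ) : wedge K w (wedge K w f) S = 0 := by
  induction K generalizing w f S with
  | zero => rfl
  | succ K ih =>
    rcases Nat.even_or_odd' S with ⟨r, rfl | rfl⟩
    · simp only [wedge_two_mul]
      exact ih _ _ _
    · simp only [wedge_two_mul_add_one, wedge_two_mul]
      have := wedge_add_smul K (fun j => w (j + 1)) (fun r => f (2 * r))
        (wedge K (fun j => w (j + 1)) (fun r => f (2 * r + 1))) (w 0) (-1) r
      rw [ih] at this
      simp only [neg_mul, one_mul, ← sub_eq_add_neg] at this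
      rw [this]
      ring

/-- Functions supported on the masks below `2 ^ K` are preserved, so storing `2 ^ K` coefficients
suffices. -/
theorem wedge_eq_zero_of_le {K : ℕ} (w : ℕ → F) {f : ℕ → F} (hf : ∀ S, 2 ^ K ≤ S → f S = 0)
    {S : ℕ} (hS : 2 ^ K ≤ S) : wedge K w f S = 0 := by
  induction K generalizing w f S with
  | zero => rfl
  | succ K ih =>
    rw [pow_succ] at hS hf
    simp only [wedge]
    split_ifs with h
    · exact ih _ (fun S hS => hf _ (by omega)) (by omega)
    · rw [hf _ (by omega), ih _ (fun S hS => hf _ (by omega)) (by omega)]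
      simp

/-- `wedge` as a linear map. -/
def wedgeHom (F : Type*) [CommRing F] (K : ℕ) : (ℕ → F) →ₗ[F] Module.End F (ℕ → F) :=
  LinearMap.mk₂ F (wedge K)
    (fun w v f => by
      funext S
      have := wedge_add_smul_left K w v f 1 1 S
      simp only [one_mul] at this
      exact this)
    (fun c w f => by
      funext S
      have := wedge_add_smul_left K w (fun _ => 0) f c 0 S
      simp only [zero_mul, add_zero] at this
      exact this)
    (fun w f g => by
      funext S
      have := wedge_add_smul K w f g 1 1 S
      simp only [one_mul] at this
      exact this)
    (fun c w f => by
      funext S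
      have := wedge_add_smul K w f (fun _ => 0) c 0 S
      simp only [zero_mul, add_zero] at this
      exact this)

@[simp] theorem wedgeHom_apply (K : ℕ) (w f : ℕ → F) : wedgeHom F K w f = wedge K w f := rfl

/-- The action of the exterior algebra given by `wedge`. -/
noncomputable def wedgeAction (F : Type*) [CommRing F] (K : ℕ) :
    ExteriorAlgebra F (ℕ → F) →ₐ[F] Module.End F (ℕ → F) :=
  ExteriorAlgebra.lift F ⟨wedgeHom F K, fun w => by
    ext f S; exact wedge_self K w f S⟩

/-- The exterior product of the vectors `w`, from left to right. -/
def wedgeList (K : ℕ) (L : List (ℕ → F)) : ℕ → F := L.foldr (wedge K) (Pi.single 0 1)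

/-- Realising the product through the exterior algebra provides multilinearity and alternation for
the explicit recursion on masks. -/
theorem wedgeAction_ofFn (K : ℕ) {r : ℕ} (v : Fin r → ℕ → F) :
    wedgeAction F K (ExteriorAlgebra.ιMulti F r v) (Pi.single 0 1) =
      wedgeList K (List.ofFn v) := by
  induction r with
  | zero => simp [wedgeList]
  | succ r ih =>
    rw [ExteriorAlgebra.ιMulti_succ_apply, map_mul, Module.End.mul_apply, ih, List.ofFn_succ]
    simp [wedgeAction, wedgeList, ExteriorAlgebra.lift_ι_apply, Matrix.vecTail, Function.comp_def]

theorem wedgeList_eq_zero_of_not_nodup (K : ℕ) {L : List (ℕ → F)} (h : ¬ L.Nodup) :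
    wedgeList K L = 0 := by
  rw [List.nodup_iff_injective_get] at h
  simp only [Function.Injective, not_forall] at h
  obtain ⟨i, j, hij, hne⟩ := h
  have := wedgeAction_ofFn K (fun i => L.get i)
  rw [List.ofFn_get] at this
  rw [← this, (ExteriorAlgebra.ιMulti F _).map_eq_zero_of_eq _ hij hne]
  simp

/-- The shifted basis vectors have no component at position `0`, so on even masks the product is
computed in one dimension less. -/
theorem wedgeList_map_shift (K : ℕ) (L : List ℕ) (r : ℕ) :
    wedgeList (K + 1) ((L.map Nat.succ).map fun j => (Pi.single j 1 : ℕ → F)) (2 * r) =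
      wedgeList K (L.map fun j => (Pi.single j 1 : ℕ → F)) r := by
  induction L generalizing r with
  | nil => simp [wedgeList, Pi.single_apply]
  | cons j L ih =>
    simp only [List.map_cons, wedgeList, List.foldr_cons] at ih ⊢
    rw [wedge_two_mul]
    simp only [ih]
    congr 1
    funext i
    simp [Pi.single_apply]

theorem wedgeList_standard (K : ℕ) :
    wedgeList K ((List.range K).map fun j => (Pi.single j 1 : ℕ → F)) (2 ^ K - 1) = 1 := by
  induction K with
  | zero => simp [wedgeList]
  | succ K ih =>
    have h1 : 1 ≤ 2 ^ K := Nat.one_le_two_pow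
    rw [List.range_succ_eq_map, List.map_cons, show 2 ^ (K + 1) - 1 = 2 * (2 ^ K - 1) + 1 by
      rw [pow_succ]; omega]
    simp only [wedgeList, List.foldr_cons] at ih ⊢
    rw [wedge_two_mul_add_one]
    have := wedgeList_map_shift (F := F) K (List.range K) (2 ^ K - 1)
    simp only [wedgeList] at this
    rw [this, ih]
    -- The first basis vector becomes zero when shifted, so the second term of the recursion
    -- vanishes.
    simp only [Pi.single_eq_same, mul_one, sub_eq_self]
    simp [wedge_zero_left]

/-- Extension of a finite sequence by zeros. -/
def extendHom (F : Type*) [CommRing F] (K : ℕ) : (Fin K → F) →ₗ[F] (ℕ → F) where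
  toFun w j := if h : j < K then w ⟨j, h⟩ else 0
  map_add' w v := by funext j; by_cases h : j < K <;> simp [h]
  map_smul' c w := by funext j; by_cases h : j < K <;> simp [h]

theorem wedgeList_congr {K : ℕ} {ι : Type*} (L : List ι) {v w : ι → ℕ → F}
    (h : ∀ i ∈ L, ∀ j < K, v i j = w i j) :
    wedgeList K (L.map v) = wedgeList K (L.map w) := by
  induction L with
  | nil => rfl
  | cons i L ih =>
    simp only [wedgeList, List.map_cons, List.foldr_cons] at ih ⊢
    rw [ih (fun i hi => h i (by simp [hi])), wedge_congr (h i (by simp))]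

/-- The coefficient at the full mask is an alternating form of degree `K` on `F ^ K` with value `1`
on the standard basis, hence the determinant. On the vectors of powers it is the Vandermonde
determinant, nonzero in a domain for distinct entries. -/
theorem wedgeList_pow_ne_zero [IsDomain F] {L : List F} (h : L.Nodup) :
    wedgeList L.length (L.map fun x j => x ^ j) (2 ^ L.length - 1) ≠ 0 := by
  set K := L.length with hK
  let g : (Fin K → F) [⋀^Fin K]→ₗ[F] F :=
    (((LinearMap.proj (2 ^ K - 1)).comp (LinearMap.applyₗ (Pi.single 0 1))).comp
      (wedgeAction F K).toLinearMap).compAlternatingMap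
        ((ExteriorAlgebra.ιMulti F K).compLinearMap (extendHom F K))
  have hg : ∀ v : Fin K → Fin K → F,
      g v = wedgeList K (List.ofFn fun i => extendHom F K (v i)) (2 ^ K - 1) := by
    intro v
    rw [← wedgeAction_ofFn]
    rfl
  have hd := g.eq_smul_basis_det (Pi.basisFun F (Fin K))
  have h1 : g (Pi.basisFun F (Fin K)) = 1 := by
    rw [hg, ← wedgeList_standard (F := F) K]
    congr 1
    refine List.ext_getElem (by simp) fun i hi hi' => ?_
    have hiK : i < K := by simpa using hi
    funext j
    rw [List.getElem_ofFn, List.getElem_map, List.getElem_range]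
    by_cases hj : j < K
    · simp [extendHom, Pi.single_apply, hj]
    · simp [extendHom, hj, show j ≠ i by omega]
  rw [h1, one_smul] at hd
  have h2 := hg (Matrix.vandermonde L.get)
  rw [hd, Pi.basisFun_det] at h2
  have h3 : wedgeList K (L.map fun x j => x ^ j) =
      wedgeList K (List.ofFn fun i => extendHom F K (Matrix.vandermonde L.get i)) := by
    have := wedgeList_congr (K := K) (List.finRange K) (v := fun i j => L.get i ^ j)
      (w := fun i => extendHom F K (Matrix.vandermonde L.get i))
      (fun i _ j hj => by simp [extendHom, hj, Matrix.vandermonde])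
    rw [← List.ofFn_eq_map, ← List.ofFn_eq_map] at this
    rw [← this]
    congr 1
    refine List.ext_getElem (by simp [hK]) fun i hi hi' => ?_
    simp
  rw [h3, ← h2]
  exact Matrix.det_vandermonde_ne_zero_iff.2 (List.nodup_iff_injective_get.1 h)

end Wedge

namespace RAM

/-! ### Total correctness with costs -/

/-- What `s` leaves unchanged between `σ` and `τ`. -/
structure Frame (s : Stmt) (σ τ : State) : Prop where
  var : ∀ y, y ∉ s.vars → τ.var y = σ.var y
  arr : ∀ a, a ∉ s.arrs → τ.arr a = σ.arr a

/-- Started in `σ`, the statement `s` is safe, costs at most `T` and leads to a state with `Q`. -/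
structure Spec (inp : ℕ → ℕ) (L V : ℕ) (s : Stmt) (σ : State) (T : ℕ) (Q : State → Prop) :
    Prop where
  safe : s.Safe inp L V σ
  cost : s.cost inp σ ≤ T
  post : Q (s.exec inp σ)

namespace Spec

variable {inp : ℕ → ℕ} {L V : ℕ} {σ : State} {T T₁ T₂ T' : ℕ} {Q Q' : State → Prop}
  {s s₁ s₂ : Stmt} {x : Var} {e e₁ e₂ : Expr} {a : Arr}

theorem mono (h : Spec inp L V s σ T Q) (hT : T ≤ T') (hQ : ∀ τ, Q τ → Q' τ) :
    Spec inp L V s σ T' Q' := ⟨h.safe, h.cost.trans hT, hQ _ h.post⟩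

theorem of_le (h : Spec inp L V s σ T Q) (hT : T ≤ T') : Spec inp L V s σ T' Q :=
  h.mono hT fun _ => id

theorem frame (h : Spec inp L V s σ T Q) :
    Spec inp L V s σ T fun τ => Q τ ∧ Frame s σ τ :=
  ⟨h.safe, h.cost, h.post, fun _ hy => s.exec_var_of_notMem inp σ hy,
    fun _ ha => s.exec_arr_of_notMem inp σ ha⟩

theorem skip (h : Q σ) : Spec inp L V .skip σ 0 Q := ⟨trivial, le_rfl, h⟩

theorem assign (hv : e.eval σ ≤ V) (h : Q (σ.set x (e.eval σ))) :
    Spec inp L V (x ≔ e) σ (e.cost + 1) Q := ⟨hv, le_rfl, h⟩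

theorem input (hv : e.eval σ < L) (h : Q (σ.set x (inp (e.eval σ)))) :
    Spec inp L V (.input x e) σ (e.cost + 1) Q := ⟨hv, le_rfl, h⟩

theorem store (hv : e₂.eval σ ≤ V) (h : Q (σ.put a (e₁.eval σ) (e₂.eval σ))) :
    Spec inp L V (.store a e₁ e₂) σ (e₁.cost + e₂.cost + 6) Q := ⟨hv, le_rfl, h⟩

theorem seq (h₁ : Spec inp L V s₁ σ T₁ Q') (h₂ : ∀ τ, Q' τ → Spec inp L V s₂ τ T₂ Q) :
    Spec inp L V (s₁ ;; s₂) σ (T₁ + T₂) Q :=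
  have h := h₂ _ h₁.post
  ⟨⟨h₁.safe, h.safe⟩, Nat.add_le_add h₁.cost h.cost, h.post⟩

theorem assign_seq (hv : e.eval σ ≤ V) (h : Spec inp L V s (σ.set x (e.eval σ)) T Q) :
    Spec inp L V (x ≔ e ;; s) σ (e.cost + 1 + T) Q :=
  seq (Q' := fun τ => τ = σ.set x (e.eval σ)) (assign hv rfl) (by rintro _ rfl; exact h)

theorem input_seq (hv : e.eval σ < L) (h : Spec inp L V s (σ.set x (inp (e.eval σ))) T Q) :
    Spec inp L V (.input x e ;; s) σ (e.cost + 1 + T) Q :=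
  seq (Q' := fun τ => τ = σ.set x (inp (e.eval σ))) (input hv rfl) (by rintro _ rfl; exact h)

theorem store_seq (hv : e₂.eval σ ≤ V)
    (h : Spec inp L V s (σ.put a (e₁.eval σ) (e₂.eval σ)) T Q) :
    Spec inp L V (.store a e₁ e₂ ;; s) σ (e₁.cost + e₂.cost + 6 + T) Q :=
  seq (Q' := fun τ => τ = σ.put a (e₁.eval σ) (e₂.eval σ)) (store hv rfl)
    (by rintro _ rfl; exact h)

theorem ite (h₁ : e₁.eval σ < e₂.eval σ → Spec inp L V s₁ σ T Q)
    (h₂ : e₂.eval σ ≤ e₁.eval σ → Spec inp L V s₂ σ T Q) :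
    Spec inp L V (.ite e₁ e₂ s₁ s₂) σ (e₁.cost + e₂.cost + 2 + T) Q := by
  by_cases h : e₁.eval σ < e₂.eval σ
  · obtain ⟨a, b, c⟩ := h₁ h
    refine ⟨?_, ?_, ?_⟩
    · rwa [Stmt.Safe, if_pos h]
    · rw [Stmt.cost, if_pos h]; omega
    · rwa [Stmt.exec, if_pos h]
  · obtain ⟨a, b, c⟩ := h₂ (by omega)
    refine ⟨?_, ?_, ?_⟩
    · rwa [Stmt.Safe, if_neg h]
    · rw [Stmt.cost, if_neg h]; omega
    · rwa [Stmt.exec, if_neg h]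

/-- The rule for loops: an invariant `I` and a bound `B t` on the cost of the `t`-th round. -/
theorem loop_sum {i : Var} (I : ℕ → State → Prop) (B : ℕ → ℕ)
    (hw : i ≠ x ∧ i ∉ s.vars ∧ x ∉ s.vars) (h0 : I 0 (σ.set i 0))
    (hs : ∀ t τ, t < σ.var x → τ.var i = t → Frame (.loop i x s) σ τ → I t τ →
      Spec inp L V s τ (B t) fun τ' => I (t + 1) (τ'.set i (t + 1)))
    (hQ : ∀ τ, Frame (.loop i x s) σ τ → I (σ.var x) τ → Q τ) :
    Spec inp L V (.loop i x s) σ ((∑ t ∈ Finset.range (σ.var x), (B t + 4)) + 3) Q := by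
  obtain ⟨hix, hi, hx⟩ := hw
  have frame : ∀ t, Frame (.loop i x s) σ ((Stmt.round i (s.exec inp))^[t] (σ.set i 0)) := by
    intro t
    refine ⟨fun y hy => ?_, fun a ha => ?_⟩
    · simp only [Stmt.vars, List.mem_cons, not_or] at hy
      induction t with
      | zero => simp [hy.1]
      | succ t ih =>
        rw [Function.iterate_succ_apply', Stmt.round, State.set_var, if_neg hy.1,
          s.exec_var_of_notMem inp _ hy.2, ih]
    · simp only [Stmt.arrs] at ha
      induction t with
      | zero => rfl
      | succ t ih =>
        rw [Function.iterate_succ_apply', Stmt.round, State.set_arr,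
          s.exec_arr_of_notMem inp _ ha, ih]
  have count : ∀ t, ((Stmt.round i (s.exec inp))^[t] (σ.set i 0)).var i = t := by
    intro t
    induction t with
    | zero => simp
    | succ t ih =>
      rw [Function.iterate_succ_apply', Stmt.round, State.set_var, if_pos rfl,
        s.exec_var_of_notMem inp _ hi, ih]
  have inv : ∀ t ≤ σ.var x, I t ((Stmt.round i (s.exec inp))^[t] (σ.set i 0)) := by
    intro t
    induction t with
    | zero => intro _; exact h0
    | succ t ih =>
      intro ht
      have := (hs t _ (by omega) (count t) (frame t) (ih (by omega))).post
      rw [Function.iterate_succ_apply', Stmt.round, s.exec_var_of_notMem inp _ hi, count t]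
      exact this
  have key := fun t (ht : t < σ.var x) => hs t _ ht (count t) (frame t) (inv t ht.le)
  refine ⟨fun t ht => (key t ht).safe, ?_, hQ _ (frame _) (inv _ le_rfl)⟩
  rw [Stmt.cost]
  refine Nat.add_le_add_right (Finset.sum_le_sum fun t ht => ?_) 3
  have := (key t (Finset.mem_range.1 ht)).cost
  omega

theorem loop {i : Var} (I : ℕ → State → Prop) (B : ℕ)
    (hw : i ≠ x ∧ i ∉ s.vars ∧ x ∉ s.vars) (h0 : I 0 (σ.set i 0))
    (hs : ∀ t τ, t < σ.var x → τ.var i = t → Frame (.loop i x s) σ τ → I t τ →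
      Spec inp L V s τ B fun τ' => I (t + 1) (τ'.set i (t + 1)))
    (hQ : ∀ τ, Frame (.loop i x s) σ τ → I (σ.var x) τ → Q τ) :
    Spec inp L V (.loop i x s) σ (σ.var x * (B + 4) + 3) Q := by
  simpa using loop_sum I (fun _ => B) hw h0 hs hQ

end Spec

/-- The vector stored in the cells of an array from `o` on. -/
def vec (p D : ℕ) (f : ℕ → ℕ) (o : ℕ) : ℕ → ZMod p :=
  fun S => if S < D then (f (o + S) : ZMod p) else 0

/-- Handles one binary digit of `h` for the exterior product. -/
def wedgeDigit (x : Var) (src : Arr) : Stmt :=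
  .ite 0 (.mod Var.r 2)
    (.acc ≔ .mod (Var.acc + Var.sg * (Var.pw * .get src (Var.h - Var.bit))) Var.p ;;
      .sg ≔ Var.p - Var.sg)
    .skip ;;
  .r ≔ Var.r / 2 ;; .bit ≔ Var.bit * 2 ;; .pw ≔ .mod (Var.pw * x) Var.p

/-- The coefficient at `h` of the exterior product. -/
def wedgeCoeff (x : Var) (src dst : Arr) : Stmt :=
  .r ≔ Var.h ;; .bit ≔ 1 ;; .pw ≔ 1 ;; .acc ≔ 0 ;; .sg ≔ 1 ;;
    .loop .c .kk (wedgeDigit x src) ;; .store dst Var.h Var.acc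

/-- `dst := w ∧ src`, where `w = (1, x, x ^ 2, …)`. -/
def wedgeStmt (x : Var) (src dst : Arr) : Stmt := .loop .h .d (wedgeCoeff x src dst)

/-- The invariant of the loop over the digits of `S`. -/
structure DigitInv (p K S : ℕ) (X : ZMod p) (f : ℕ → ZMod p) (t : ℕ) (τ : State) : Prop where
  r : τ.var .r = S / 2 ^ t
  bit : τ.var .bit = 2 ^ t
  pw_lt : τ.var .pw < p
  pw : (τ.var .pw : ZMod p) = X ^ t
  acc_lt : τ.var .acc < p
  sg_le : τ.var .sg ≤ p
  acc : (τ.var .acc : ZMod p) + τ.var .sg * wedge (K - t) (fun j => X ^ (t + j))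
    (fun r => f (2 ^ t * r + S % 2 ^ t)) (S / 2 ^ t) = wedge K (fun j => X ^ j) f S

/-! ### Computing exterior products modulo `p` -/

section
variable {inp : ℕ → ℕ} {L V p K : ℕ} {x : Var} {src dst : Arr} {σ : State} {S : ℕ}

/-- The recursion for `wedge` is unrolled from the lowest digit upwards, `sg` holding the sign
accumulated so far. A digit `1` adds the term obtained by deleting it from `S` and flips the sign; a
digit `0` adds nothing. The digits already treated stay fixed in the argument of `f`. -/
theorem wedgeDigit_spec [Fact p.Prime] {t : ℕ} (ht : t < K) (hS : S < 2 ^ K)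
    (hx : x ≠ .r ∧ x ≠ .bit ∧ x ≠ .acc ∧ x ≠ .sg)
    (hp : σ.var .p = p) (hpV : p ≤ V) (hDV : 2 ^ K ≤ V) (hh : σ.var .h = S)
    (hI : DigitInv p K S (σ.var x) (vec p (2 ^ K) (σ.arr src) 0) t σ) :
    Spec inp L V (wedgeDigit x src) σ 110
      (DigitInv p K S (σ.var x) (vec p (2 ^ K) (σ.arr src) 0) (t + 1)) := by
  obtain ⟨hxr, hxb, hxa, hxs⟩ := hx
  obtain ⟨h1, h2, h3, h4, h5, h6, h7⟩ := hI
  have hp2 : 2 ≤ p := (Fact.out : p.Prime).two_le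
  set f := vec p (2 ^ K) (σ.arr src) 0 with hf
  set X : ZMod p := (σ.var x : ZMod p) with hX
  have hKt : K - t = (K - (t + 1)) + 1 := by omega
  have hSm : S % 2 ^ (t + 1) = S % 2 ^ t + 2 ^ t * (S / 2 ^ t % 2) := Nat.mod_pow_succ
  have hSd : S / 2 ^ (t + 1) = S / 2 ^ t / 2 := by rw [pow_succ, Nat.div_div_eq_div_mul]
  have hle : 2 ^ (t + 1) ≤ 2 ^ K := Nat.pow_le_pow_right (by omega) (by omega)
  have hSt : S / 2 ^ t ≤ S := Nat.div_le_self _ _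
  have hdm := Nat.div_add_mod S (2 ^ t)
  refine Spec.of_le (Spec.seq (T₁ := 70) (T₂ := 40) (Q' := fun ρ => ρ.var .r = S / 2 ^ t ∧
    ρ.var .bit = 2 ^ t ∧ ρ.var .pw < p ∧ (ρ.var .pw : ZMod p) = X ^ t ∧ ρ.var .acc < p ∧
    ρ.var .sg ≤ p ∧ ρ.var .p = p ∧ ρ.var x = σ.var x ∧
      (ρ.var .acc : ZMod p) + ρ.var .sg * wedge (K - (t + 1)) (fun j => X ^ (t + 1 + j))
        (fun r => f (2 ^ (t + 1) * r + S % 2 ^ (t + 1))) (S / 2 ^ (t + 1)) =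
          wedge K (fun j => X ^ j) f S)
    (Spec.of_le (Spec.ite (T := 60) (fun hodd => ?_) fun heven => ?_) (by decide))
    fun ρ hρ => ?_) (by decide)
  · simp only [Expr.eval_ofNat, Expr.eval_mod, Expr.eval_var, h1] at hodd
    refine Spec.of_le (Spec.assign_seq ?_ (Spec.assign ?_ ?_)) (by simp)
    · simp [hp]
      exact (Nat.mod_lt _ (by omega)).le.trans hpV
    · simp [hp]
      omega
    · obtain ⟨r', hr'⟩ : ∃ r', S / 2 ^ t = 2 * r' + 1 := ⟨S / 2 ^ t / 2, by omega⟩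
      have hr2 : (2 * r' + 1) / 2 = r' := by omega
      -- Digit `t` of `S` is `1`, so subtracting `2 ^ t` deletes exactly this digit.
      have hSb : S - 2 ^ t = 2 ^ t * (2 * r') + S % 2 ^ t := by
        rw [hr', mul_add] at hdm; omega
      have hfS : ((σ.arr src (S - 2 ^ t) : ℕ) : ZMod p) = f (2 ^ t * (2 * r') + S % 2 ^ t) := by
        rw [hf, vec, if_pos (by omega), zero_add, hSb]
      simp only [State.set_var, reduceCtorEq, if_true, if_false, Expr.eval_mod, Expr.eval_add,
        Expr.eval_mul, Expr.eval_sub, Expr.eval_get, Expr.eval_var, hp, hh, h2, h1, hxa, hxs]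
      refine ⟨trivial, trivial, h3, h4, Nat.mod_lt _ (by omega), by omega, trivial, trivial, ?_⟩
      rw [← h7, hKt, hSd, hr', hr2, hSm, hr', wedge_two_mul_add_one]
      have e1 : ∀ j, t + 1 + j = t + (j + 1) := fun j => by omega
      have e2 : ∀ r, 2 ^ (t + 1) * r + (S % 2 ^ t + 2 ^ t * ((2 * r' + 1) % 2)) =
          2 ^ t * (2 * r + 1) + S % 2 ^ t := fun r => by
        rw [show (2 * r' + 1) % 2 = 1 by omega]; ring
      simp only [e1, e2]
      rw [ZMod.natCast_mod]
      push_cast [Nat.cast_sub h6]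
      rw [hfS, h4]
      simp only [CharP.cast_eq_zero, add_zero]
      ring
  · simp only [Expr.eval_ofNat, Expr.eval_mod, Expr.eval_var, h1] at heven
    refine Spec.of_le (Spec.skip ⟨h1, h2, h3, h4, h5, h6, hp, rfl, ?_⟩) (by omega)
    obtain ⟨r', hr'⟩ : ∃ r', S / 2 ^ t = 2 * r' := ⟨S / 2 ^ t / 2, by omega⟩
    have hr2 : 2 * r' / 2 = r' := by omega
    rw [← h7, hKt, hSd, hr', hr2, hSm, hr', wedge_two_mul]
    have e1 : ∀ j, t + 1 + j = t + (j + 1) := fun j => by omega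
    have e2 : ∀ r, 2 ^ (t + 1) * r + (S % 2 ^ t + 2 ^ t * (2 * r' % 2)) =
        2 ^ t * (2 * r) + S % 2 ^ t := fun r => by
      rw [show 2 * r' % 2 = 0 by omega]; ring
    simp only [e1, e2]
  · obtain ⟨g1, g2, g3, g4, g5, g6, g7, g8, g9⟩ := hρ
    refine Spec.of_le (Spec.assign_seq ?_ <| Spec.assign_seq ?_ <| Spec.assign ?_ ?_) (by simp)
    · simp [g1]; omega
    · simp [g2]; omega
    · simp [g7]
      exact (Nat.mod_lt _ (by omega)).le.trans hpV
    · constructor <;> simp only [State.set_var, reduceCtorEq, if_true, if_false, Expr.eval_mod,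
        Expr.eval_div, Expr.eval_ofNat, Expr.eval_mul, Expr.eval_var, hxr, hxb, g1, g2, g7, g8]
      · exact hSd.symm
      · rw [pow_succ]
      · exact Nat.mod_lt _ (by omega)
      · rw [ZMod.natCast_mod]
        push_cast
        rw [g4, pow_succ]
      · exact g5
      · exact g6
      · exact g9

theorem wedgeCoeff_spec [Fact p.Prime] (hS : S < 2 ^ K)
    (hx : x ∉ [Var.h, .r, .bit, .pw, .acc, .sg, .c])
    (hp : σ.var .p = p) (hpV : p ≤ V) (hDV : 2 ^ K ≤ V) (hh : σ.var .h = S) (hK : σ.var .kk = K) :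
    Spec inp L V (wedgeCoeff x src dst) σ (114 * K + 40) fun τ => ∃ v < p,
      (v : ZMod p) = wedge K (fun j => (σ.var x : ZMod p) ^ j) (vec p (2 ^ K) (σ.arr src) 0) S ∧
      τ.arr = (σ.put dst S v).arr := by
  have hp2 : 2 ≤ p := (Fact.out : p.Prime).two_le
  simp only [List.mem_cons, not_or, List.not_mem_nil, not_false_eq_true, and_true] at hx
  obtain ⟨hxh, hxr, hxbit, hxpw, hxacc, hxsg, hxc⟩ := hx
  refine Spec.of_le (Spec.assign_seq (by simp; omega) <| Spec.assign_seq (by simp; omega) <|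
    Spec.assign_seq (by simp; omega) <| Spec.assign_seq (by simp) <|
    Spec.assign_seq (by simp; omega) <|
      Spec.seq (Q' := fun τ => DigitInv p K S (σ.var x) (vec p (2 ^ K) (σ.arr src) 0) K τ ∧
        τ.arr = σ.arr ∧ τ.var .h = S)
      (Spec.loop (fun t τ => DigitInv p K S (σ.var x) (vec p (2 ^ K) (σ.arr src) 0) t τ) 110
        ⟨by decide, by simp [wedgeDigit, Stmt.vars], by simp [wedgeDigit, Stmt.vars]⟩ ?_ ?_ ?_)
      (T₂ := 8) fun τ hτ => ?_) ?_
  · constructor <;> simp [hh, Nat.mod_one] <;> omega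
  · intro t τ ht hc hfr hI
    have h1 := hfr.var .p (by simp [wedgeDigit, Stmt.vars])
    have h2 := hfr.var .h (by simp [wedgeDigit, Stmt.vars])
    have h3 := hfr.var x (by simp [wedgeDigit, Stmt.vars, *])
    have h4 := hfr.arr src (by simp [wedgeDigit, Stmt.arrs])
    simp [*] at h1 h2 h3 h4 ht
    rw [← h3, ← h4] at hI ⊢
    refine (wedgeDigit_spec ht hS ⟨hxr, hxbit, hxacc, hxsg⟩ h1 hpV hDV h2 hI).mono le_rfl ?_
    rintro ρ ⟨g1, g2, g3, g4, g5, g6, g7⟩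
    constructor <;> simpa
  · intro τ hfr hI
    refine ⟨by simpa [hK] using hI, ?_, ?_⟩
    · funext a
      exact hfr.arr a (by simp [wedgeDigit, Stmt.arrs])
    · rw [hfr.var .h (by simp [wedgeDigit, Stmt.vars])]
      simpa using hh
  · obtain ⟨hI, harr, hh'⟩ := hτ
    refine Spec.of_le (Spec.store ?_ ?_) (by simp)
    · have := hI.acc_lt
      simp; omega
    · refine ⟨τ.var .acc, hI.acc_lt, ?_, ?_⟩
      -- No digits are left, the remaining product `wedge 0` is `0`, and `acc` is the coefficient
      -- itself.
      · have := hI.acc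
        simpa [wedge] using this
      · funext a j
        simp [harr, hh']
  · simp [hK]; omega

/-- The coefficient at a mask uses those of `src` at smaller masks, which an increasing loop would
already have overwritten in place; hence two different arrays. The exclusion of the scratch
variables for `x` keeps the base of the powers constant. -/
theorem wedgeStmt_spec [Fact p.Prime] (hne : src ≠ dst)
    (hx : x ∉ [Var.h, .r, .bit, .pw, .acc, .sg, .c])
    (hp : σ.var .p = p) (hpV : p ≤ V) (hK : σ.var .kk = K)
    (hD : σ.var .d = 2 ^ K) (hDV : 2 ^ K ≤ V) :
    Spec inp L V (wedgeStmt x src dst) σ (2 ^ K * (114 * K + 44) + 3) fun τ =>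
      (∀ S < 2 ^ K, τ.arr dst S < p) ∧
      vec p (2 ^ K) (τ.arr dst) 0 =
        wedge K (fun j => (σ.var x : ZMod p) ^ j) (vec p (2 ^ K) (σ.arr src) 0) := by
  have hx' := hx
  simp only [List.mem_cons, not_or, List.not_mem_nil, not_false_eq_true, and_true] at hx'
  obtain ⟨hxh, hxr, hxbit, hxpw, hxacc, hxsg, hxc⟩ := hx'
  set f := vec p (2 ^ K) (σ.arr src) 0 with hf
  refine ((Spec.loop (fun t τ => ∀ S < t, τ.arr dst S < p ∧
    (τ.arr dst S : ZMod p) = wedge K (fun j => (σ.var x : ZMod p) ^ j) f S)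
    (114 * K + 40) ⟨by decide, ?_, ?_⟩ ?_ ?_ ?_)).of_le ?_
  · simp [Stmt.vars, wedgeCoeff, wedgeDigit]
  · simp [Stmt.vars, wedgeCoeff, wedgeDigit]
  · simp
  · intro S τ hS hτh hfr hI
    rw [hD] at hS
    have h1 := hfr.var .p (by simp [wedgeCoeff, wedgeDigit, Stmt.vars])
    have h2 := hfr.var .kk (by simp [wedgeCoeff, wedgeDigit, Stmt.vars])
    have h3 := hfr.var x (by simp [wedgeCoeff, wedgeDigit, Stmt.vars, *])
    have h4 := hfr.arr src (by simp [wedgeCoeff, wedgeDigit, Stmt.arrs, hne])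
    refine (wedgeCoeff_spec hS hx (h1.trans hp) hpV hDV hτh (h2.trans hK)).mono le_rfl ?_
    rintro ρ ⟨v, hv, hv', hρ⟩ S' hS'
    rw [State.set_arr, hρ, State.put_arr]
    split_ifs with h
    · rw [h3, h4] at hv'
      exact ⟨hv, h.2 ▸ hv'⟩
    · exact hI S' (by simp at h; omega)
  · intro τ hfr hI
    rw [hD] at hI
    refine ⟨fun S hS => (hI S hS).1, ?_⟩
    funext S
    by_cases hS : S < 2 ^ K
    · rw [vec, if_pos hS, zero_add, (hI S hS).2]
    · rw [vec, if_neg hS, wedge_eq_zero_of_le _ (fun S hS => ?_) (by omega)]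
      rw [hf, vec, if_neg (by omega)]
  · rw [hD]

end

end RAM

namespace RAM

/-! ### Blocks of vectors in echelon form -/

theorem mul_add_inj {D a b c d : ℕ} (hb : b < D) (hd : d < D) (h : a * D + b = c * D + d) :
    a = c ∧ b = d := by
  have h1 : (a * D + b) / D = a := by
    rw [mul_comm, Nat.mul_add_div (by omega), Nat.div_eq_of_lt hb, add_zero]
  have h2 : (c * D + d) / D = c := by
    rw [mul_comm, Nat.mul_add_div (by omega), Nat.div_eq_of_lt hd, add_zero]
  have h3 : a = c := by rw [← h1, h, h2]
  subst h3
  exact ⟨rfl, by omega⟩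

/-- The block `b` of the array `A` consists of `D` rows of length `D`. Row `S` has entries
below `p`, those before the diagonal being `0`. -/
def Echelon (p D : ℕ) (A : ℕ → ℕ) (b : ℕ) : Prop :=
  ∀ S < D, ∀ T < D, A (b * (D * D) + S * D + T) < p ∧
    (T < S → A (b * (D * D) + S * D + T) = 0)

/-- The rows of a block that have a nonzero entry on the diagonal. -/
def blockRows (p D : ℕ) (A : ℕ → ℕ) (b : ℕ) : Set (ℕ → ZMod p) :=
  {f | ∃ S < D, A (b * (D * D) + S * D + S) ≠ 0 ∧ f = vec p D A (b * (D * D) + S * D)}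

/-- The space spanned by the rows of a block. -/
def blockSpan (p D : ℕ) (A : ℕ → ℕ) (b : ℕ) : Submodule (ZMod p) (ℕ → ZMod p) :=
  Submodule.span (ZMod p) (blockRows p D A b)

section
variable {p D : ℕ} {A A' : ℕ → ℕ} {b : ℕ}

theorem block_lt {S S' : ℕ} (hS : S < D) (hS' : S' < D) :
    b * (D * D) + S * D + S' < (b + 1) * (D * D) := by
  have : (S + 1) * D ≤ D * D := Nat.mul_le_mul_right _ hS
  rw [add_mul, one_mul] at this ⊢
  omega

theorem vec_congr {f g : ℕ → ℕ} {o : ℕ} (h : ∀ S < D, f (o + S) = g (o + S)) :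
    vec p D f o = vec p D g o := by
  funext S
  simp only [vec]
  split_ifs with hS
  · rw [h S hS]
  · rfl

theorem blockRows_congr
    (h : ∀ j, b * (D * D) ≤ j → j < (b + 1) * (D * D) → A j = A' j) :
    blockRows p D A b = blockRows p D A' b := by
  have h' : ∀ S < D, ∀ S' < D, A (b * (D * D) + S * D + S') = A' (b * (D * D) + S * D + S') :=
    fun S hS S' hS' => h _ (by omega) (block_lt hS hS')
  ext f
  refine exists_congr fun S => and_congr_right fun hS => ?_
  rw [h' S hS S hS, vec_congr (h' S hS)]

theorem blockSpan_congr
    (h : ∀ j, b * (D * D) ≤ j → j < (b + 1) * (D * D) → A j = A' j) :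
    blockSpan p D A b = blockSpan p D A' b := by
  rw [blockSpan, blockSpan, blockRows_congr h]

theorem Echelon.congr (h : ∀ j, b * (D * D) ≤ j → j < (b + 1) * (D * D) → A j = A' j)
    (hA : Echelon p D A b) : Echelon p D A' b := by
  intro S hS S' hS'
  rw [← h _ (by omega) (block_lt hS hS')]
  exact hA S hS S' hS'

theorem echelon_of_zero (hp : 0 < p)
    (h : ∀ j, b * (D * D) ≤ j → j < (b + 1) * (D * D) → A j = 0) : Echelon p D A b := by
  intro S hS S' hS'
  rw [h _ (by omega) (block_lt hS hS')]
  exact ⟨hp, fun _ => rfl⟩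

theorem blockSpan_of_zero
    (h : ∀ j, b * (D * D) ≤ j → j < (b + 1) * (D * D) → A j = 0) : blockSpan p D A b = ⊥ := by
  rw [blockSpan, Submodule.span_eq_bot]
  rintro f ⟨S, hS, hne, -⟩
  exact absurd (h _ (by omega) (block_lt hS hS)) hne

/-- The blocks `b` of `A` and `b'` of `A'` have the same entries. -/
theorem blockRows_copy {b' : ℕ}
    (h : ∀ j < D * D, A' (b' * (D * D) + j) = A (b * (D * D) + j)) :
    blockRows p D A' b' = blockRows p D A b := by
  have h' : ∀ S < D, ∀ S' < D,
      A' (b' * (D * D) + S * D + S') = A (b * (D * D) + S * D + S') := by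
    intro S hS S' hS'
    have := block_lt (b := 0) hS hS'
    rw [add_assoc, add_assoc]
    exact h _ (by omega)
  ext f
  refine exists_congr fun S => and_congr_right fun hS => ?_
  rw [h' S hS S hS]
  refine and_congr_right fun _ => ?_
  have : vec p D A' (b' * (D * D) + S * D) = vec p D A (b * (D * D) + S * D) := by
    funext S'
    simp only [vec]
    split_ifs with hS'
    · rw [h' S hS S' hS']
    · rfl
  rw [this]

theorem Echelon.copy {b' : ℕ} (hA : Echelon p D A b)
    (h : ∀ j < D * D, A' (b' * (D * D) + j) = A (b * (D * D) + j)) : Echelon p D A' b' := by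
  intro S hS S' hS'
  have := block_lt (b := 0) hS hS'
  rw [add_assoc, h _ (by omega), ← add_assoc]
  exact hA S hS S' hS'

theorem cast_ne_zero_of_lt {v : ℕ} (h0 : v ≠ 0) (h : v < p) : (v : ZMod p) ≠ 0 := by
  rw [Ne, ZMod.natCast_eq_zero_iff]
  exact fun hd => h0 (Nat.eq_zero_of_dvd_of_lt hd h)

/-- A block spans the zero space iff its diagonal vanishes. -/
theorem blockSpan_eq_bot_iff (hA : Echelon p D A b) :
    blockSpan p D A b = ⊥ ↔ ∀ S < D, A (b * (D * D) + S * D + S) = 0 := by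
  rw [blockSpan, Submodule.span_eq_bot]
  constructor
  · intro h S hS
    by_contra hne
    have := congrFun (h _ ⟨S, hS, hne, rfl⟩) S
    rw [vec, if_pos hS] at this
    exact cast_ne_zero_of_lt hne (hA S hS S hS).1 this
  · rintro h f ⟨S, hS, hne, -⟩
    exact absurd (h S hS) hne

/-- Replacing a row without diagonal entry by a vector `f`. -/
theorem blockSpan_store {f : ℕ → ℕ} {S₀ : ℕ} (hS₀ : S₀ < D)
    (h0 : A (b * (D * D) + S₀ * D + S₀) = 0) (hf : f S₀ ≠ 0)
    (hin : ∀ S < D, A' (b * (D * D) + S₀ * D + S) = f S)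
    (hout : ∀ S < D, S ≠ S₀ → ∀ S' < D,
      A' (b * (D * D) + S * D + S') = A (b * (D * D) + S * D + S')) :
    blockSpan p D A' b = blockSpan p D A b ⊔ Submodule.span (ZMod p) {vec p D f 0} := by
  rw [blockSpan, blockSpan, ← Submodule.span_union]
  congr 1
  have hrow : vec p D A' (b * (D * D) + S₀ * D) = vec p D f 0 := by
    funext S
    simp only [vec, zero_add]
    split_ifs with hS
    · rw [hin S hS]
    · rfl
  ext g
  simp only [blockRows, Set.mem_ofPred_eq, Set.mem_union, Set.mem_singleton_iff]
  constructor
  · rintro ⟨S, hS, hne, rfl⟩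
    by_cases h : S = S₀
    · subst h; exact .inr hrow
    · rw [hout S hS h S hS] at hne
      exact .inl ⟨S, hS, hne, vec_congr (hout S hS h)⟩
  · rintro (⟨S, hS, hne, rfl⟩ | rfl)
    · have h : S ≠ S₀ := by rintro rfl; exact hne h0
      refine ⟨S, hS, ?_, (vec_congr (hout S hS h)).symm⟩
      rwa [hout S hS h S hS]
    · exact ⟨S₀, hS₀, by rwa [hin S₀ hS₀], hrow.symm⟩

end

/-- Since `c` is invertible and `r` lies in `B`, the vector `f` can be recovered from the
combination. Not normalising the pivots avoids inverses modulo `p`. -/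
theorem sup_span_eliminate {F M : Type*} [Field F] [AddCommGroup M] [Module F M]
    {B : Submodule F M} {f r : M} (hr : r ∈ B) {c d : F} (hc : c ≠ 0) :
    B ⊔ Submodule.span F {c • f + d • r} = B ⊔ Submodule.span F {f} := by
  apply le_antisymm
  · refine sup_le le_sup_left ?_
    rw [Submodule.span_singleton_le_iff_mem]
    exact add_mem (Submodule.smul_mem _ _ (Submodule.mem_sup_right
      (Submodule.mem_span_singleton_self f))) (Submodule.smul_mem _ _ (Submodule.mem_sup_left hr))
  · refine sup_le le_sup_left ?_
    rw [Submodule.span_singleton_le_iff_mem]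
    have hf : c⁻¹ • ((c • f + d • r) + (-d) • r) = f := by
      rw [add_assoc, ← add_smul, add_neg_cancel, zero_smul, add_zero, smul_smul,
        inv_mul_cancel₀ hc, one_smul]
    have hm : c⁻¹ • ((c • f + d • r) + (-d) • r) ∈ B ⊔ Submodule.span F {c • f + d • r} :=
      Submodule.smul_mem _ _ (add_mem (Submodule.mem_sup_right
        (Submodule.mem_span_singleton_self _)) (Submodule.smul_mem _ _ (Submodule.mem_sup_left hr)))
    rwa [hf] at hm

/-- `vf := c * vf - f * (row at b)`. -/
def eliminate : Stmt :=
  .loop .h .d (.store .vf Var.h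
    (.mod (Var.c * .get .vf Var.h + (Var.p - Var.f) * .get .blk (Var.b + Var.h)) Var.p))

/-- Stores `vf` as the row at `b` and clears it. -/
def storeRow : Stmt :=
  .loop .h .d (.store .blk (Var.b + Var.h) (.get .vf Var.h) ;; .store .vf Var.h 0)

/-- One step of the insertion of `vf` into the block `dst`. -/
def insertRound : Stmt :=
  .ite 0 (.get .vf Var.s)
    (.b ≔ Var.dst * Var.dd + Var.s * Var.d ;; .c ≔ .get .blk (Var.b + Var.s) ;;
      .f ≔ .get .vf Var.s ;; .ite 0 Var.c eliminate storeRow)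
    .skip

/-- Adds `vf` to the space spanned by the block `dst`. -/
def insertStmt : Stmt := .loop .s .d insertRound

/-! ### Gaussian elimination without division -/

section
variable {inp : ℕ → ℕ} {L V p D b : ℕ} {σ : State}

theorem eliminate_spec (hp : σ.var .p = p) (hpV : p ≤ V) (hp0 : 0 < p) (hD : σ.var .d = D) :
    Spec inp L V eliminate σ (D * 64 + 3) fun τ => ∀ S < D, τ.arr .vf S =
      (σ.var .c * σ.arr .vf S + (p - σ.var .f) * σ.arr .blk (σ.var .b + S)) % p := by
  refine Spec.of_le (Spec.loop (fun t τ => ∀ S, τ.arr .vf S = if S < t then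
      (σ.var .c * σ.arr .vf S + (p - σ.var .f) * σ.arr .blk (σ.var .b + S)) % p
      else σ.arr .vf S) 60 (by decide) (by simp) ?_ ?_) ?_
  · intro t τ ht hh hfr hI
    have h1 := hfr.var .p (by decide)
    have h2 := hfr.var .c (by decide)
    have h3 := hfr.var .f (by decide)
    have h4 := hfr.var .b (by decide)
    have h5 := hfr.arr .blk (by decide)
    refine Spec.of_le (Spec.store ?_ ?_) (by simp)
    · simp only [Expr.eval_mod, Expr.eval_var, h1, hp]
      exact (Nat.mod_lt _ hp0).le.trans hpV
    · intro S
      simp only [State.set_arr, State.put_arr, Expr.eval_mod, Expr.eval_var, Expr.eval_add,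
        Expr.eval_mul, Expr.eval_sub, Expr.eval_get, h1, h2, h3, h4, h5, hh, true_and, hp]
      rcases lt_trichotomy S t with h | h | h
      · rw [if_neg h.ne, if_pos (by omega), hI, if_pos h]
      · rw [if_pos h, if_pos (by omega), hI, if_neg (by omega), h]
      · rw [if_neg h.ne', if_neg (by omega), hI, if_neg (by omega)]
  · intro τ hfr hI S hS
    rw [hI, if_pos (by omega)]
  · rw [hD]

theorem storeRow_spec (hD : σ.var .d = D) (hV : ∀ S < D, σ.arr .vf S ≤ V) :
    Spec inp L V storeRow σ (D * 64 + 3) fun τ => (∀ S < D, τ.arr .vf S = 0) ∧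
      (∀ S < D, τ.arr .blk (σ.var .b + S) = σ.arr .vf S) ∧
      ∀ j, j < σ.var .b ∨ σ.var .b + D ≤ j → τ.arr .blk j = σ.arr .blk j := by
  refine Spec.of_le (Spec.loop (fun t τ => (∀ S < t, τ.arr .vf S = 0) ∧
      (∀ S, t ≤ S → τ.arr .vf S = σ.arr .vf S) ∧
      (∀ S < t, τ.arr .blk (σ.var .b + S) = σ.arr .vf S) ∧
      ∀ j, j < σ.var .b ∨ σ.var .b + t ≤ j → τ.arr .blk j = σ.arr .blk j) 60 (by decide)
      (by simp) ?_ ?_) ?_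
  · rintro t τ ht hh hfr ⟨h1, h2, h3, h4⟩
    have h5 := hfr.var .b (by decide)
    refine Spec.of_le (Spec.store_seq ?_ (Spec.store ?_ ?_)) (by simp)
    · simp only [Expr.eval_get, Expr.eval_var, hh, h2 t le_rfl]
      exact hV t (by omega)
    · simp
    · simp only [State.set_arr, State.put_arr, Expr.eval_var, Expr.eval_add,
        Expr.eval_get, State.put_var, Expr.eval_ofNat, h5, hh, true_and, reduceCtorEq, false_and,
        if_false]
      refine ⟨fun S hS => ?_, fun S hS => ?_, fun S hS => ?_, fun j hj => ?_⟩
      · split_ifs with h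
        · rfl
        · exact h1 S (by omega)
      · rw [if_neg (by omega), h2 S (by omega)]
      · split_ifs with h
        · rw [h2 t le_rfl]; congr 1; omega
        · exact h3 S (by omega)
      · rw [if_neg (by omega), h4 j (by omega)]
  · rintro τ hfr ⟨h1, h2, h3, h4⟩
    rw [hD] at h1 h3 h4
    exact ⟨h1, h3, h4⟩
  · rw [hD]

/-- The invariant of the insertion of the vector `f` into the block `b` of `A`. -/
structure InsertInv (p D : ℕ) (A : ℕ → ℕ) (f : ℕ → ZMod p) (b t : ℕ) (τ : State) : Prop where
  lt : ∀ S < D, τ.arr .vf S < p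
  zero : ∀ S < t, τ.arr .vf S = 0
  echelon : Echelon p D (τ.arr .blk) b
  span : blockSpan p D (τ.arr .blk) b ⊔ Submodule.span (ZMod p) {vec p D (τ.arr .vf) 0} =
    blockSpan p D A b ⊔ Submodule.span (ZMod p) {f}
  out : ∀ j, j < b * (D * D) ∨ (b + 1) * (D * D) ≤ j → τ.arr .blk j = A j

/-- At coordinate `t` the vector already vanishes, or it is cleared there with the row that has its
pivot at `t`, or it becomes this row and is replaced by `0`. In each case the span of block and
vector together stays the same. -/
theorem insertRound_spec [Fact p.Prime] {A : ℕ → ℕ} {f : ℕ → ZMod p} {t : ℕ} (ht : t < D)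
    (hp : σ.var .p = p) (hpV : p ≤ V) (hD : σ.var .d = D) (hDD : σ.var .dd = D * D)
    (hdst : σ.var .dst = b) (hbV : (b + 1) * (D * D) ≤ V) (hs : σ.var .s = t)
    (hI : InsertInv p D A f b t σ) :
    Spec inp L V insertRound σ (D * 64 + 100) (InsertInv p D A f b (t + 1)) := by
  have hp0 : 0 < p := (Fact.out : p.Prime).pos
  refine Spec.of_le (Spec.ite (T := D * 64 + 80) (fun hne => ?_) (fun heq => ?_)) (by simp; omega)
  · simp only [Expr.eval_ofNat, Expr.eval_get, Expr.eval_var, hs] at hne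
    set rb := b * (D * D) + t * D with hrb
    have hrbV : rb + t < (b + 1) * (D * D) := block_lt ht ht
    have hpiv := hI.echelon t ht t ht
    rw [← hrb] at hpiv
    have hft := hI.lt t ht
    refine Spec.of_le (Spec.assign_seq ?_ <| Spec.assign_seq ?_ <| Spec.assign_seq ?_ <|
      Spec.ite (T := D * 64 + 3) (fun hc => ?_) (fun hc => ?_)) (by simp; omega)
    · simp only [Expr.eval_add, Expr.eval_mul, Expr.eval_var, hdst, hDD, hs, hD]
      omega
    · simp [hdst, hDD, hs, hD, ← hrb]
      omega
    · simp [hs]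
      omega
    · simp only [Expr.eval_ofNat, Expr.eval_get, Expr.eval_var, Expr.eval_add, Expr.eval_mul,
        State.set_var, State.set_arr, hdst, hDD, hs, hD, reduceCtorEq, if_true, if_false,
        ← hrb] at hc ⊢
      refine (eliminate_spec (p := p) (D := D) (by simpa using hp) hpV hp0
        (by simpa using hD)).frame.mono le_rfl ?_
      rintro τ ⟨h, hfr⟩
      have hblk := hfr.arr .blk (by decide)
      simp only [State.set_var, State.set_arr, reduceCtorEq, if_true, if_false] at h hblk
      set c := σ.arr .blk (rb + t) with hcdef
      have hv : vec p D (τ.arr .vf) 0 = (c : ZMod p) • vec p D (σ.arr .vf) 0 +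
          (-(σ.arr .vf t : ZMod p)) • vec p D (σ.arr .blk) rb := by
        funext S
        simp only [vec, zero_add, Pi.add_apply, Pi.smul_apply, smul_eq_mul]
        split_ifs with hS
        · rw [h S hS, ZMod.natCast_mod]
          push_cast [Nat.cast_sub hft.le]
          simp
        · simp
      refine ⟨fun S hS => ?_, fun S hS => ?_, by rw [hblk]; exact hI.echelon, ?_, ?_⟩
      · rw [h S hS]; exact Nat.mod_lt _ hp0
      -- Before the pivot both the vector and the row vanish. At the pivot the two products add up
      -- to a multiple of `p`.
      · rw [h S (by omega)]
        rcases Nat.lt_succ_iff_lt_or_eq.1 hS with hS | rfl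
        · rw [hI.zero S hS, (hI.echelon t ht S (by omega)).2 hS]
          simp
        · rw [← hcdef, Nat.sub_mul, mul_comm c, ← Nat.add_sub_assoc
            (Nat.mul_le_mul_right _ hft.le), Nat.add_sub_cancel_left]
          simp
      · rw [hblk, hv, sup_span_eliminate, hI.span]
        · exact Submodule.subset_span ⟨t, ht, by rw [← hrb]; omega, rfl⟩
        · exact cast_ne_zero_of_lt (by omega) hpiv.1
      · rw [hblk]; exact hI.out
    · simp only [Expr.eval_ofNat, Expr.eval_get, Expr.eval_var, Expr.eval_add, Expr.eval_mul,
        State.set_var, State.set_arr, hdst, hDD, hs, hD, reduceCtorEq, if_true, if_false,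
        ← hrb] at hc ⊢
      refine (storeRow_spec (D := D) (by simpa using hD)
        (fun S hS => by simpa using (hI.lt S hS).le.trans hpV)).mono le_rfl ?_
      rintro τ ⟨h1, h2, h3⟩
      simp only [State.set_var, State.set_arr, reduceCtorEq, if_true, if_false] at h1 h2 h3
      have hrow : (t + 1) * D ≤ D * D := Nat.mul_le_mul_right _ ht
      rw [add_mul, one_mul] at hrow
      have hout : ∀ S < D, S ≠ t → ∀ S' < D, τ.arr .blk (b * (D * D) + S * D + S') =
          σ.arr .blk (b * (D * D) + S * D + S') := by
        intro S hS hne S' hS'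
        refine h3 _ ?_
        by_contra hcon
        obtain ⟨h, h'⟩ : rb ≤ b * (D * D) + S * D + S' ∧ b * (D * D) + S * D + S' < rb + D := by
          omega
        obtain ⟨d, hd⟩ := Nat.exists_eq_add_of_le h
        exact hne (mul_add_inj (b := S') (d := d) hS' (by omega) (by omega)).1
      -- The stored vector vanishes before `t` by the invariant, so it is a legitimate row `t` of an
      -- echelon form.
      refine ⟨fun S hS => by rw [h1 S hS]; exact hp0, fun S hS => h1 S (by omega), ?_, ?_, ?_⟩
      · intro S hS S' hS'
        by_cases hSt : S = t
        · subst hSt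
          rw [h2 S' hS']
          exact ⟨hI.lt S' hS', fun h => hI.zero S' h⟩
        · rw [hout S hS hSt S' hS']
          exact hI.echelon S hS S' hS'
      · have hz : vec p D (τ.arr .vf) 0 = 0 := by
          funext S
          simp only [vec, zero_add, Pi.zero_apply]
          split_ifs with hS
          · rw [h1 S hS]; simp
          · rfl
        rw [hz, Submodule.span_zero_singleton, sup_bot_eq,
          blockSpan_store ht (by rw [← hrb]; omega) (by omega) h2 hout, hI.span]
      · intro j hj
        rw [add_mul, one_mul] at hj
        rw [h3 j (by omega), hI.out j (by rw [add_mul, one_mul]; exact hj)]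
  · simp only [Expr.eval_ofNat, Expr.eval_get, Expr.eval_var, hs] at heq
    refine Spec.of_le (Spec.skip ⟨hI.lt, fun S hS => ?_, hI.echelon, hI.span, hI.out⟩) (by omega)
    rcases Nat.lt_succ_iff_lt_or_eq.1 hS with hS | rfl
    · exact hI.zero S hS
    · omega

/-- After all `D` coordinates the vector has been reduced to zero, so its span drops out of the
invariant. -/
theorem insertStmt_spec [Fact p.Prime]
    (hp : σ.var .p = p) (hpV : p ≤ V) (hD : σ.var .d = D) (hDD : σ.var .dd = D * D)
    (hdst : σ.var .dst = b) (hbV : (b + 1) * (D * D) ≤ V)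
    (hlt : ∀ S < D, σ.arr .vf S < p) (hE : Echelon p D (σ.arr .blk) b) :
    Spec inp L V insertStmt σ (D * (D * 64 + 104) + 3) fun τ =>
      Echelon p D (τ.arr .blk) b ∧
      blockSpan p D (τ.arr .blk) b =
        blockSpan p D (σ.arr .blk) b ⊔ Submodule.span (ZMod p) {vec p D (σ.arr .vf) 0} ∧
      ∀ j, j < b * (D * D) ∨ (b + 1) * (D * D) ≤ j → τ.arr .blk j = σ.arr .blk j := by
  refine Spec.of_le (Spec.loop (InsertInv p D (σ.arr .blk) (vec p D (σ.arr .vf) 0) b)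
    (D * 64 + 100) (by decide) ?_ ?_ ?_) ?_
  · exact ⟨hlt, by simp, hE, rfl, fun _ _ => rfl⟩
  · intro t τ ht hs hfr hI
    refine (insertRound_spec (by omega) ((hfr.var _ (by decide)).trans hp) hpV
      ((hfr.var _ (by decide)).trans hD) ((hfr.var _ (by decide)).trans hDD)
      ((hfr.var _ (by decide)).trans hdst) hbV hs hI).mono le_rfl ?_
    rintro ρ ⟨h1, h2, h3, h4, h5⟩
    exact ⟨h1, h2, h3, h4, h5⟩
  · rintro τ hfr ⟨h1, h2, h3, h4, h5⟩
    rw [hD] at h2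
    refine ⟨h3, ?_, h5⟩
    have hz : vec p D (τ.arr .vf) 0 = 0 := by
      funext S
      simp only [vec, zero_add, Pi.zero_apply]
      split_ifs with hS
      · rw [h2 S hS]; simp
      · rfl
    rw [← h4, hz, Submodule.span_zero_singleton, sup_bot_eq]
  · rw [hD]

end

end RAM

namespace RAM

/-! ### Systems of moves -/

/-- `R` moves between `n` vertices; the `j`-th one leads from `fr j` to `tgt j` and has the two
tokens `X j` and `Y j`, which are less than `U`. There are `k` agents with starts `s` and targets
`t`, and `l` steps. -/
structure MoveSystem where
  (n k l R U : ℕ)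
  (fr tgt X Y s t : ℕ → ℕ)
  fr_lt : ∀ j < R, fr j < n
  tgt_lt : ∀ j < R, tgt j < n
  X_lt : ∀ j < R, X j < U
  Y_lt : ∀ j < R, Y j < U
  s_lt : ∀ a < k, s a < n
  t_lt : ∀ a < k, t a < n

namespace MoveSystem

variable (M : MoveSystem)

/-- The token lists `A` extended by one of the first `j` moves in step `i`. -/
def extend (A : ℕ → Set (List ℕ)) (i j v : ℕ) : Set (List ℕ) :=
  {L | ∃ q < j, M.tgt q = v ∧
    ∃ T ∈ A (M.fr q), L = (i * M.U + M.Y q) :: (i * M.U + M.X q) :: T}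

/-- The token lists of the walks of agent `a` with `i` steps and end `v`, prepended to lists
from `A`. -/
def partials (A : Set (List ℕ)) (a : ℕ) : ℕ → ℕ → Set (List ℕ)
  | 0, v => {L | L ∈ A ∧ v = M.s a}
  | i + 1, v => M.extend (partials A a i) i M.R v

/-- The token lists of walks of the first `a` agents to their targets. -/
def results : ℕ → Set (List ℕ)
  | 0 => {[]}
  | a + 1 => M.partials (results a) a M.l (M.t a)

end MoveSystem

/-- The exterior product of the vectors `(1, z, z ^ 2, …)` for the entries `z` of a list. -/
def tokenVec (p K : ℕ) (L : List ℕ) : ℕ → ZMod p :=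
  wedgeList K (L.map fun (z j : ℕ) => (z : ZMod p) ^ j)

/-- The space spanned by the exterior products of a set of lists. -/
def tokenSpan (p K : ℕ) (A : Set (List ℕ)) : Submodule (ZMod p) (ℕ → ZMod p) :=
  Submodule.span (ZMod p) (Set.image (tokenVec p K) A)

/-- The exterior product with the vectors given by `x` and `y`. -/
def wedgeTwo (p K x y : ℕ) : Module.End (ZMod p) (ℕ → ZMod p) :=
  (wedgeHom (ZMod p) K fun j => (y : ZMod p) ^ j).comp (wedgeHom (ZMod p) K fun j => (x : ZMod p) ^ j)

theorem tokenSpan_extend_zero (M : MoveSystem) (p K : ℕ) (A : ℕ → Set (List ℕ)) (i v : ℕ) :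
    tokenSpan p K (M.extend A i 0 v) = ⊥ := by
  have : M.extend A i 0 v = ∅ := by
    ext L; simp [MoveSystem.extend]
  rw [tokenSpan, this]
  simp

theorem tokenSpan_extend_succ_of_ne (M : MoveSystem) (p K : ℕ) (A : ℕ → Set (List ℕ))
    {i j v : ℕ} (h : M.tgt j ≠ v) :
    tokenSpan p K (M.extend A i (j + 1) v) = tokenSpan p K (M.extend A i j v) := by
  congr 1
  ext L
  constructor
  · rintro ⟨j', hj', hv, hL⟩
    rcases Nat.lt_succ_iff_lt_or_eq.1 hj' with hj' | rfl
    · exact ⟨j', hj', hv, hL⟩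
    · exact absurd hv h
  · rintro ⟨j', hj', hv, hL⟩
    exact ⟨j', by omega, hv, hL⟩

/-- Prepending two fixed tokens acts linearly on the products, and a linear map sends a span to the
span of the images. This makes a basis of each space a sufficient substitute for the set of all
token lists. -/
theorem tokenSpan_extend_succ (M : MoveSystem) (p K : ℕ) (A : ℕ → Set (List ℕ)) (i j : ℕ) :
    tokenSpan p K (M.extend A i (j + 1) (M.tgt j)) = tokenSpan p K (M.extend A i j (M.tgt j)) ⊔
      (tokenSpan p K (A (M.fr j))).map (wedgeTwo p K (i * M.U + M.X j) (i * M.U + M.Y j)) := by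
  rw [tokenSpan, tokenSpan, tokenSpan, Submodule.map_span, ← Submodule.span_union,
    Set.image_image]
  have : M.extend A i (j + 1) (M.tgt j) = M.extend A i j (M.tgt j) ∪
      (fun L => (i * M.U + M.Y j) :: (i * M.U + M.X j) :: L) '' A (M.fr j) := by
    ext L
    constructor
    · rintro ⟨j', hj', hv, hL⟩
      rcases Nat.lt_succ_iff_lt_or_eq.1 hj' with hj' | rfl
      · exact .inl ⟨j', hj', hv, hL⟩
      · obtain ⟨L', hL', rfl⟩ := hL
        exact .inr ⟨L', hL', rfl⟩
    · rintro (⟨j', hj', hv, hL⟩ | ⟨L', hL', rfl⟩)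
      · exact ⟨j', by omega, hv, hL⟩
      · exact ⟨j, by omega, rfl, L', hL', rfl⟩
  rw [this, Set.image_union, Set.image_image]
  rfl

/-! ### The main loops -/

/-- Treats the row `t` of the block `src`. -/
def rowStmt : Stmt :=
  .ite 0 (.get .blk (Var.src * Var.dd + Var.t * Var.d + Var.t))
    (.loop .h .d (.store .vf Var.h (.get .blk (Var.src * Var.dd + Var.t * Var.d + Var.h))) ;;
      wedgeStmt .x .vf .vh ;; wedgeStmt .y .vh .vf ;; insertStmt)
    .skip

/-- Treats the move `j` in step `i`. -/
def moveStmt : Stmt :=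
  .src ≔ Var.g * Var.n + .get .fr Var.j ;; .dst ≔ (Var.g + 1) * Var.n + .get .tgt Var.j ;;
  .x ≔ Var.i * Var.uu + .get .tok Var.j ;; .y ≔ Var.i * Var.uu + .get .lab (.get .tgt Var.j) ;;
  .loop .t .d rowStmt

def stepStmt : Stmt := .loop .j .rr moveStmt ;; .g ≔ Var.g + 1

/-- Copies the block `ptr` to the block `dst`. -/
def copyStmt : Stmt :=
  .loop .h .dd (.store .blk (Var.dst * Var.dd + Var.h) (.get .blk (Var.ptr * Var.dd + Var.h)))

/-- Treats the agent `a`; the input starts at position `o`. -/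
def agentStmt (o : ℕ) : Stmt :=
  .input .u (.lit (o + 4) + 2 * Var.m + Var.a) ;;
  .input .v (.lit (o + 4) + 2 * Var.m + Var.k + Var.a) ;;
  .dst ≔ Var.g * Var.n + Var.u ;;
  copyStmt ;; .loop .i .l stepStmt ;;
  .ptr ≔ Var.g * Var.n + Var.v ;; .g ≔ Var.g + 1

def searchStmt (o : ℕ) : Stmt :=
  .store .blk 0 1 ;; .ptr ≔ 0 ;; .g ≔ 1 ;; .loop .a .k (agentStmt o) ;;
  .len ≔ 0 ;;
  .loop .h .d (.ite 0 (.get .blk (Var.ptr * Var.dd + Var.h * Var.d + Var.h)) (.len ≔ 1) .skip)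

/-! ### Correctness of the dynamic programme -/

section
variable {inp : ℕ → ℕ} {L V p K : ℕ} {σ : State}

/-- The first `t` rows of a block that have a nonzero entry on the diagonal. -/
def rowsBelow (p D : ℕ) (A : ℕ → ℕ) (b t : ℕ) : Set (ℕ → ZMod p) :=
  {f | ∃ S < t, A (b * (D * D) + S * D + S) ≠ 0 ∧ f = vec p D A (b * (D * D) + S * D)}

/-- The invariant of the loop over the rows of the block `src`. -/
structure RowInv (p K : ℕ) (A : ℕ → ℕ) (src dst x y t : ℕ) (τ : State) : Prop where
  echelon : Echelon p (2 ^ K) (τ.arr .blk) dst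
  span : blockSpan p (2 ^ K) (τ.arr .blk) dst = blockSpan p (2 ^ K) A dst ⊔
    (Submodule.span (ZMod p) (rowsBelow p (2 ^ K) A src t)).map (wedgeTwo p K x y)
  out : ∀ j, j < dst * (2 ^ K * 2 ^ K) ∨ (dst + 1) * (2 ^ K * 2 ^ K) ≤ j → τ.arr .blk j = A j

/-- A row with a pivot is copied, multiplied first by the vector of `x` and then by that of `y`, and
inserted into the block `dst`. This is the contribution of one generator of the source space; rows
without a pivot are not generators. -/
theorem rowStmt_spec [Fact p.Prime] {A : ℕ → ℕ} {src dst x y t : ℕ} (ht : t < 2 ^ K)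
    (hp : σ.var .p = p) (hpV : p ≤ V) (hK : σ.var .kk = K) (hD : σ.var .d = 2 ^ K)
    (hDD : σ.var .dd = 2 ^ K * 2 ^ K) (hDV : 2 ^ K ≤ V)
    (hsrc : σ.var .src = src) (hdst : σ.var .dst = dst) (hx : σ.var .x = x) (hy : σ.var .y = y)
    (hsd : src < dst) (hbV : (dst + 1) * (2 ^ K * 2 ^ K) ≤ V)
    (hE : Echelon p (2 ^ K) A src) (hst : σ.var .t = t) (hI : RowInv p K A src dst x y t σ) :
    Spec inp L V rowStmt σ (2 ^ K * (2 ^ K * 64 + 228 * K + 260) + 60)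
      (RowInv p K A src dst x y (t + 1)) := by
  -- The block `src` lies before `dst`, the only block that has been modified so far.
  have hA : ∀ S < 2 ^ K, ∀ S' < 2 ^ K,
      σ.arr .blk (src * (2 ^ K * 2 ^ K) + S * 2 ^ K + S') =
        A (src * (2 ^ K * 2 ^ K) + S * 2 ^ K + S') := by
    intro S hS S' hS'
    refine hI.out _ (.inl ?_)
    exact (block_lt hS hS').trans_le (Nat.mul_le_mul_right _ hsd)
  refine Spec.of_le (Spec.ite (T := 2 ^ K * (2 ^ K * 64 + 228 * K + 260) + 30)
    (fun hne => ?_) (fun heq => ?_)) (by simp; omega)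
  · simp only [Expr.eval_ofNat, Expr.eval_get, Expr.eval_var, Expr.eval_add, Expr.eval_mul, hst,
      hsrc, hDD, hD] at hne
    refine Spec.of_le (Spec.seq (Spec.loop (fun r τ => ∀ S < r, τ.arr .vf S =
      A (src * (2 ^ K * 2 ^ K) + t * 2 ^ K + S)) 40 (by decide) (by simp) ?_ (Q := fun τ =>
        (∀ S < 2 ^ K, τ.arr .vf S = A (src * (2 ^ K * 2 ^ K) + t * 2 ^ K + S)) ∧
        Frame (.loop .h .d (.store .vf Var.h
          (.get .blk (Var.src * Var.dd + Var.t * Var.d + Var.h)))) σ τ)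
      fun τ hfr hI => ⟨by rwa [hD] at hI, hfr⟩) fun σ₁ hσ₁ => ?_)
      (show _ + (2 ^ K * (114 * K + 44) + 3 + (2 ^ K * (114 * K + 44) + 3 +
        (2 ^ K * (2 ^ K * 64 + 104) + 3))) ≤ _ from ?_)
    · intro r τ hr hh hfr hJ
      have h1 := hfr.var .src (by decide)
      have h2 := hfr.var .dd (by decide)
      have h3 := hfr.var .t (by decide)
      have h4 := hfr.var .d (by decide)
      have h5 := hfr.arr .blk (by decide)
      refine Spec.of_le (Spec.store ?_ ?_) (by simp)
      · simp only [Expr.eval_get, Expr.eval_add, Expr.eval_mul, Expr.eval_var, h1, h2, h3, h4, h5,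
          hsrc, hDD, hst, hD, hh]
        rw [hA t ht r (by omega)]
        exact (hE t ht r (by omega)).1.le.trans hpV
      · intro S hS
        simp only [State.set_arr, State.put_arr, Expr.eval_get, Expr.eval_add, Expr.eval_mul,
          Expr.eval_var, h1, h2, h3, h4, h5, hsrc, hDD, hst, hD, hh, true_and]
        split_ifs with h
        · rw [hA t ht r (by omega), h]
        · exact hJ S (by omega)
    · obtain ⟨hvf, hfr₁⟩ := hσ₁
      have hv1 : vec p (2 ^ K) (σ₁.arr .vf) 0 =
          vec p (2 ^ K) A (src * (2 ^ K * 2 ^ K) + t * 2 ^ K) := by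
        funext S
        simp only [vec, zero_add]
        split_ifs with hS
        · rw [hvf S hS]
        · rfl
      refine Spec.seq (wedgeStmt_spec (K := K) (p := p) (by decide) (by decide)
        ((hfr₁.var _ (by decide)).trans hp) hpV ((hfr₁.var _ (by decide)).trans hK)
        ((hfr₁.var _ (by decide)).trans hD) hDV).frame fun σ₂ hσ₂ => ?_
      obtain ⟨⟨-, hv2⟩, hfr₂⟩ := hσ₂
      refine Spec.seq (wedgeStmt_spec (K := K) (p := p) (by decide) (by decide)
        ((hfr₂.var _ (by decide)).trans ((hfr₁.var _ (by decide)).trans hp)) hpV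
        ((hfr₂.var _ (by decide)).trans ((hfr₁.var _ (by decide)).trans hK))
        ((hfr₂.var _ (by decide)).trans ((hfr₁.var _ (by decide)).trans hD)) hDV).frame
        fun σ₃ hσ₃ => ?_
      obtain ⟨⟨hlt, hv3⟩, hfr₃⟩ := hσ₃
      have hvar : ∀ z, z ∉ [Var.h, .r, .bit, .pw, .acc, .sg, .c] → σ₃.var z = σ.var z := by
        intro z hz
        simp only [List.mem_cons, not_or, List.not_mem_nil, not_false_eq_true, and_true] at hz
        rw [hfr₃.var z (by simp [wedgeStmt, wedgeCoeff, wedgeDigit, Stmt.vars, *]),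
          hfr₂.var z (by simp [wedgeStmt, wedgeCoeff, wedgeDigit, Stmt.vars, *]),
          hfr₁.var z (by simp [Stmt.vars, *])]
      have hblk : σ₃.arr .blk = σ.arr .blk := by
        rw [hfr₃.arr _ (by decide), hfr₂.arr _ (by decide), hfr₁.arr _ (by decide)]
      have hx2 : σ₁.var .x = x := (hfr₁.var _ (by decide)).trans hx
      have hy2 : σ₂.var .y = y := (hfr₂.var _ (by decide)).trans
        ((hfr₁.var _ (by decide)).trans hy)
      refine (insertStmt_spec (p := p) (D := 2 ^ K) (b := dst) ((hvar _ (by decide)).trans hp) hpV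
        ((hvar _ (by decide)).trans hD) ((hvar _ (by decide)).trans hDD)
        ((hvar _ (by decide)).trans hdst) hbV hlt (by rw [hblk]; exact hI.echelon)).mono le_rfl ?_
      rintro τ ⟨h1, h2, h3⟩
      refine ⟨h1, ?_, fun j hj => by rw [h3 j hj, hblk, hI.out j hj]⟩
      rw [h2, hblk, hI.span, hv3, hv2, hv1, hx2, hy2, sup_assoc]
      congr 1
      rw [Submodule.map_span, Submodule.map_span, ← Submodule.span_union]
      congr 1
      ext f
      constructor
      · rintro (⟨g, ⟨S, hS, hS', rfl⟩, rfl⟩ | hf)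
        · exact ⟨_, ⟨S, by omega, hS', rfl⟩, rfl⟩
        · rw [Set.mem_singleton_iff] at hf
          refine ⟨_, ⟨t, by omega, ?_, rfl⟩, hf.symm⟩
          rw [← hA t ht t ht]; omega
      · rintro ⟨g, ⟨S, hS, hS', rfl⟩, rfl⟩
        rcases Nat.lt_succ_iff_lt_or_eq.1 hS with hS | rfl
        · exact .inl ⟨_, ⟨S, hS, hS', rfl⟩, rfl⟩
        · exact .inr rfl
    · rw [hD]
      ring_nf
      omega
  · simp only [Expr.eval_ofNat, Expr.eval_get, Expr.eval_var, Expr.eval_add, Expr.eval_mul, hst,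
      hsrc, hDD, hD] at heq
    refine Spec.of_le (Spec.skip ⟨hI.echelon, ?_, hI.out⟩) (by omega)
    rw [hI.span]
    have : rowsBelow p (2 ^ K) A src (t + 1) = rowsBelow p (2 ^ K) A src t := by
      ext f
      constructor
      · rintro ⟨S, hS, hS', hf⟩
        rcases Nat.lt_succ_iff_lt_or_eq.1 hS with hS | rfl
        · exact ⟨S, hS, hS', hf⟩
        · rw [← hA S ht S ht] at hS'; omega
      · rintro ⟨S, hS, hS', hf⟩
        exact ⟨S, by omega, hS', hf⟩
    rw [this]

/-- The cost bound for one row. -/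
def rowCost (K : ℕ) : ℕ := 2 ^ K * (2 ^ K * 64 + 228 * K + 260) + 60

/-- The constants of the computation have the right values. -/
structure Ctx (M : MoveSystem) (p K m : ℕ) (σ : State) : Prop where
  p : σ.var .p = p
  kk : σ.var .kk = K
  d : σ.var .d = 2 ^ K
  dd : σ.var .dd = 2 ^ K * 2 ^ K
  n : σ.var .n = M.n
  m : σ.var .m = m
  k : σ.var .k = M.k
  l : σ.var .l = M.l
  rr : σ.var .rr = M.R
  uu : σ.var .uu = M.U
  fr : ∀ j < M.R, σ.arr .fr j = M.fr j
  tgt : ∀ j < M.R, σ.arr .tgt j = M.tgt j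
  tok : ∀ j < M.R, σ.arr .tok j = M.X j
  lab : ∀ j < M.R, σ.arr .lab (M.tgt j) = M.Y j

theorem Ctx.of_frame {M : MoveSystem} {m : ℕ} {s : Stmt} {τ : State} (h : Ctx M p K m σ)
    (hfr : Frame s σ τ)
    (hs : (∀ y ∈ [Var.p, .kk, .d, .dd, .n, .m, .k, .l, .rr, .uu], y ∉ s.vars) ∧
      ∀ a ∈ [Arr.fr, .tgt, .tok, .lab], a ∉ s.arrs) : Ctx M p K m τ := by
  obtain ⟨hv, ha⟩ := hs
  constructor
  · rw [hfr.var _ (hv _ (by simp)), h.p]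
  · rw [hfr.var _ (hv _ (by simp)), h.kk]
  · rw [hfr.var _ (hv _ (by simp)), h.d]
  · rw [hfr.var _ (hv _ (by simp)), h.dd]
  · rw [hfr.var _ (hv _ (by simp)), h.n]
  · rw [hfr.var _ (hv _ (by simp)), h.m]
  · rw [hfr.var _ (hv _ (by simp)), h.k]
  · rw [hfr.var _ (hv _ (by simp)), h.l]
  · rw [hfr.var _ (hv _ (by simp)), h.rr]
  · rw [hfr.var _ (hv _ (by simp)), h.uu]
  · rw [hfr.arr _ (ha _ (by simp))]; exact h.fr
  · rw [hfr.arr _ (ha _ (by simp))]; exact h.tgt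
  · rw [hfr.arr _ (ha _ (by simp))]; exact h.tok
  · rw [hfr.arr _ (ha _ (by simp))]; exact h.lab

/-- The blocks of step `g` span the spaces given by the sets `S v`. -/
def Region (M : MoveSystem) (p K : ℕ) (A : ℕ → ℕ) (g : ℕ) (S : ℕ → Set (List ℕ)) : Prop :=
  ∀ v < M.n, Echelon p (2 ^ K) A (g * M.n + v) ∧
    blockSpan p (2 ^ K) A (g * M.n + v) = tokenSpan p K (S v)

theorem block_disjoint {b b' E j : ℕ} (hb : b' ≠ b) (h1 : b' * E ≤ j) (h2 : j < (b' + 1) * E) :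
    j < b * E ∨ (b + 1) * E ≤ j := by
  rcases Nat.lt_or_gt_of_ne hb with h | h
  · exact .inl (h2.trans_le (Nat.mul_le_mul_right _ h))
  · exact .inr ((Nat.mul_le_mul_right _ h).trans h1)

variable {M : MoveSystem} {m : ℕ}

/-- Only the block of the vertex entered changes, and it is enlarged by the image of the block of
the vertex left. The latter belongs to the previous generation, so moves of the same step do not
feed into each other. -/
theorem moveStmt_spec [Fact p.Prime] {g i j : ℕ} {S : ℕ → Set (List ℕ)}
    (hc : Ctx M p K m σ) (hpV : p ≤ V) (hDV : 2 ^ K ≤ V)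
    (hgV : (g + 2) * M.n * (2 ^ K * 2 ^ K) ≤ V) (hUV : M.l * M.U ≤ V)
    (hg : σ.var .g = g) (hi : σ.var .i = i) (hil : i < M.l) (hj : σ.var .j = j) (hjR : j < M.R)
    (hR : Region M p K (σ.arr .blk) g S)
    (hR' : Region M p K (σ.arr .blk) (g + 1) (M.extend S i j))
    (hz : ∀ q, (g + 2) * M.n * (2 ^ K * 2 ^ K) ≤ q → σ.arr .blk q = 0) :
    Spec inp L V moveStmt σ (2 ^ K * (rowCost K + 4) + 80) fun τ =>
      Region M p K (τ.arr .blk) g S ∧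
      Region M p K (τ.arr .blk) (g + 1) (M.extend S i (j + 1)) ∧
      ∀ q, (g + 2) * M.n * (2 ^ K * 2 ^ K) ≤ q → τ.arr .blk q = 0 := by
  have hfrn := M.fr_lt j hjR
  have htn := M.tgt_lt j hjR
  have hX := M.X_lt j hjR
  have hY := M.Y_lt j hjR
  have hiU : i * M.U + M.U ≤ M.l * M.U := by
    rw [← Nat.succ_mul]; exact Nat.mul_le_mul_right _ hil
  have h1D : 1 ≤ 2 ^ K * 2 ^ K := Nat.mul_pos (by positivity) (by positivity)
  have hg1 : (g + 1) * M.n = g * M.n + M.n := by ring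
  have hg2 : (g + 2) * M.n = (g + 1) * M.n + M.n := by ring
  have hgn : (g + 2) * M.n ≤ V := (Nat.le_mul_of_pos_right _ h1D).trans hgV
  set src := g * M.n + M.fr j with hsrc
  set dst := (g + 1) * M.n + M.tgt j with hdst
  have hsd : src < dst := by omega
  have hdV : (dst + 1) * (2 ^ K * 2 ^ K) ≤ (g + 2) * M.n * (2 ^ K * 2 ^ K) :=
    Nat.mul_le_mul_right _ (by omega)
  refine Spec.of_le (Spec.assign_seq ?_ <| Spec.assign_seq ?_ <| Spec.assign_seq ?_ <|
    Spec.assign_seq ?_ <| Spec.loop (RowInv p K (σ.arr .blk) src dst (i * M.U + M.X j)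
      (i * M.U + M.Y j)) (rowCost K) (by decide) ?_ ?_ ?_) ?_
  · simp [hg, hj, hc.n, hc.fr j hjR, ← hsrc]; omega
  · simp [hg, hj, hc.n, hc.tgt j hjR, ← hdst]; omega
  · simp [hi, hj, hc.uu, hc.tok j hjR]; omega
  · simp [hi, hj, hc.uu, hc.tgt j hjR, hc.lab j hjR]; omega
  · refine ⟨(hR' _ htn).1, ?_, fun _ _ => rfl⟩
    have : rowsBelow p (2 ^ K) (σ.arr .blk) src 0 = ∅ := by
      ext f; simp [rowsBelow]
    simp [this]
  · intro t τ ht hst hfr hI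
    have e1 := hfr.var .src (by decide)
    have e2 := hfr.var .dst (by decide)
    have e3 := hfr.var .x (by decide)
    have e4 := hfr.var .y (by decide)
    have e5 := hfr.var .p (by decide)
    have e6 := hfr.var .kk (by decide)
    have e7 := hfr.var .d (by decide)
    have e8 := hfr.var .dd (by decide)
    simp only [State.set_var, reduceCtorEq, if_true, if_false, Expr.eval_add, Expr.eval_mul,
      Expr.eval_var, Expr.eval_get, Expr.eval_ofNat, State.set_arr, hg, hi, hj, hc.n, hc.uu, hc.p,
      hc.kk, hc.d, hc.dd, hc.fr j hjR, hc.tgt j hjR, hc.tok j hjR, hc.lab j hjR] at e1 e2 e3 e4 e5 e6 e7 e8 ht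
    refine (rowStmt_spec ht e5 hpV e6 e7 e8 hDV e1 e2 e3 e4 hsd (hdV.trans hgV)
      (hR _ hfrn).1 hst hI).mono le_rfl ?_
    rintro ρ ⟨h1, h2, h3⟩
    exact ⟨h1, h2, h3⟩
  · intro τ hfr hI
    simp only [State.set_var, reduceCtorEq, if_false, hc.d] at hI
    have same : ∀ b, b ≠ dst → ∀ q, b * (2 ^ K * 2 ^ K) ≤ q → q < (b + 1) * (2 ^ K * 2 ^ K) →
        σ.arr .blk q = τ.arr .blk q := fun b hb q h1 h2 => (hI.out q (block_disjoint hb h1 h2)).symm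
    refine ⟨fun v hv => ?_, fun v hv => ?_, fun q hq => ?_⟩
    · have hs := same (g * M.n + v) (by omega)
      exact ⟨(hR v hv).1.congr hs, by rw [← blockSpan_congr hs, (hR v hv).2]⟩
    · by_cases hv' : M.tgt j = v
      · subst hv'
        refine ⟨hI.echelon, ?_⟩
        rw [tokenSpan_extend_succ, ← (hR' _ hv).2, ← (hR _ hfrn).2]
        exact hI.span
      · have hs := same ((g + 1) * M.n + v) (by omega)
        exact ⟨(hR' v hv).1.congr hs, by
          rw [← blockSpan_congr hs, (hR' v hv).2, tokenSpan_extend_succ_of_ne _ _ _ _ hv']⟩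
    · rw [hI.out q (.inr (hdV.trans hq)), hz q hq]
  · simp only [State.set_var, reduceCtorEq, if_false, hc.d]
    simp
    omega

/-- The cells from generation `g + 1` on are still zero, and zero blocks represent zero spaces.
Therefore the new generation needs no initialisation, which would cost time proportional to `n`. -/
theorem stepStmt_spec [Fact p.Prime] {g i : ℕ} {S : ℕ → Set (List ℕ)}
    (hc : Ctx M p K m σ) (hpV : p ≤ V) (hDV : 2 ^ K ≤ V)
    (hgV : (g + 2) * M.n * (2 ^ K * 2 ^ K) ≤ V) (hgV' : g < V) (hUV : M.l * M.U ≤ V)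
    (hg : σ.var .g = g) (hi : σ.var .i = i) (hil : i < M.l)
    (hR : Region M p K (σ.arr .blk) g S)
    (hz : ∀ q, (g + 1) * M.n * (2 ^ K * 2 ^ K) ≤ q → σ.arr .blk q = 0) :
    Spec inp L V stepStmt σ (M.R * (2 ^ K * (rowCost K + 4) + 84) + 10) fun τ =>
      τ.var .g = g + 1 ∧
      Region M p K (τ.arr .blk) (g + 1) (M.extend S i M.R) ∧
      ∀ q, (g + 2) * M.n * (2 ^ K * 2 ^ K) ≤ q → τ.arr .blk q = 0 := by
  have hp0 : 0 < p := (Fact.out : p.Prime).pos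
  have hle : (g + 1) * M.n * (2 ^ K * 2 ^ K) ≤ (g + 2) * M.n * (2 ^ K * 2 ^ K) :=
    Nat.mul_le_mul_right _ (Nat.mul_le_mul_right _ (by omega))
  refine Spec.of_le (Spec.seq (Spec.loop (fun j τ => Region M p K (τ.arr .blk) g S ∧
      Region M p K (τ.arr .blk) (g + 1) (M.extend S i j) ∧
      ∀ q, (g + 2) * M.n * (2 ^ K * 2 ^ K) ≤ q → τ.arr .blk q = 0)
      (2 ^ K * (rowCost K + 4) + 80) (by decide) ?_ ?_ fun τ hfr hI => And.intro hI hfr)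
      (T₂ := 4) ?_) ?_
  · refine ⟨hR, fun v hv => ?_, fun q hq => hz q (hle.trans hq)⟩
    have h0 : ∀ q, ((g + 1) * M.n + v) * (2 ^ K * 2 ^ K) ≤ q →
        q < ((g + 1) * M.n + v + 1) * (2 ^ K * 2 ^ K) → σ.arr .blk q = 0 := fun q h1 _ =>
      hz q ((Nat.mul_le_mul_right _ (by omega)).trans h1)
    exact ⟨echelon_of_zero hp0 h0, by rw [tokenSpan_extend_zero]; exact blockSpan_of_zero h0⟩
  · rintro j τ hj hτj hfr ⟨h1, h2, h3⟩
    rw [hc.rr] at hj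
    exact (moveStmt_spec (hc.of_frame hfr (by decide)) hpV hDV hgV hUV
      ((hfr.var _ (by decide)).trans hg) ((hfr.var _ (by decide)).trans hi) hil hτj hj
      h1 h2 h3).mono le_rfl fun ρ h => h
  · rintro τ ⟨⟨-, h2, h3⟩, hfr⟩
    have hgτ : τ.var .g = g := (hfr.var _ (by decide)).trans hg
    refine Spec.of_le (Spec.assign ?_ ⟨?_, ?_, h3⟩) (by simp)
    · simp [hgτ]; omega
    · simp [hgτ]
    · rw [← hc.rr]; exact h2
  · rw [hc.rr]
    show M.R * (2 ^ K * (rowCost K + 4) + 84) + 3 + 4 ≤ _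
    omega

theorem Echelon.lt {D b : ℕ} {A : ℕ → ℕ} (h : Echelon p D A b) {j : ℕ} (hj : j < D * D) :
    A (b * (D * D) + j) < p := by
  have hD : 0 < D := by
    by_contra h0
    obtain rfl : D = 0 := by omega
    simp at hj
  have := (h (j / D) (Nat.div_lt_of_lt_mul hj) (j % D) (Nat.mod_lt _ hD)).1
  rwa [add_assoc, Nat.div_add_mod'] at this

theorem copyStmt_spec {D b b' : ℕ} (hbb : b < b') (hpV : p ≤ V) (hDD : σ.var .dd = D * D)
    (hptr : σ.var .ptr = b) (hdst : σ.var .dst = b') (hE : Echelon p D (σ.arr .blk) b) :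
    Spec inp L V copyStmt σ (D * D * 34 + 3) fun τ =>
      (∀ q < D * D, τ.arr .blk (b' * (D * D) + q) = σ.arr .blk (b * (D * D) + q)) ∧
      ∀ q, q < b' * (D * D) ∨ (b' + 1) * (D * D) ≤ q → τ.arr .blk q = σ.arr .blk q := by
  refine Spec.of_le (Spec.loop (fun t τ =>
      (∀ q < t, τ.arr .blk (b' * (D * D) + q) = σ.arr .blk (b * (D * D) + q)) ∧
      ∀ q, q < b' * (D * D) ∨ b' * (D * D) + t ≤ q → τ.arr .blk q = σ.arr .blk q) 30
      (by decide) (by simp) ?_ ?_) ?_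
  · rintro t τ ht hh hfr ⟨h1, h2⟩
    have e1 := hfr.var .ptr (by decide)
    have e2 := hfr.var .dst (by decide)
    have e3 := hfr.var .dd (by decide)
    have hle : (b + 1) * (D * D) ≤ b' * (D * D) := Nat.mul_le_mul_right _ hbb
    rw [add_mul, one_mul] at hle
    rw [hDD] at ht
    have h3 := h2 (b * (D * D) + t) (.inl (by omega))
    refine Spec.of_le (Spec.store ?_ ⟨fun q hq => ?_, fun q hq => ?_⟩) (by simp)
    · simp only [Expr.eval_get, Expr.eval_add, Expr.eval_mul, Expr.eval_var, e1, e3, hh, hptr, hDD,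
        h3]
      exact (hE.lt ht).le.trans hpV
    · simp only [State.set_arr, State.put_arr, Expr.eval_get, Expr.eval_add, Expr.eval_mul,
        Expr.eval_var, e1, e2, e3, hh, hptr, hdst, hDD, true_and, h3]
      split_ifs with h
      · congr 1; omega
      · exact h1 q (by omega)
    · simp only [State.set_arr, State.put_arr, Expr.eval_get, Expr.eval_add, Expr.eval_mul,
        Expr.eval_var, e1, e2, e3, hh, hptr, hdst, hDD, true_and]
      rw [if_neg (by omega), h2 q (by omega)]
  · rintro τ hfr ⟨h1, h2⟩
    rw [hDD] at h1 h2
    exact ⟨h1, fun q hq => h2 q (by rw [add_mul, one_mul] at hq; exact hq)⟩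
  · rw [hDD]

/-- The cost bound for one agent. -/
def agentCost (M : MoveSystem) (K : ℕ) : ℕ :=
  2 ^ K * 2 ^ K * 34 + M.l * (M.R * (2 ^ K * (rowCost K + 4) + 84) + 14) + 80

/-- The invariant of the loop over the agents. -/
structure AgentInv (M : MoveSystem) (p K a : ℕ) (τ : State) : Prop where
  g : τ.var .g = 1 + a * (M.l + 1)
  ptr : τ.var .ptr < τ.var .g * M.n
  echelon : Echelon p (2 ^ K) (τ.arr .blk) (τ.var .ptr)
  span : blockSpan p (2 ^ K) (τ.arr .blk) (τ.var .ptr) = tokenSpan p K (M.results a)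
  zero : ∀ q, τ.var .g * M.n * (2 ^ K * 2 ^ K) ≤ q → τ.arr .blk q = 0

/-- The walk of an agent starts from the products of all previous agents instead of the unit, placed
at the start vertex. Each agent consumes `M.l + 1` generations of blocks, so no block is ever
reused. -/
theorem agentStmt_spec [Fact p.Prime] {o a : ℕ}
    (hc : Ctx M p K m σ) (hpV : p ≤ V) (hDV : 2 ^ K ≤ V)
    (hgV : (M.k * (M.l + 1) + 3) * M.n * (2 ^ K * 2 ^ K) ≤ V) (hUV : M.l * M.U ≤ V)
    (ha : σ.var .a = a) (hak : a < M.k)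
    (hs : o + 4 + 2 * m + a < L ∧ inp (o + 4 + 2 * m + a) = M.s a)
    (ht : o + 4 + 2 * m + M.k + a < L ∧ inp (o + 4 + 2 * m + M.k + a) = M.t a)
    (hI : AgentInv M p K a σ) :
    Spec inp L V (agentStmt o) σ (agentCost M K) (AgentInv M p K (a + 1)) := by
  have hp0 : 0 < p := (Fact.out : p.Prime).pos
  have h1D : 1 ≤ 2 ^ K * 2 ^ K := Nat.mul_pos (by positivity) (by positivity)
  have hsn := M.s_lt a hak
  have htn := M.t_lt a hak
  obtain ⟨hg, hptr, hE, hspan, hz⟩ := hI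
  set g := 1 + a * (M.l + 1) with hgdef
  rw [hg] at hptr hz
  have hgk : g + M.l + 1 ≤ 1 + M.k * (M.l + 1) := by
    have : (a + 1) * (M.l + 1) ≤ M.k * (M.l + 1) := Nat.mul_le_mul_right _ hak
    rw [add_mul, one_mul] at this
    omega
  have hGn : (M.k * (M.l + 1) + 3) * M.n ≤ V := (Nat.le_mul_of_pos_right _ h1D).trans hgV
  have hG : M.k * (M.l + 1) + 3 ≤ V := (Nat.le_mul_of_pos_right _ (by omega)).trans hGn
  have hgn : ∀ r, r ≤ M.k * (M.l + 1) + 3 → r * M.n * (2 ^ K * 2 ^ K) ≤ V := fun r hr =>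
    (Nat.mul_le_mul_right _ (Nat.mul_le_mul_right _ hr)).trans hgV
  have hgn' : ∀ r, r + 1 ≤ M.k * (M.l + 1) + 3 → r * M.n + M.n ≤ V := fun r hr => by
    rw [← Nat.succ_mul]
    exact (Nat.mul_le_mul_right _ hr).trans hGn
  have hg1 : (g + 1) * M.n = g * M.n + M.n := by ring
  refine Spec.of_le (Spec.input_seq ?_ <| Spec.input_seq ?_ <| Spec.assign_seq ?_ <|
    Spec.seq (copyStmt_spec (p := p) (D := 2 ^ K) (b := σ.var .ptr) (b' := g * M.n + M.s a)
      (by omega) hpV ?_ ?_ ?_ ?_).frame (T₂ := M.l * (M.R * (2 ^ K * (rowCost K + 4) + 84) + 14) + 15)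
      fun τ hτ => ?_) (by simp only [agentCost]; simp; omega)
  · simp only [Expr.eval_add, Expr.eval_lit, Expr.eval_mul, Expr.eval_ofNat, Expr.eval_var, hc.m,
      ha]
    exact hs.1
  · simp only [Expr.eval_add, Expr.eval_lit, Expr.eval_mul, Expr.eval_ofNat, Expr.eval_var,
      State.set_var, reduceCtorEq, if_false, hc.m, hc.k, ha]
    exact ht.1
  · simp only [Expr.eval_add, Expr.eval_lit, Expr.eval_mul, Expr.eval_ofNat, Expr.eval_var,
      State.set_var, reduceCtorEq, if_false, if_true, hc.m, hc.n, hg, ha, hs.2]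
    have := hgn' g (by omega)
    omega
  · simpa using hc.dd
  · simp
  · simp only [Expr.eval_add, Expr.eval_lit, Expr.eval_mul, Expr.eval_ofNat, Expr.eval_var,
      State.set_var, reduceCtorEq, if_false, if_true, hc.m, hc.n, hg, ha, hs.2]
  · simpa using hE
  · refine Spec.of_le (Spec.seq (Spec.loop (fun i ρ => ρ.var .g = g + i ∧
      Region M p K (ρ.arr .blk) (g + i) (M.partials (M.results a) a i) ∧
      ∀ q, (g + i + 1) * M.n * (2 ^ K * 2 ^ K) ≤ q → ρ.arr .blk q = 0)
      (M.R * (2 ^ K * (rowCost K + 4) + 84) + 10) (by decide) ?_ ?_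
      fun τ hfr hI => And.intro hI hfr) (T₂ := 12) ?_) ?_
    · obtain ⟨⟨h1, h2⟩, hfr⟩ := hτ
      simp only [State.set_arr] at h1 h2
      have e1 := hfr.var .g (by decide)
      simp only [State.set_var, reduceCtorEq, if_false, hg] at e1
      refine ⟨by simpa using e1, ?_, fun q hq => ?_⟩
      · intro v hv
        simp only [State.set_arr, add_zero]
        by_cases hvs : v = M.s a
        · subst hvs
          refine ⟨hE.copy h1, ?_⟩
          rw [blockSpan, blockRows_copy h1, ← blockSpan, hspan]
          congr 1
          ext L
          simp [MoveSystem.partials]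
        · have h0 : ∀ q, (g * M.n + v) * (2 ^ K * 2 ^ K) ≤ q →
              q < (g * M.n + v + 1) * (2 ^ K * 2 ^ K) → τ.arr .blk q = 0 := fun q hq hq' => by
            rw [h2 q (block_disjoint (by omega) hq hq')]
            exact hz q ((Nat.mul_le_mul_right _ (by omega)).trans hq)
          refine ⟨echelon_of_zero hp0 h0, ?_⟩
          rw [blockSpan_of_zero h0]
          have : M.partials (M.results a) a 0 v = ∅ := by
            ext L; simp [MoveSystem.partials, hvs]
          simp [this, tokenSpan]
      · simp only [State.set_arr]
        rw [add_zero] at hq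
        rw [h2 q (.inr ((Nat.mul_le_mul_right _ (by omega)).trans hq))]
        exact hz q ((Nat.mul_le_mul_right _ (by omega)).trans hq)
    · rintro i ρ hi hρi hfr' ⟨h1, h2, h3⟩
      obtain ⟨-, hfr⟩ := hτ
      have e1 := hfr.var .l (by decide)
      simp only [State.set_var, reduceCtorEq, if_false, hc.l] at e1
      rw [e1] at hi
      have hcτ : Ctx M p K m ρ := by
        -- The position `o` does not influence which variables change; the closed statement for `o =
        -- 0` lets `decide` check them.
        refine Ctx.of_frame (s := agentStmt 0) hc ⟨fun y hy => ?_, fun a ha => ?_⟩ (by decide)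
        · simp only [agentStmt, Stmt.vars, List.mem_append, not_or] at hy
          rw [hfr'.var y (by simp_all [Stmt.vars]), hfr.var y (by simp_all [Stmt.vars, copyStmt])]
          simp_all
        · simp only [agentStmt, Stmt.arrs, List.mem_append, not_or] at ha
          rw [hfr'.arr a (by simp_all [Stmt.arrs]), hfr.arr a (by simp_all [Stmt.arrs, copyStmt])]
          rfl
      refine (stepStmt_spec hcτ hpV hDV (hgn _ (by omega)) (by omega) hUV h1 hρi hi h2 h3).mono
        le_rfl ?_
      rintro ω ⟨k1, k2, k3⟩
      exact ⟨by simpa [add_assoc] using k1, k2, k3⟩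
    · rintro ρ ⟨⟨h1, h2, h3⟩, hfr'⟩
      obtain ⟨-, hfr⟩ := hτ
      have e1 := hfr.var .l (by decide)
      have e2 := (hfr'.var .n (by decide)).trans (hfr.var .n (by decide))
      have e3 := (hfr'.var .v (by decide)).trans (hfr.var .v (by decide))
      simp only [State.set_var, reduceCtorEq, if_false, if_true, hc.l, hc.n, Expr.eval_add,
        Expr.eval_lit, Expr.eval_mul, Expr.eval_ofNat, Expr.eval_var, hc.m, hc.k, ha, ht.2]
        at e1 e2 e3
      rw [e1] at h1 h2 h3
      have hgl := hgn' (g + M.l) (by omega)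
      refine Spec.of_le (Spec.assign_seq ?_ <| Spec.assign ?_ ?_) (by simp)
      · simp only [Expr.eval_add, Expr.eval_mul, Expr.eval_var, h1, e2, e3]
        omega
      · simp [h1]; omega
      · have hg2 : (g + M.l + 1) * M.n = (g + M.l) * M.n + M.n := by ring
        have hr := h2 (M.t a) htn
        constructor <;> simp only [State.set_var, State.set_arr, reduceCtorEq, if_true, if_false,
          Expr.eval_add, Expr.eval_mul, Expr.eval_var, Expr.eval_ofNat, h1, e2, e3]
        · rw [hgdef]; ring
        · omega
        · exact hr.1
        · exact hr.2
        · exact h3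
    · obtain ⟨-, hfr⟩ := hτ
      have e1 := hfr.var .l (by decide)
      simp only [State.set_var, reduceCtorEq, if_false, hc.l] at e1
      rw [e1]

theorem MoveSystem.partials_spec (M : MoveSystem) {A : Set (List ℕ)} {a N : ℕ}
    (hA : ∀ L ∈ A, L.length = N ∧ ∀ z ∈ L, z < M.l * M.U) {i : ℕ} (hi : i ≤ M.l) {v : ℕ}
    {L : List ℕ} (hL : L ∈ M.partials A a i v) :
    L.length = N + 2 * i ∧ ∀ z ∈ L, z < M.l * M.U := by
  induction i generalizing v L with
  | zero => exact hA L hL.1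
  | succ i ih =>
    obtain ⟨j, hj, -, L', hL', rfl⟩ := hL
    obtain ⟨h1, h2⟩ := ih (by omega) hL'
    have hiU : i * M.U + M.U ≤ M.l * M.U := by
      rw [← Nat.succ_mul]; exact Nat.mul_le_mul_right _ hi
    have hX := M.X_lt j hj
    have hY := M.Y_lt j hj
    refine ⟨by simp [h1]; omega, fun z hz => ?_⟩
    simp only [List.mem_cons] at hz
    rcases hz with rfl | rfl | hz
    · omega
    · omega
    · exact h2 z hz

/-- Both facts feed into `tokenSpan_eq_bot_iff`: with `2 * (k * l)` factors the products have top
degree, and tokens below the prime `p` stay distinct modulo `p`. -/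
theorem MoveSystem.results_spec (M : MoveSystem) {a : ℕ} {L : List ℕ} (hL : L ∈ M.results a) :
    L.length = 2 * (a * M.l) ∧ ∀ z ∈ L, z < M.l * M.U := by
  induction a generalizing L with
  | zero =>
    obtain rfl : L = [] := hL
    simp
  | succ a ih =>
    obtain ⟨h1, h2⟩ := M.partials_spec (fun L hL => ih hL) le_rfl hL
    exact ⟨by rw [h1]; ring, h2⟩

/-- A space of exterior products is nonzero iff some list has no repetition. -/
theorem tokenSpan_eq_bot_iff [Fact p.Prime] {A : Set (List ℕ)}
    (hA : ∀ L ∈ A, L.length = K ∧ ∀ z ∈ L, z < p) :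
    tokenSpan p K A = ⊥ ↔ ∀ L ∈ A, ¬ L.Nodup := by
  rw [tokenSpan, Submodule.span_eq_bot]
  constructor
  · intro h L hL hnd
    obtain ⟨h1, h2⟩ := hA L hL
    have h0 := h _ ⟨L, hL, rfl⟩
    -- Distinct numbers below `p` remain distinct as residues, so the points of the Vandermonde
    -- matrix differ.
    have hnd' : (L.map fun z : ℕ => (z : ZMod p)).Nodup := by
      refine hnd.map_on fun x hx y hy hxy => ?_
      rw [ZMod.natCast_eq_natCast_iff'] at hxy
      rwa [Nat.mod_eq_of_lt (h2 x hx), Nat.mod_eq_of_lt (h2 y hy)] at hxy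
    have := wedgeList_pow_ne_zero hnd'
    rw [List.map_map, List.length_map, h1] at this
    exact this (congrFun h0 _)
  · rintro h _ ⟨L, hL, rfl⟩
    refine wedgeList_eq_zero_of_not_nodup K fun hnd => h L hL ?_
    exact hnd.of_map _

/-- Storing `1` in cell `0` makes block `0` the line spanned by the empty product, which is
generation zero of the programme. In the end a nonzero entry on the diagonal of the block `ptr` is
equivalent to a nonzero space, hence to a list without repetition. -/
theorem searchStmt_spec [Fact p.Prime] {o : ℕ}
    (hc : Ctx M p K m σ) (hpV : p ≤ V) (hDV : 2 ^ K ≤ V)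
    (hgV : (M.k * (M.l + 1) + 3) * M.n * (2 ^ K * 2 ^ K) ≤ V) (hUp : M.l * M.U < p)
    (hk : 0 < M.k) (hK : K = 2 * (M.k * M.l))
    (hs : ∀ a < M.k, o + 4 + 2 * m + a < L ∧ inp (o + 4 + 2 * m + a) = M.s a)
    (ht : ∀ a < M.k, o + 4 + 2 * m + M.k + a < L ∧ inp (o + 4 + 2 * m + M.k + a) = M.t a)
    (hz : ∀ q, σ.arr .blk q = 0) :
    Spec inp L V (searchStmt o) σ (M.k * (agentCost M K + 4) + 2 ^ K * 40 + 40) fun τ =>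
      ((∃ T ∈ M.results M.k, T.Nodup) ∧ τ.var .len = 1) ∨
      ((¬ ∃ T ∈ M.results M.k, T.Nodup) ∧ τ.var .len = 0) := by
  have hp1 : 1 < p := (Fact.out : p.Prime).one_lt
  have hn : 0 < M.n := (Nat.zero_le _).trans_lt (M.s_lt 0 hk)
  have h1D : 1 ≤ 2 ^ K := Nat.one_le_two_pow
  refine Spec.of_le (Spec.store_seq ?_ <| Spec.assign_seq ?_ <| Spec.assign_seq ?_ <|
    Spec.seq (T₁ := M.k * (agentCost M K + 4) + 3) (Q' := fun τ => AgentInv M p K M.k τ ∧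
      τ.var .d = 2 ^ K ∧ τ.var .dd = 2 ^ K * 2 ^ K)
      (Spec.of_le (Spec.loop (AgentInv M p K) (agentCost M K) ⟨by decide, ?_, ?_⟩ ?_ ?_ ?_) ?_)
      (T₂ := 2 ^ K * 40 + 10) fun τ hτ => ?_) ?_
  · simp; omega
  · simp
  · simp; omega
  · simp only [agentStmt, Stmt.vars]; decide
  · simp only [agentStmt, Stmt.vars]; decide
  · have hblk : ∀ q, (if q = 0 then 1 else σ.arr .blk q) = if q = 0 then 1 else 0 := by
      simp [hz]
    constructor <;> simp only [State.set_var, State.set_arr, State.put_arr, State.put_var,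
      reduceCtorEq, if_true, if_false, Expr.eval_ofNat, true_and, zero_mul, add_zero, one_mul]
    · exact hn
    · intro S hS S' hS'
      simp only [zero_mul, zero_add, hblk, State.put_arr, true_and]
      refine ⟨by split_ifs <;> omega, fun h => ?_⟩
      rw [if_neg]
      have := Nat.le_mul_of_pos_right S h1D
      omega
    · rw [blockSpan, tokenSpan, MoveSystem.results, Set.image_singleton]
      congr 1
      ext f
      simp only [blockRows, Set.mem_ofPred_eq, Set.mem_singleton_iff, zero_mul, zero_add,
        State.put_arr, true_and, hz]
      -- The only nonzero coefficient of the unit of the exterior algebra is at the empty mask, so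
      -- it is row `0` with pivot `0`.
      have hrow : ∀ A : ℕ → ℕ, (∀ q, A q = if q = 0 then 1 else 0) →
          vec p (2 ^ K) A 0 = tokenVec p K [] := by
        intro A hA
        funext S
        simp only [vec, zero_add, hA, tokenVec, wedgeList, List.map_nil, List.foldr_nil,
          Pi.single_apply]
        split_ifs <;> first | omega | simp
      constructor
      · rintro ⟨S, hS, hne, rfl⟩
        have hS0 : S * 2 ^ K + S = 0 := by
          by_contra h
          rw [if_neg h] at hne
          exact hne rfl
        obtain rfl : S = 0 := by omega
        rw [zero_mul]
        exact hrow _ fun q => by simp [hz]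
      · rintro rfl
        refine ⟨0, h1D, by simp, ?_⟩
        rw [zero_mul]
        exact (hrow _ fun q => by simp [hz]).symm
    · intro q hq
      rw [hz, if_neg]
      have : 1 * 1 ≤ M.n * (2 ^ K * 2 ^ K) := Nat.mul_le_mul hn (Nat.mul_pos h1D h1D)
      omega
  · intro a τ ha hτa hfr hI
    have hcτ : Ctx M p K m τ := by
      refine Ctx.of_frame (s := searchStmt 0) hc ⟨fun y hy => ?_, fun b hb => ?_⟩ (by decide)
      · simp only [searchStmt, agentStmt, Stmt.vars, List.mem_append, not_or] at hy
        rw [hfr.var y (by simp_all [agentStmt, Stmt.vars])]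
        simp_all
      · simp only [searchStmt, agentStmt, Stmt.arrs, List.mem_append, not_or] at hb
        rw [hfr.arr b (by simp_all [agentStmt, Stmt.arrs])]
        simp only [State.set_arr]
        exact State.put_arr_of_ne _ _ _ _ _ (by simp_all)
    simp only [State.set_var, State.put_var, reduceCtorEq, if_false, hc.k] at ha
    refine (agentStmt_spec hcτ hpV hDV hgV (by omega) hτa ha (hs a ha) (ht a ha) hI).mono le_rfl ?_
    rintro ρ ⟨h1, h2, h3, h4, h5⟩
    exact ⟨h1, h2, h3, h4, h5⟩
  · intro τ hfr hI
    simp only [State.set_var, State.put_var, reduceCtorEq, if_false, hc.k] at hI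
    refine ⟨hI, ?_, ?_⟩
    · rw [hfr.var .d (by simp only [agentStmt, Stmt.vars]; decide)]
      simpa using hc.d
    · rw [hfr.var .dd (by simp only [agentStmt, Stmt.vars]; decide)]
      simpa using hc.dd
  · simp [hc.k]
  · obtain ⟨hI, hd, hdd⟩ := hτ
    have hbot := blockSpan_eq_bot_iff hI.echelon
    rw [hI.span, tokenSpan_eq_bot_iff (fun L hL => ?_)] at hbot
    · refine Spec.of_le (Spec.assign_seq (by simp) <| Spec.loop (fun t ρ =>
        ((∃ S < t, τ.arr .blk (τ.var .ptr * (2 ^ K * 2 ^ K) + S * 2 ^ K + S) ≠ 0) ∧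
          ρ.var .len = 1) ∨
        ((∀ S < t, τ.arr .blk (τ.var .ptr * (2 ^ K * 2 ^ K) + S * 2 ^ K + S) = 0) ∧
          ρ.var .len = 0)) 36 (by decide) ?_ ?_ ?_) ?_
      · right; simp
      · intro t ρ ht hρ hfr hJ
        have e1 := hfr.var .ptr (by decide)
        have e2 := hfr.var .dd (by decide)
        have e3 := hfr.var .d (by decide)
        have e4 := hfr.arr .blk (by decide)
        simp only [State.set_var, State.set_arr, reduceCtorEq, if_false, hd, hdd] at e1 e2 e3 e4
        refine Spec.of_le (Spec.ite (T := 2) (fun hne => ?_) (fun heq => ?_)) (by simp)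
        · simp only [Expr.eval_ofNat, Expr.eval_get, Expr.eval_add, Expr.eval_mul, Expr.eval_var,
            e1, e2, e3, e4, hρ] at hne
          refine Spec.of_le (Spec.assign (by simp; omega) (.inl ⟨⟨t, by omega, by omega⟩, ?_⟩))
            (by simp)
          simp
        · simp only [Expr.eval_ofNat, Expr.eval_get, Expr.eval_add, Expr.eval_mul, Expr.eval_var,
            e1, e2, e3, e4, hρ] at heq
          refine Spec.of_le (Spec.skip ?_) (by omega)
          rcases hJ with ⟨⟨S, hS, hne⟩, h⟩ | ⟨h0, h⟩
          · exact .inl ⟨⟨S, by omega, hne⟩, by simpa using h⟩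
          · refine .inr ⟨fun S hS => ?_, by simpa using h⟩
            rcases Nat.lt_succ_iff_lt_or_eq.1 hS with hS | rfl
            · exact h0 S hS
            · omega
      · intro ρ hfr hJ
        simp only [State.set_var, reduceCtorEq, if_false, hd] at hJ
        rcases hJ with ⟨⟨S, hS, hne⟩, h⟩ | ⟨h0, h⟩
        · refine .inl ⟨?_, h⟩
          by_contra hcon
          push Not at hcon
          exact hne (hbot.1 hcon S hS)
        · refine .inr ⟨?_, h⟩
          push Not
          exact hbot.2 h0
      · simp [hd]; omega
    · obtain ⟨h1, h2⟩ := M.results_spec hL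
      exact ⟨by rw [h1, hK], fun z hz => (h2 z hz).trans hUp⟩
  · simp; omega

end

end RAM

namespace RAM

/-! ### Route data over the natural numbers -/

/-- An instance with vertices `0, …, n - 1`, edges between `u e` and `v e` for `e < m`, agents
`0, …, k - 1` with starts `s` and targets `t`, and makespan `l`. -/
structure Data where
  (n m k l : ℕ)
  (u v s t : ℕ → ℕ)
  u_lt : ∀ e < m, u e < n
  v_lt : ∀ e < m, v e < n
  s_lt : ∀ a < k, s a < n
  t_lt : ∀ a < k, t a < n

namespace Data

variable (G : Data)

/-- The edge `e` joins `x` to `y`. -/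
def Joins (e x y : ℕ) : Prop := (x = G.u e ∧ y = G.v e) ∨ (x = G.v e ∧ y = G.u e)

/-- There is a schedule for the agents; edges may be used in both directions at once unless
`δ = 0`. -/
def Solvable (δ : ℕ) : Prop :=
  ∃ w : ℕ → ℕ → ℕ, (∀ a < G.k, w 0 a = G.s a) ∧ (∀ a < G.k, w G.l a = G.t a) ∧
    ∀ i < G.l, (∀ a < G.k, w (i + 1) a = w i a ∨ ∃ e < G.m, G.Joins e (w i a) (w (i + 1) a)) ∧
      (∀ a < G.k, ∀ b < G.k, a ≠ b → w (i + 1) a ≠ w (i + 1) b) ∧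
      (δ = 0 → ∀ a < G.k, ∀ b < G.k, a ≠ b → w (i + 1) a = w i b → w (i + 1) b ≠ w i a)

/-- The number of labels. -/
def A : ℕ := 2 * G.m + G.k

/-- The vertex that can have the label `c`. -/
def vertex (c : ℕ) : ℕ :=
  if c < 2 * G.m then if c % 2 = 0 then G.u (c / 2) else G.v (c / 2) else G.s (c - 2 * G.m)

theorem vertex_two_mul {e : ℕ} (he : e < G.m) : G.vertex (2 * e) = G.u e := by
  rw [vertex, if_pos (by omega), if_pos (by omega)]; congr 1; omega

theorem vertex_two_mul_add_one {e : ℕ} (he : e < G.m) : G.vertex (2 * e + 1) = G.v e := by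
  rw [vertex, if_pos (by omega), if_neg (by omega)]; congr 1; omega

theorem vertex_add (a : ℕ) : G.vertex (2 * G.m + a) = G.s a := by
  rw [vertex, if_neg (by omega)]; congr 1; omega

/-- `f` gives the vertex `x` a proper label. -/
def Labels (f : ℕ → ℕ) (x : ℕ) : Prop := f x < G.A ∧ G.vertex (f x) = x

/-- `f` labels all ends of edges and all starts. -/
structure IsLabelling (f : ℕ → ℕ) : Prop where
  u : ∀ e < G.m, G.Labels f (G.u e)
  v : ∀ e < G.m, G.Labels f (G.v e)
  s : ∀ a < G.k, G.Labels f (G.s a)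

variable {G}

/-- A vertex may have several possible labels, but a label determines its vertex through `vertex`.
Hence comparing labels is the same as comparing vertices. -/
theorem Labels.inj {f : ℕ → ℕ} {x y : ℕ} (hx : G.Labels f x) (hy : G.Labels f y)
    (h : f x = f y) : x = y := by
  rw [← hx.2, ← hy.2, h]

variable (G)

/-- The start of the `j`-th move: two moves along every edge, waiting at its ends, waiting at
the starts. -/
def fr (j : ℕ) : ℕ :=
  if j < 4 * G.m then if j % 2 = 0 then G.u (j / 4) else G.v (j / 4) else G.s (j - 4 * G.m)

/-- The end of the `j`-th move. -/
def tgt (j : ℕ) : ℕ :=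
  if j < 4 * G.m then
    if j % 4 = 0 ∨ j % 4 = 3 then G.v (j / 4) else G.u (j / 4)
  else G.s (j - 4 * G.m)

/-- The token of the `j`-th move. -/
def tok (δ : ℕ) (f : ℕ → ℕ) (j : ℕ) : ℕ :=
  if j < 4 * G.m ∧ j % 4 < 2 then 2 * G.A + 2 * (j / 4) + δ * (j % 4) else G.A + f (G.tgt j)

variable {G} in
theorem fr_lt {j : ℕ} (hj : j < 4 * G.m + G.k) : G.fr j < G.n := by
  rw [fr]
  split_ifs
  · exact G.u_lt _ (by omega)
  · exact G.v_lt _ (by omega)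
  · exact G.s_lt _ (by omega)

variable {G} in
theorem tgt_lt {j : ℕ} (hj : j < 4 * G.m + G.k) : G.tgt j < G.n := by
  rw [tgt]
  split_ifs
  · exact G.v_lt _ (by omega)
  · exact G.u_lt _ (by omega)
  · exact G.s_lt _ (by omega)

/-- A move ends at an end of an edge or at a start, and exactly these vertices are labelled. -/
theorem labels_tgt {f : ℕ → ℕ} (hf : G.IsLabelling f) {j : ℕ} (hj : j < 4 * G.m + G.k) :
    G.Labels f (G.tgt j) := by
  rw [tgt]
  split_ifs
  · exact hf.v _ (by omega)
  · exact hf.u _ (by omega)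
  · exact hf.s _ (by omega)

/-- Three ranges of length `A` are in use: labels of entered vertices below `A`, pauses from `A` on,
and edges from `2 * A` on, where `2 * m ≤ A` leaves room for two tokens per edge. -/
theorem tok_lt {δ : ℕ} (hδ : δ ≤ 1) {f : ℕ → ℕ} (hf : G.IsLabelling f) {j : ℕ}
    (hj : j < 4 * G.m + G.k) : G.tok δ f j < 3 * G.A := by
  have := (G.labels_tgt hf hj).1
  rw [tok]
  split_ifs with h
  · have := Nat.mul_le_mul hδ (show j % 4 ≤ 1 by omega)
    simp only [A]; omega
  · omega

/-- The moves of an instance. -/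
def moves (δ : ℕ) (hδ : δ ≤ 1) (f : ℕ → ℕ) (hf : G.IsLabelling f) : MoveSystem where
  n := G.n
  k := G.k
  l := G.l
  R := 4 * G.m + G.k
  U := 3 * G.A
  fr := G.fr
  tgt := G.tgt
  X := G.tok δ f
  Y j := f (G.tgt j)
  s := G.s
  t := G.t
  fr_lt _ hj := fr_lt hj
  tgt_lt _ hj := tgt_lt hj
  X_lt j hj := G.tok_lt hδ hf hj
  Y_lt j hj := by have := (G.labels_tgt hf hj).1; omega
  s_lt := G.s_lt
  t_lt := G.t_lt

/-- A move along an edge or a pause. -/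
theorem joins_or_eq (j : ℕ) :
    (j < 4 * G.m ∧ j % 4 < 2 ∧ G.Joins (j / 4) (G.fr j) (G.tgt j)) ∨
      ((¬ (j < 4 * G.m ∧ j % 4 < 2)) ∧ G.fr j = G.tgt j) := by
  by_cases h : j < 4 * G.m
  · rw [fr, tgt, if_pos h, if_pos h]
    have : j % 4 = 0 ∨ j % 4 = 1 ∨ j % 4 = 2 ∨ j % 4 = 3 := by omega
    rcases this with h' | h' | h' | h'
    · rw [if_pos (by omega), if_pos (by omega)]
      exact .inl ⟨h, by omega, .inl ⟨rfl, rfl⟩⟩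
    · rw [if_neg (by omega), if_neg (by omega)]
      exact .inl ⟨h, by omega, .inr ⟨rfl, rfl⟩⟩
    · rw [if_pos (by omega), if_neg (by omega)]
      exact .inr ⟨by omega, rfl⟩
    · rw [if_neg (by omega), if_pos (by omega)]
      exact .inr ⟨by omega, rfl⟩
  · rw [fr, tgt, if_neg h, if_neg h]
    exact .inr ⟨by tauto, rfl⟩

theorem exists_move_of_joins {e x y : ℕ} (he : e < G.m) (h : G.Joins e x y) :
    ∃ j < 4 * G.m + G.k, G.fr j = x ∧ G.tgt j = y := by
  rcases h with ⟨rfl, rfl⟩ | ⟨rfl, rfl⟩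
  · refine ⟨4 * e, by omega, ?_, ?_⟩
    · rw [fr, if_pos (by omega), if_pos (by omega)]; congr 1; omega
    · rw [tgt, if_pos (by omega), if_pos (by omega)]; congr 1; omega
  · refine ⟨4 * e + 1, by omega, ?_, ?_⟩
    · rw [fr, if_pos (by omega), if_neg (by omega)]; congr 1; omega
    · rw [tgt, if_pos (by omega), if_neg (by omega)]; congr 1; omega

/-- Pauses are available only at starts and at ends of edges. That is enough, since an agent stands
at its start or where its last move ended. -/
theorem exists_move_self {x : ℕ} (h : (∃ a < G.k, x = G.s a) ∨ ∃ j < 4 * G.m + G.k, x = G.tgt j) :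
    ∃ j < 4 * G.m + G.k, G.fr j = x ∧ G.tgt j = x := by
  have hs : ∀ a < G.k, ∃ j < 4 * G.m + G.k, G.fr j = G.s a ∧ G.tgt j = G.s a := fun a ha => by
    refine ⟨4 * G.m + a, by omega, ?_, ?_⟩
    · rw [fr, if_neg (by omega)]; congr 1; omega
    · rw [tgt, if_neg (by omega)]; congr 1; omega
  rcases h with ⟨a, ha, rfl⟩ | ⟨j, hj, rfl⟩
  · exact hs a ha
  · by_cases h : j < 4 * G.m
    · by_cases h' : j % 4 = 0 ∨ j % 4 = 3
      · refine ⟨4 * (j / 4) + 3, by omega, ?_, ?_⟩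
        · rw [fr, tgt, if_pos (by omega), if_neg (by omega), if_pos h, if_pos h']
          congr 1; omega
        · rw [tgt, tgt, if_pos (by omega), if_pos (by omega), if_pos h, if_pos h']
          congr 1; omega
      · refine ⟨4 * (j / 4) + 2, by omega, ?_, ?_⟩
        · rw [fr, tgt, if_pos (by omega), if_pos (by omega), if_pos h, if_neg h']
          congr 1; omega
        · rw [tgt, tgt, if_pos (by omega), if_neg (by omega), if_pos h, if_neg h']
          congr 1; omega
    · rw [tgt, if_neg h]
      exact hs _ (by omega)

variable {G}

/-- Moves with the same token collide or exchange their ends. -/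
theorem tok_eq {δ : ℕ} (hδ : δ ≤ 1) {f : ℕ → ℕ} (hf : G.IsLabelling f) {j j' : ℕ}
    (hj : j < 4 * G.m + G.k) (hj' : j' < 4 * G.m + G.k) (h : G.tok δ f j = G.tok δ f j') :
    G.tgt j = G.tgt j' ∨ δ = 0 ∧ G.fr j = G.tgt j' ∧ G.fr j' = G.tgt j := by
  have hl := G.labels_tgt hf hj
  have hl' := G.labels_tgt hf hj'
  have h1 := hl.1
  have h1' := hl'.1
  rw [tok, tok] at h
  split_ifs at h with c c'
  · have e1 : j % 4 = 0 ∨ j % 4 = 1 := by omega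
    have e1' : j' % 4 = 0 ∨ j' % 4 = 1 := by omega
    obtain rfl | rfl : δ = 0 ∨ δ = 1 := by omega
    · have hq : j / 4 = j' / 4 := by omega
      rw [tgt, tgt, fr, fr, if_pos c.1, if_pos c'.1, if_pos c.1, if_pos c'.1, hq]
      rcases e1 with e1 | e1 <;> rcases e1' with e1' | e1'
      · left; rw [if_pos (by omega), if_pos (by omega)]
      · right; rw [if_pos (by omega), if_neg (by omega), if_neg (by omega), if_pos (by omega)]
        exact ⟨rfl, rfl, rfl⟩
      · right; rw [if_neg (by omega), if_pos (by omega), if_pos (by omega), if_neg (by omega)]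
        exact ⟨rfl, rfl, rfl⟩
      · left; rw [if_neg (by omega), if_neg (by omega)]
    · left
      have : j = j' := by omega
      rw [this]
  · omega
  · omega
  · exact .inl (hl.inj hl' (by omega))

/-- In a list of edges without repetition an unordered pair of ends determines the edge. Without
this, two agents could swap along parallel edges with different tokens. -/
theorem eq_of_joins {e e' x y : ℕ}
    (hs : ∀ e < G.m, ∀ e' < e, ¬ G.Joins e (G.u e') (G.v e')) (he : e < G.m) (he' : e' < G.m)
    (h : G.Joins e x y) (h' : G.Joins e' y x) : e = e' := by
  have key : ∀ a b, a < G.m → b < a → G.Joins a x y → G.Joins b y x → False := by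
    intro a b ha hb h1 h2
    refine hs a ha b hb ?_
    rcases h1 with ⟨rfl, rfl⟩ | ⟨rfl, rfl⟩ <;> rcases h2 with ⟨h3, h4⟩ | ⟨h3, h4⟩ <;>
      simp [Joins, h3, h4]
  rcases lt_trichotomy e e' with hlt | heq | hlt
  · have sw : ∀ a x y, G.Joins a x y → G.Joins a y x := fun a x y h => by
      rcases h with ⟨h1, h2⟩ | ⟨h1, h2⟩ <;> simp [Joins, h1, h2]
    exact (key e' e he' hlt (sw _ _ _ h') (sw _ _ _ h)).elim
  · exact heq
  · have := key e e' he hlt h h'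
    exact this.elim

/-- Moves that exchange two vertices along a simple edge have the same token. -/
theorem tok_eq_of_swap {f : ℕ → ℕ}
    (hs : ∀ e < G.m, ∀ e' < e, ¬ G.Joins e (G.u e') (G.v e')) {j j' : ℕ}
    (h : G.tgt j = G.fr j')
    (h' : G.tgt j' = G.fr j) (hne : G.fr j ≠ G.tgt j) : G.tok 0 f j = G.tok 0 f j' := by
  rcases G.joins_or_eq j with ⟨h1, h2, h3⟩ | ⟨-, h3⟩
  · rcases G.joins_or_eq j' with ⟨h1', h2', h3'⟩ | ⟨-, h3'⟩
    · rw [← h, h'] at h3'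
      have := eq_of_joins hs (by omega) (by omega) h3 h3'
      rw [tok, tok, if_pos ⟨h1, h2⟩, if_pos ⟨h1', h2'⟩, this]
      simp
    · exact (hne (by rw [h, ← h', h3'])).elim
  · exact (hne h3).elim

end Data

/-! ### Walks and their token lists -/

namespace MoveSystem

variable (M : MoveSystem)

/-- The tokens of `i` steps given by the moves `J`. -/
def toks (J : ℕ → ℕ) : ℕ → List ℕ
  | 0 => []
  | i + 1 => (i * M.U + M.Y (J i)) :: (i * M.U + M.X (J i)) :: toks J i

/-- The tokens of the first `a` agents. -/
def allToks (J : ℕ → ℕ → ℕ) : ℕ → List ℕ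
  | 0 => []
  | a + 1 => M.toks (J a) M.l ++ allToks J a

/-- The moves `J` form a walk of agent `a` of length `i` along the vertices `w`. -/
structure Walk (a : ℕ) (J w : ℕ → ℕ) (i : ℕ) : Prop where
  start : w 0 = M.s a
  lt : ∀ i' < i, J i' < M.R
  fr : ∀ i' < i, M.fr (J i') = w i'
  tgt : ∀ i' < i, M.tgt (J i') = w (i' + 1)

theorem toks_congr {J J' : ℕ → ℕ} {i : ℕ} (h : ∀ i' < i, J i' = J' i') :
    M.toks J i = M.toks J' i := by
  induction i with
  | zero => rfl
  | succ i ih => rw [toks, toks, ih fun i' hi' => h i' (by omega), h i (by omega)]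

/-- Unrolls the recursion of the dynamic programme: a list it produces consists of the tokens along
an explicit walk, latest step first, in front of a list of the previous agents. -/
theorem mem_partials {A : Set (List ℕ)} {a i v : ℕ} {L : List ℕ} :
    L ∈ M.partials A a i v ↔ ∃ J w, M.Walk a J w i ∧ w i = v ∧ ∃ L' ∈ A, L = M.toks J i ++ L' := by
  induction i generalizing v L with
  | zero =>
    constructor
    · rintro ⟨hL, rfl⟩
      exact ⟨0, fun _ => M.s a, ⟨rfl, by simp, by simp, by simp⟩, rfl, L, hL, rfl⟩
    · rintro ⟨J, w, hw, rfl, L', hL', rfl⟩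
      exact ⟨hL', hw.start⟩
  | succ i ih =>
    constructor
    · rintro ⟨j, hj, rfl, L₁, hL₁, rfl⟩
      obtain ⟨J, w, hw, hv, L', hL', rfl⟩ := ih.1 hL₁
      refine ⟨fun i' => if i' = i then j else J i', fun i' => if i' = i + 1 then M.tgt j else w i',
        ⟨by simpa using hw.start, ?_, ?_, ?_⟩, by simp, L', hL', ?_⟩
      · intro i' hi'
        split_ifs with h
        · exact hj
        · exact hw.lt i' (by omega)
      · intro i' hi'
        rw [if_neg (show i' ≠ i + 1 by omega)]
        split_ifs with h
        · rw [h, hv]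
        · exact hw.fr i' (by omega)
      · intro i' hi'
        split_ifs with h h' h'
        · rfl
        · omega
        · omega
        · exact hw.tgt i' (by omega)
      · rw [toks, if_pos rfl, M.toks_congr (J' := J) (fun i' hi' => if_neg hi'.ne)]
        rfl
    · rintro ⟨J, w, hw, rfl, L', hL', rfl⟩
      refine ⟨J i, hw.lt i (by omega), hw.tgt i (by omega), M.toks J i ++ L', ih.2 ⟨J, w,
        ⟨hw.start, fun i' hi' => hw.lt i' (by omega), fun i' hi' => hw.fr i' (by omega),
          fun i' hi' => hw.tgt i' (by omega)⟩, (hw.fr i (by omega)).symm, L', hL', rfl⟩, rfl⟩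

theorem allToks_congr {J J' : ℕ → ℕ → ℕ} {a : ℕ} (h : ∀ a' < a, J a' = J' a') :
    M.allToks J a = M.allToks J' a := by
  induction a with
  | zero => rfl
  | succ a ih => rw [allToks, allToks, ih fun i' hi' => h i' (by omega), h a (by omega)]

theorem mem_results {a : ℕ} {L : List ℕ} :
    L ∈ M.results a ↔ ∃ J w : ℕ → ℕ → ℕ, (∀ b < a, M.Walk b (J b) (w b) M.l ∧ w b M.l = M.t b) ∧
      L = M.allToks J a := by
  induction a generalizing L with
  | zero =>
    constructor
    · rintro rfl
      exact ⟨0, 0, by simp, rfl⟩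
    · rintro ⟨J, w, -, rfl⟩
      rfl
  | succ a ih =>
    rw [results, mem_partials]
    constructor
    · rintro ⟨J, w, hw, hv, L', hL', rfl⟩
      obtain ⟨J', w', hw', rfl⟩ := ih.1 hL'
      refine ⟨fun b => if b = a then J else J' b, fun b => if b = a then w else w' b,
        fun b hb => ?_, ?_⟩
      · dsimp only
        split_ifs with h
        · subst h; exact ⟨hw, hv⟩
        · exact hw' b (by omega)
      · rw [allToks, if_pos rfl, M.allToks_congr (J' := J') fun i' hi' => if_neg hi'.ne]
    · rintro ⟨J, w, hw, rfl⟩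
      exact ⟨J a, w a, (hw a (by omega)).1, (hw a (by omega)).2, M.allToks J a,
        ih.2 ⟨J, w, fun b hb => hw b (by omega), rfl⟩, rfl⟩

theorem mem_toks {J : ℕ → ℕ} {i z : ℕ} :
    z ∈ M.toks J i ↔ ∃ i' < i, z = i' * M.U + M.Y (J i') ∨ z = i' * M.U + M.X (J i') := by
  induction i with
  | zero => simp [toks]
  | succ i ih =>
    rw [toks, List.mem_cons, List.mem_cons, ih]
    constructor
    · rintro (h | h | ⟨i', hi', h⟩)
      · exact ⟨i, by omega, .inl h⟩
      · exact ⟨i, by omega, .inr h⟩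
      · exact ⟨i', by omega, h⟩
    · rintro ⟨i', hi', h⟩
      rcases Nat.lt_succ_iff_lt_or_eq.1 hi' with hi' | rfl
      · exact .inr (.inr ⟨i', hi', h⟩)
      · tauto

theorem mem_allToks {J : ℕ → ℕ → ℕ} {a z : ℕ} :
    z ∈ M.allToks J a ↔ ∃ b < a, z ∈ M.toks (J b) M.l := by
  induction a with
  | zero => simp [allToks]
  | succ a ih =>
    rw [allToks, List.mem_append, ih]
    constructor
    · rintro (h | ⟨b, hb, h⟩)
      · exact ⟨a, by omega, h⟩
      · exact ⟨b, by omega, h⟩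
    · rintro ⟨b, hb, h⟩
      rcases Nat.lt_succ_iff_lt_or_eq.1 hb with hb | rfl
      · exact .inr ⟨b, hb, h⟩
      · exact .inl h

/-- The tokens of step `i` fill part of the interval from `i * U` to `(i + 1) * U`, so only tokens
of the same step can coincide. -/
theorem add_mul_inj {U i i' x x' : ℕ} (hx : x < U) (hx' : x' < U)
    (h : i * U + x = i' * U + x') : i = i' ∧ x = x' := by
  have h1 : (i * U + x) / U = i := by
    rw [mul_comm, Nat.mul_add_div (by omega), Nat.div_eq_of_lt hx, add_zero]
  have h2 : (i' * U + x') / U = i' := by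
    rw [mul_comm, Nat.mul_add_div (by omega), Nat.div_eq_of_lt hx', add_zero]
  have : i = i' := by rw [← h1, ← h2, h]
  subst this
  exact ⟨rfl, by omega⟩

variable {M}

/-- A single walk never collides with itself: different steps use different intervals, and within a
step the two kinds of tokens are disjoint. -/
theorem nodup_toks (hXY : ∀ j < M.R, ∀ j' < M.R, M.X j ≠ M.Y j') {J : ℕ → ℕ} {i : ℕ}
    (hJ : ∀ i' < i, J i' < M.R) : (M.toks J i).Nodup := by
  induction i with
  | zero => exact List.nodup_nil
  | succ i ih =>
    have hJi := hJ i (by omega)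
    have hY := M.Y_lt _ hJi
    have hX := M.X_lt _ hJi
    have key : ∀ x, x < M.U → i * M.U + x ∉ M.toks J i := by
      intro x hx hmem
      obtain ⟨i', hi', h⟩ := M.mem_toks.1 hmem
      have hY' := M.Y_lt _ (hJ i' (by omega))
      have hX' := M.X_lt _ (hJ i' (by omega))
      rcases h with h | h
      · have := (add_mul_inj hx hY' h).1; omega
      · have := (add_mul_inj hx hX' h).1; omega
    rw [toks, List.nodup_cons, List.nodup_cons, List.mem_cons, not_or]
    refine ⟨⟨fun h => ?_, key _ hY⟩, key _ hX, ih fun i' hi' => hJ i' (by omega)⟩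
    exact hXY _ hJi _ hJi (by omega)

/-- A repetition needs two agents and the same step, and it pairs tokens of the same kind because
the two kinds are disjoint. -/
theorem nodup_allToks (hXY : ∀ j < M.R, ∀ j' < M.R, M.X j ≠ M.Y j') {J : ℕ → ℕ → ℕ} {a : ℕ}
    (hJ : ∀ b < a, ∀ i < M.l, J b i < M.R) :
    (M.allToks J a).Nodup ↔ ∀ b < a, ∀ c < b, ∀ i < M.l, M.X (J b i) ≠ M.X (J c i) ∧
      M.Y (J b i) ≠ M.Y (J c i) := by
  induction a with
  | zero => simp [allToks]
  | succ a ih =>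
    rw [allToks, List.nodup_append', ih fun b hb => hJ b (by omega)]
    constructor
    · rintro ⟨-, h, hd⟩ b hb c hc i hi
      rcases Nat.lt_succ_iff_lt_or_eq.1 hb with hb | rfl
      · exact h b hb c hc i hi
      · constructor
        · intro heq
          refine hd (M.mem_toks.2 ⟨i, hi, .inr rfl⟩) (M.mem_allToks.2 ⟨c, hc, ?_⟩)
          rw [heq]
          exact M.mem_toks.2 ⟨i, hi, .inr rfl⟩
        · intro heq
          refine hd (M.mem_toks.2 ⟨i, hi, .inl rfl⟩) (M.mem_allToks.2 ⟨c, hc, ?_⟩)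
          rw [heq]
          exact M.mem_toks.2 ⟨i, hi, .inl rfl⟩
    · intro h
      refine ⟨nodup_toks hXY (hJ a (by omega)), fun b hb => h b (by omega), ?_⟩
      intro z hz hz'
      obtain ⟨i, hi, h1⟩ := M.mem_toks.1 hz
      obtain ⟨c, hc, hz'⟩ := M.mem_allToks.1 hz'
      obtain ⟨i', hi', h2⟩ := M.mem_toks.1 hz'
      have hj := hJ a (by omega) i hi
      have hj' := hJ c (by omega) i' hi'
      have hY := M.Y_lt _ hj
      have hX := M.X_lt _ hj
      have hY' := M.Y_lt _ hj'
      have hX' := M.X_lt _ hj'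
      have key := h a (by omega) c hc i hi
      rcases h1 with h1 | h1 <;> rcases h2 with h2 | h2
      · obtain ⟨rfl, h3⟩ := add_mul_inj hY hY' (h1.symm.trans h2)
        exact key.2 h3
      · obtain ⟨rfl, h3⟩ := add_mul_inj hY hX' (h1.symm.trans h2)
        exact hXY _ hj' _ hj h3.symm
      · obtain ⟨rfl, h3⟩ := add_mul_inj hX hY' (h1.symm.trans h2)
        exact hXY _ hj _ hj' h3
      · obtain ⟨rfl, h3⟩ := add_mul_inj hX hX' (h1.symm.trans h2)
        exact key.1 h3

end MoveSystem

/-! ### Solutions as token lists without repetition -/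

namespace Data

variable {G : Data}

/-- The schedules are the conflict-free systems of walks. -/
theorem exists_nodup_iff_solvable {δ : ℕ} (hδ : δ ≤ 1) {f : ℕ → ℕ} (hf : G.IsLabelling f)
    (hs : ∀ e < G.m, ∀ e' < e, ¬ G.Joins e (G.u e') (G.v e'))  :
    (∃ T ∈ (G.moves δ hδ f hf).results G.k, T.Nodup) ↔ G.Solvable δ := by
  set M := G.moves δ hδ f hf with hM
  -- Tokens `X` are at least `G.A`, whereas tokens `Y` are labels below `G.A`.
  have hXY : ∀ j < M.R, ∀ j' < M.R, M.X j ≠ M.Y j' := by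
    intro j hj j' hj'
    have := (G.labels_tgt hf hj').1
    change G.tok δ f j ≠ f (G.tgt j')
    rw [tok]
    split_ifs <;> omega
  constructor
  · rintro ⟨T, hT, hnd⟩
    obtain ⟨J, w, hw, rfl⟩ := M.mem_results.1 hT
    rw [MoveSystem.nodup_allToks hXY fun b hb => (hw b hb).1.lt] at hnd
    have hne : ∀ i < G.l, ∀ a < G.k, ∀ b < G.k, a ≠ b → M.X (J a i) ≠ M.X (J b i) ∧
        w a (i + 1) ≠ w b (i + 1) := by
      have key : ∀ i < G.l, ∀ a < G.k, ∀ b < a, M.X (J a i) ≠ M.X (J b i) ∧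
        w a (i + 1) ≠ w b (i + 1) := by
        intro i hi a ha b hb
        obtain ⟨h1, h2⟩ := hnd a ha b hb i hi
        refine ⟨h1, fun h => h2 ?_⟩
        rw [← (hw a ha).1.tgt i hi, ← (hw b (by omega)).1.tgt i hi] at h
        exact congrArg f h
      intro i hi a ha b hb hab
      rcases Nat.lt_or_gt_of_ne hab with h | h
      · exact ⟨(key i hi b hb a h).1.symm, (key i hi b hb a h).2.symm⟩
      · exact key i hi a ha b h
    refine ⟨fun i a => w a i, fun a ha => (hw a ha).1.start, fun a ha => (hw a ha).2,
      fun i hi => ⟨fun a ha => ?_, fun a ha b hb hab => (hne i hi a ha b hb hab).2, ?_⟩⟩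
    · have hlt := (hw a ha).1.lt i hi
      have h1 : G.fr (J a i) = w a i := (hw a ha).1.fr i hi
      have h2 : G.tgt (J a i) = w a (i + 1) := (hw a ha).1.tgt i hi
      dsimp only
      rw [← h1, ← h2]
      rcases G.joins_or_eq (J a i) with ⟨h3, -, h4⟩ | ⟨-, h4⟩
      · exact .inr ⟨_, by omega, h4⟩
      · exact .inl h4.symm
    · rintro rfl a ha b hb hab h1 h2
      have hlt := (hw a ha).1.lt i hi
      have hlt' := (hw b hb).1.lt i hi
      have k1 : G.fr (J a i) = w a i := (hw a ha).1.fr i hi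
      have k2 : G.tgt (J a i) = w a (i + 1) := (hw a ha).1.tgt i hi
      have k3 : G.fr (J b i) = w b i := (hw b hb).1.fr i hi
      have k4 : G.tgt (J b i) = w b (i + 1) := (hw b hb).1.tgt i hi
      obtain ⟨h3, h4⟩ := hne i hi a ha b hb hab
      dsimp only at h1 h2
      -- Agents that swap use the same edge in opposite directions; for `δ = 0` both directions have
      -- one token, a repetition.
      refine h3 (tok_eq_of_swap hs (by rw [k2, k3, h1]) (by rw [k4, k1, h2]) ?_)
      rw [k1, k2, ← h2]
      exact h4.symm
  · rintro ⟨w, h0, hl, hw⟩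
    have hmove : ∀ a i, ∃ j, a < G.k → i < G.l →
        j < 4 * G.m + G.k ∧ G.fr j = w i a ∧ G.tgt j = w (i + 1) a := by
      intro a i
      by_cases hai : a < G.k ∧ i < G.l
      · obtain ⟨ha, hi⟩ := hai
        suffices h : ∃ j < 4 * G.m + G.k, G.fr j = w i a ∧ G.tgt j = w (i + 1) a by
          obtain ⟨j, hj⟩ := h
          exact ⟨j, fun _ _ => hj⟩
        -- The induction serves the pauses: for `i > 0` the current vertex is the end of the
        -- preceding move, so a pause exists there.
        induction i with
        | zero =>
          rcases (hw 0 hi).1 a ha with h | ⟨e, he, h⟩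
          · rw [h]
            exact G.exists_move_self (.inl ⟨a, ha, h0 a ha⟩)
          · exact G.exists_move_of_joins he h
        | succ i ih =>
          rcases (hw (i + 1) hi).1 a ha with h | ⟨e, he, h⟩
          · rw [h]
            obtain ⟨j, hj, -, hj'⟩ := ih (by omega)
            exact G.exists_move_self (.inr ⟨j, hj, hj'.symm⟩)
          · exact G.exists_move_of_joins he h
      · exact ⟨0, fun ha hi => (hai ⟨ha, hi⟩).elim⟩
    choose J hJ using hmove
    refine ⟨M.allToks J G.k, M.mem_results.2 ⟨J, fun a i => w i a, fun a ha => ⟨⟨h0 a ha,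
      fun i hi => (hJ a i ha hi).1, fun i hi => (hJ a i ha hi).2.1,
      fun i hi => (hJ a i ha hi).2.2⟩, hl a ha⟩, rfl⟩, ?_⟩
    rw [MoveSystem.nodup_allToks hXY fun b hb i hi => (hJ b i hb hi).1]
    intro b hb c hc i hi
    obtain ⟨h1, h2, h3⟩ := hJ b i hb hi
    obtain ⟨h1', h2', h3'⟩ := hJ c i (by omega) hi
    obtain ⟨-, hinj, hsw⟩ := hw i hi
    have hne := hinj b hb c (by omega) (by omega)
    rw [← h3, ← h3'] at hne
    constructor
    · intro h
      -- Equal tokens `X` mean a common target or, only for `δ = 0`, a swap; the schedule excludes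
      -- both.
      rcases tok_eq hδ hf h1 h1' h with h | ⟨h4, h5, h6⟩
      · exact hne h
      · refine hsw h4 b hb c (by omega) (by omega) ?_ ?_
        · rw [← h3, ← h2', h6]
        · rw [← h3', ← h2, h5]
    · intro h
      exact hne ((G.labels_tgt hf h1).inj (G.labels_tgt hf h1') h)

end Data

end RAM

namespace RAM

/-! ### Finding a prime -/

/-- Marks the composite numbers up to `n2`. -/
def sieveStmt : Stmt :=
  .loop .i .n2 (.b ≔ Var.n2 / (Var.i + 2) ;;
    .loop .j .b (.store .mark ((Var.i + 2) * (Var.j + 2)) 1))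

/-- Looks for an unmarked number in `(nn, 2 nn]`. -/
def primeStmt : Stmt :=
  .loop .i .nn (.ite (.get .mark (Var.nn + 1 + Var.i)) 1 (.p ≔ Var.nn + 1 + Var.i) .skip)

/-- Each dyadic range of divisors contributes at most `N`. This harmonic sum is the cost of the
sieve and produces the factor `log n` of the running time. -/
theorem sum_div_le (N r : ℕ) : ∑ i ∈ Finset.range (2 ^ r), N / (i + 2) ≤ (r + 1) * N := by
  induction r with
  | zero => simpa using Nat.div_le_self N 2
  | succ r ih =>
    rw [pow_succ, mul_two, Finset.sum_range_add]
    have : ∑ i ∈ Finset.range (2 ^ r), N / (2 ^ r + i + 2) ≤ N := by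
      calc ∑ i ∈ Finset.range (2 ^ r), N / (2 ^ r + i + 2)
          ≤ ∑ i ∈ Finset.range (2 ^ r), N / 2 ^ r :=
            Finset.sum_le_sum fun i _ => Nat.div_le_div_left (by omega) (by positivity)
        _ = 2 ^ r * (N / 2 ^ r) := by simp
        _ ≤ N := Nat.mul_div_le _ _
    calc _ ≤ (r + 1) * N + N := Nat.add_le_add ih this
      _ = (r + 1 + 1) * N := by ring

theorem sum_div_le_log (N : ℕ) :
    ∑ i ∈ Finset.range N, N / (i + 2) ≤ (Nat.log 2 N + 2) * N := by
  refine le_trans (Finset.sum_le_sum_of_subset ?_) (sum_div_le N (Nat.log 2 N + 1))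
  exact Finset.range_mono (Nat.lt_pow_succ_log_self (by omega) N).le

/-! ### Correctness of the sieve and of the search for a prime -/

section
variable {inp : ℕ → ℕ} {L V : ℕ} {σ : State}

/-- Only products of two factors of size at least `2` are marked, so primes stay unmarked. A
composite `q ≤ N` is reached with its least prime factor as `x + 2`. The inner loop may go slightly
beyond `N`, which is harmless since composites alone are marked. -/
theorem sieveStmt_spec {N : ℕ} (hN : σ.var .n2 = N) (hNV : N ≤ V) (hV : 1 ≤ V)
    (hm : ∀ q, σ.arr .mark q = 0) :
    Spec inp L V sieveStmt σ (N * (18 * Nat.log 2 N + 60) + 3) fun τ =>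
      ∀ q ≤ N, 2 ≤ q → (τ.arr .mark q = 0 ↔ q.Prime) := by
  refine Spec.of_le (Spec.loop_sum (fun t τ =>
    (∀ q, τ.arr .mark q ≠ 0 → ∃ x y, q = (x + 2) * (y + 2)) ∧
    ∀ x < t, ∀ y < N / (x + 2), τ.arr .mark ((x + 2) * (y + 2)) ≠ 0)
    (fun t => N / (t + 2) * 18 + 10) (by decide) ⟨by simp [hm], by simp⟩ ?_ ?_) ?_
  · rintro t τ ht hti hfr ⟨h1, h2⟩
    have e1 := hfr.var .n2 (by decide)
    rw [hN] at e1
    refine Spec.of_le (Spec.assign_seq ?_ <| Spec.loop (fun r ρ =>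
      (∀ q, ρ.arr .mark q ≠ 0 → ∃ x y, q = (x + 2) * (y + 2)) ∧
      (∀ x < t, ∀ y < N / (x + 2), ρ.arr .mark ((x + 2) * (y + 2)) ≠ 0) ∧
      ∀ y < r, ρ.arr .mark ((t + 2) * (y + 2)) ≠ 0) 14 (by decide) ⟨by simpa using h1,
        by simpa using h2, by simp⟩ ?_ ?_) ?_
    · simp only [Expr.eval_div, Expr.eval_var, e1]
      exact (Nat.div_le_self _ _).trans hNV
    · rintro r ρ hr hrj hfr' ⟨k1, k2, k3⟩
      have e2 := hfr'.var .i (by decide)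
      simp only [State.set_var, reduceCtorEq, if_false, hti] at e2
      refine Spec.of_le (Spec.store (by simpa using hV) ?_) (by simp)
      simp only [State.set_arr, State.put_arr, Expr.eval_mul, Expr.eval_add, Expr.eval_var,
        Expr.eval_ofNat, e2, hrj, true_and]
      refine ⟨fun q hq => ?_, fun x hx y hy => ?_, fun y hy => ?_⟩
      · split_ifs at hq with h
        · exact ⟨t, r, h⟩
        · exact k1 q hq
      · split_ifs
        · simp
        · exact k2 x hx y hy
      · split_ifs with h
        · simp
        · refine k3 y (lt_of_le_of_ne (by omega) ?_)
          rintro rfl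
          exact h rfl
    · rintro ρ hfr' ⟨k1, k2, k3⟩
      simp only [State.set_var, if_true, Expr.eval_div, Expr.eval_add, Expr.eval_var,
        Expr.eval_ofNat, e1, hti] at k3
      refine ⟨by simpa using k1, fun x hx y hy => ?_⟩
      rcases Nat.lt_succ_iff_lt_or_eq.1 hx with hx | rfl
      · exact k2 x hx y hy
      · exact k3 y hy
    · simp [e1, hti]
      omega
  · rintro τ hfr ⟨h1, h2⟩ q hq hq2
    rw [hN] at h2
    constructor
    · intro h0
      by_contra hp
      obtain ⟨x, hx2, hxq, hxd⟩ : ∃ x, 2 ≤ x ∧ x < q ∧ x ∣ q :=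
        ⟨q.minFac, (Nat.minFac_prime (by omega)).two_le,
          (Nat.not_prime_iff_minFac_lt hq2).1 hp, Nat.minFac_dvd q⟩
      obtain ⟨y, rfl⟩ := hxd
      have hy : 2 ≤ y := by
        by_contra hy
        interval_cases y <;> omega
      obtain ⟨x', rfl⟩ := Nat.exists_eq_add_of_le' hx2
      obtain ⟨y', rfl⟩ := Nat.exists_eq_add_of_le' hy
      refine h2 x' (by omega) y' ?_ h0
      have : y' + 2 ≤ N / (x' + 2) := (Nat.le_div_iff_mul_le (by omega)).2 (by rwa [mul_comm])
      omega
    · intro hp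
      by_contra h0
      obtain ⟨x, y, rfl⟩ := h1 q h0
      exact Nat.not_prime_mul (by omega) (by omega) hp
  · rw [hN]
    simp only [Finset.sum_add_distrib, ← Finset.sum_mul, Finset.sum_const, Finset.card_range,
      smul_eq_mul]
    have := sum_div_le_log N
    calc _ ≤ ((Nat.log 2 N + 2) * N * 18 + N * 10) + N * 4 + 3 := by gcongr
      _ ≤ _ := by ring_nf; omega

theorem primeStmt_spec {N : ℕ} (hN : σ.var .nn = N) (h0 : 0 < N) (hNV : 2 * N ≤ V)
    (hm : ∀ q ≤ 2 * N, 2 ≤ q → (σ.arr .mark q = 0 ↔ q.Prime)) :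
    Spec inp L V primeStmt σ (N * 30 + 3) fun τ =>
      (τ.var .p).Prime ∧ N < τ.var .p ∧ τ.var .p ≤ 2 * N := by
  refine Spec.of_le (Spec.loop (fun t τ => (∃ r < t, σ.arr .mark (N + 1 + r) = 0) →
    (τ.var .p).Prime ∧ N < τ.var .p ∧ τ.var .p ≤ 2 * N) 26 (by decide) (by simp) ?_ ?_)
    (by rw [hN])
  · intro t τ ht hti hfr hI
    have e1 := hfr.var .nn (by decide)
    have e2 := hfr.arr .mark (by decide)
    rw [hN] at e1 ht
    refine Spec.of_le (Spec.ite (T := 6) (fun hlt => ?_) (fun hge => ?_)) (by simp)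
    · simp only [Expr.eval_get, Expr.eval_add, Expr.eval_var, Expr.eval_ofNat, e1, e2, hti]
        at hlt
      refine Spec.of_le (Spec.assign ?_ fun _ => ?_) (by simp)
      · simp [e1, hti]; omega
      · simp only [State.set_var, reduceCtorEq, if_true, if_false, Expr.eval_add, Expr.eval_var,
          Expr.eval_ofNat, e1, hti]
        exact ⟨(hm _ (by omega) (by omega)).1 (by omega), by omega, by omega⟩
    · simp only [Expr.eval_get, Expr.eval_add, Expr.eval_var, Expr.eval_ofNat, e1, e2, hti]
        at hge
      refine Spec.of_le (Spec.skip ?_) (by omega)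
      rintro ⟨r, hr, hr'⟩
      rcases Nat.lt_succ_iff_lt_or_eq.1 hr with hr | rfl
      · simpa using hI ⟨r, hr, hr'⟩
      · omega
  · intro τ hfr hI
    -- Bertrand's postulate guarantees that the search meets an unmarked number.
    obtain ⟨q, hq, h1, h2⟩ := Nat.exists_prime_lt_and_le_two_mul N (by omega)
    refine hI ⟨q - N - 1, by omega, ?_⟩
    rw [show N + 1 + (q - N - 1) = q by omega]
    exact (hm q h2 hq.two_le).2 hq

end

/-! ### Setting up the moves -/

/-- The input cells from `o` on hold the instance `G`. -/
structure Reads (inp : ℕ → ℕ) (L o : ℕ) (G : Data) : Prop where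
  len : o + 4 + 2 * G.m + 2 * G.k ≤ L
  n : inp o = G.n
  m : inp (o + 1) = G.m
  k : inp (o + 2) = G.k
  l : inp (o + 3) = G.l
  u : ∀ e < G.m, inp (o + 4 + 2 * e) = G.u e
  v : ∀ e < G.m, inp (o + 4 + 2 * e + 1) = G.v e
  s : ∀ a < G.k, inp (o + 4 + 2 * G.m + a) = G.s a
  t : ∀ a < G.k, inp (o + 4 + 2 * G.m + G.k + a) = G.t a

def readStmt (o : ℕ) : Stmt :=
  .input .n (.lit o) ;; .input .m (.lit (o + 1)) ;; .input .k (.lit (o + 2)) ;;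
  .input .l (.lit (o + 3))

def constStmt : Stmt :=
  .kk ≔ 2 * (Var.k * Var.l) ;; .d ≔ 1 ;; .loop .i .kk (.d ≔ Var.d + Var.d) ;;
  .dd ≔ Var.d * Var.d ;; .aa ≔ 2 * Var.m + Var.k ;; .uu ≔ 3 * Var.aa ;; .nn ≔ Var.uu * Var.l ;;
  .n2 ≔ 2 * Var.nn ;; .rr ≔ 4 * Var.m + Var.k

def labelStmt (o : ℕ) : Stmt :=
  .loop .e .m (.input .u (.lit (o + 4) + 2 * Var.e) ;; .input .v (.lit (o + 4) + 2 * Var.e + 1) ;;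
    .store .lab Var.u (2 * Var.e) ;; .store .lab Var.v (2 * Var.e + 1)) ;;
  .loop .a .k (.input .u (.lit (o + 4) + 2 * Var.m + Var.a) ;;
    .store .lab Var.u (2 * Var.m + Var.a))

/-- Stores the move `j` from `x` to `y` with token `z`. -/
def entryStmt (j x y z : Expr) : Stmt := .store .fr j x ;; .store .tgt j y ;; .store .tok j z

def edgeMovesStmt (o δ : ℕ) : Stmt :=
  .input .u (.lit (o + 4) + 2 * Var.e) ;; .input .v (.lit (o + 4) + 2 * Var.e + 1) ;;
  entryStmt (4 * Var.e) Var.u Var.v (2 * Var.aa + 2 * Var.e) ;;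
  entryStmt (4 * Var.e + 1) Var.v Var.u (2 * Var.aa + 2 * Var.e + .lit δ) ;;
  entryStmt (4 * Var.e + 2) Var.u Var.u (Var.aa + .get .lab Var.u) ;;
  entryStmt (4 * Var.e + 3) Var.v Var.v (Var.aa + .get .lab Var.v)

def startMovesStmt (o : ℕ) : Stmt :=
  .input .u (.lit (o + 4) + 2 * Var.m + Var.a) ;;
  entryStmt (4 * Var.m + Var.a) Var.u Var.u (Var.aa + .get .lab Var.u)

def movesStmt (o δ : ℕ) : Stmt :=
  .loop .e .m (edgeMovesStmt o δ) ;; .loop .a .k (startMovesStmt o)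

/-- The derived constants have their values. -/
structure Consts (G : Data) (σ : State) : Prop where
  n : σ.var .n = G.n
  m : σ.var .m = G.m
  k : σ.var .k = G.k
  l : σ.var .l = G.l
  kk : σ.var .kk = 2 * (G.k * G.l)
  d : σ.var .d = 2 ^ (2 * (G.k * G.l))
  dd : σ.var .dd = 2 ^ (2 * (G.k * G.l)) * 2 ^ (2 * (G.k * G.l))
  aa : σ.var .aa = G.A
  uu : σ.var .uu = 3 * G.A
  nn : σ.var .nn = 3 * G.A * G.l
  n2 : σ.var .n2 = 2 * (3 * G.A * G.l)
  rr : σ.var .rr = 4 * G.m + G.k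

theorem Consts.of_frame {G : Data} {s : Stmt} {σ τ : State} (h : Consts G σ) (hfr : Frame s σ τ)
    (hv : ∀ y ∈ [Var.n, .m, .k, .l, .kk, .d, .dd, .aa, .uu, .nn, .n2, .rr], y ∉ s.vars) :
    Consts G τ := by
  constructor
  · rw [hfr.var _ (hv _ (by simp)), h.n]
  · rw [hfr.var _ (hv _ (by simp)), h.m]
  · rw [hfr.var _ (hv _ (by simp)), h.k]
  · rw [hfr.var _ (hv _ (by simp)), h.l]
  · rw [hfr.var _ (hv _ (by simp)), h.kk]
  · rw [hfr.var _ (hv _ (by simp)), h.d]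
  · rw [hfr.var _ (hv _ (by simp)), h.dd]
  · rw [hfr.var _ (hv _ (by simp)), h.aa]
  · rw [hfr.var _ (hv _ (by simp)), h.uu]
  · rw [hfr.var _ (hv _ (by simp)), h.nn]
  · rw [hfr.var _ (hv _ (by simp)), h.n2]
  · rw [hfr.var _ (hv _ (by simp)), h.rr]

/-! ### Correctness of the set-up and of the whole algorithm -/

section
variable {inp : ℕ → ℕ} {L V o δ : ℕ} {σ : State} {G : Data}

theorem readStmt_spec (ho : o + 3 < L) :
    Spec inp L V (readStmt o) σ 8 fun τ => τ.var .n = inp o ∧ τ.var .m = inp (o + 1) ∧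
      τ.var .k = inp (o + 2) ∧ τ.var .l = inp (o + 3) := by
  refine Spec.of_le (Spec.input_seq ?_ <| Spec.input_seq ?_ <| Spec.input_seq ?_ <|
    Spec.input ?_ ?_) (by simp)
  · simp; omega
  · simp; omega
  · simp; omega
  · simp; omega
  · simp

theorem readStmt_spec_of_reads (hr : Reads inp L o G) :
    Spec inp L V (readStmt o) σ 8 fun τ =>
      τ.var .n = G.n ∧ τ.var .m = G.m ∧ τ.var .k = G.k ∧ τ.var .l = G.l := by
  have := hr.len
  have h := readStmt_spec (inp := inp) (L := L) (V := V) (o := o) (σ := σ) (by omega)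
  rwa [hr.n, hr.m, hr.k, hr.l] at h

theorem constStmt_spec (hn : σ.var .n = G.n) (hm : σ.var .m = G.m) (hk : σ.var .k = G.k)
    (hl : σ.var .l = G.l) (hkk : 2 * (G.k * G.l) ≤ V) (hl0 : 0 < G.l)
    (hDV : 2 ^ (2 * (G.k * G.l)) * 2 ^ (2 * (G.k * G.l)) ≤ V) (hNV : 2 * (3 * G.A * G.l) ≤ V) :
    Spec inp L V constStmt σ (2 * (G.k * G.l) * 8 + 60) (Consts G) := by
  have h1D : 1 ≤ 2 ^ (2 * (G.k * G.l)) := Nat.one_le_two_pow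
  have hD : 2 ^ (2 * (G.k * G.l)) ≤ V := (Nat.le_mul_of_pos_right _ h1D).trans hDV
  have hAl : 3 * G.A ≤ 3 * G.A * G.l := Nat.le_mul_of_pos_right _ hl0
  have hA : 2 * G.m + G.k = G.A := rfl
  refine Spec.of_le (Spec.assign_seq ?_ <| Spec.assign_seq ?_ <|
    Spec.seq (Spec.loop (fun t τ => τ.var .d = 2 ^ t) 4 (by decide) (by simp) ?_
      fun τ hfr hI => And.intro hI hfr) (T₂ := 40) ?_) ?_
  · simp [hk, hl, hkk]
  · simp; omega
  · intro t τ ht _ hfr hI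
    simp [hk, hl] at ht
    have : 2 ^ (t + 1) ≤ 2 ^ (2 * (G.k * G.l)) := Nat.pow_le_pow_right (by omega) (by omega)
    rw [pow_succ] at this
    refine Spec.of_le (Spec.assign ?_ ?_) (by simp)
    · simp [hI]; omega
    · simp [hI, pow_succ]; ring
  · rintro τ ⟨hd, hfr⟩
    have e1 := hfr.var .n (by decide)
    have e2 := hfr.var .m (by decide)
    have e3 := hfr.var .k (by decide)
    have e4 := hfr.var .l (by decide)
    have e5 := hfr.var .kk (by decide)
    simp [hk, hl, hn, hm] at e1 e2 e3 e4 e5 hd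
    refine Spec.of_le (Spec.assign_seq ?_ <| Spec.assign_seq ?_ <| Spec.assign_seq ?_ <|
      Spec.assign_seq ?_ <| Spec.assign_seq ?_ <| Spec.assign ?_ ?_) (by simp)
    · simp [hd, hDV]
    · simp [e2, e3]; omega
    · simp [e2, e3]; omega
    · simp [e2, e3, e4, hA]; omega
    · simp [e2, e3, e4, hA]; omega
    · simp [e2, e3]; omega
    · constructor <;> simp [e1, e2, e3, e4, e5, hd, hA]
  · simp [hk, hl]
    omega

/-- Later writes may replace a label, but only by another proper label of the same vertex. Thus the
label written last counts, and no test whether a vertex already has one is needed. -/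
theorem labels_put {f : ℕ → ℕ} {w c x : ℕ} (hc : c < G.A) (hw : G.vertex c = w)
    (h : x = w ∨ G.Labels f x) : G.Labels (fun j => if j = w then c else f j) x := by
  by_cases hx : x = w
  · subst hx
    simp [Data.Labels, hc, hw]
  · have := h.resolve_left hx
    simpa [Data.Labels, hx] using this

theorem labelStmt_spec (hr : Reads inp L o G) (hc : Consts G σ) (hAV : G.A ≤ V) :
    Spec inp L V (labelStmt o) σ (G.m * 54 + G.k * 30 + 6) fun τ => G.IsLabelling (τ.arr .lab) := by
  have hlen := hr.len
  have hA : 2 * G.m + G.k = G.A := rfl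
  refine Spec.of_le (Spec.seq (Spec.loop (fun t τ => ∀ e < t, G.Labels (τ.arr .lab) (G.u e) ∧
    G.Labels (τ.arr .lab) (G.v e)) 50 (by simp [Stmt.vars]) (by simp) ?_
      fun τ hfr hI => And.intro hI hfr) (T₂ := G.k * 30 + 3) ?_) ?_
  · intro t τ ht hte hfr hI
    rw [hc.m] at ht
    have hu := hr.u t ht
    have hv := hr.v t ht
    refine Spec.of_le (Spec.input_seq ?_ <| Spec.input_seq ?_ <| Spec.store_seq ?_ <|
      Spec.store ?_ ?_) (by simp)
    · simp [hte]; omega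
    · simp [hte]; omega
    · simp [hte]; omega
    · simp [hte]; omega
    · simp only [State.set_arr, State.put_var, State.set_var, Expr.eval_add,
        Expr.eval_mul, Expr.eval_var, Expr.eval_ofNat, Expr.eval_lit, hte, hu, hv, reduceCtorEq,
        if_true, if_false]
      intro e he
      have key : ∀ x, (x = G.u t ∨ x = G.v t ∨ G.Labels (τ.arr .lab) x) →
          G.Labels (fun j => if j = G.v t then 2 * t + 1 else
            if j = G.u t then 2 * t else τ.arr .lab j) x := by
        intro x hx
        refine labels_put (by omega) (G.vertex_two_mul_add_one ht) ?_
        by_cases hxv : x = G.v t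
        · exact .inl hxv
        · exact .inr (labels_put (by omega) (G.vertex_two_mul ht) (by tauto))
      have conv : ((((τ.set Var.u (G.u t)).set Var.v (G.v t)).put Arr.lab (G.u t) (2 * t)).put
          Arr.lab (G.v t) (2 * t + 1)).arr .lab = fun j => if j = G.v t then 2 * t + 1 else
            if j = G.u t then 2 * t else τ.arr .lab j := by
        funext j
        simp
      rw [conv]
      rcases Nat.lt_succ_iff_lt_or_eq.1 he with he | rfl
      · exact ⟨key _ (.inr (.inr (hI e he).1)), key _ (.inr (.inr (hI e he).2))⟩
      · exact ⟨key _ (.inl rfl), key _ (.inr (.inl rfl))⟩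
  · rintro τ ⟨hI, hfr⟩
    rw [hc.m] at hI
    have e1 := hfr.var .m (by simp [Stmt.vars])
    have e2 := hfr.var .k (by simp [Stmt.vars])
    rw [hc.m] at e1
    rw [hc.k] at e2
    refine Spec.of_le (Spec.loop (fun t τ => (∀ e < G.m, G.Labels (τ.arr .lab) (G.u e) ∧
      G.Labels (τ.arr .lab) (G.v e)) ∧ ∀ a < t, G.Labels (τ.arr .lab) (G.s a)) 26
      (by simp [Stmt.vars]) ⟨by simpa using hI, by simp⟩ ?_ ?_) (by rw [e2])
    · rintro t ρ ht hte hfr' ⟨h1, h2⟩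
      rw [e2] at ht
      have e3 := hfr'.var .m (by simp [Stmt.vars])
      rw [e1] at e3
      have hs := hr.s t ht
      refine Spec.of_le (Spec.input_seq ?_ <| Spec.store ?_ ?_) (by simp)
      · simp [hte, e3]; omega
      · simp [hte, e3]; omega
      · simp only [State.set_arr, State.set_var, Expr.eval_add,
          Expr.eval_mul, Expr.eval_var, Expr.eval_ofNat, Expr.eval_lit, hte, hs, e3, reduceCtorEq,
          if_true, if_false]
        have conv : ((ρ.set Var.u (G.s t)).put Arr.lab (G.s t) (2 * G.m + t)).arr .lab =
            fun j => if j = G.s t then 2 * G.m + t else ρ.arr .lab j := by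
          funext j
          simp
        rw [conv]
        have key : ∀ x, (x = G.s t ∨ G.Labels (ρ.arr .lab) x) →
            G.Labels (fun j => if j = G.s t then 2 * G.m + t else ρ.arr .lab j) x :=
          fun x hx => labels_put (by omega) (G.vertex_add t) hx
        refine ⟨fun e he => ⟨key _ (.inr (h1 e he).1), key _ (.inr (h1 e he).2)⟩, fun a ha => ?_⟩
        rcases Nat.lt_succ_iff_lt_or_eq.1 ha with ha | rfl
        · exact key _ (.inr (h2 a ha))
        · exact key _ (.inl rfl)
    · rintro ρ hfr' ⟨h1, h2⟩
      rw [e2] at h2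
      exact ⟨fun e he => (h1 e he).1, fun e he => (h1 e he).2, h2⟩
  · rw [hc.m]; omega

/-- The first `J` moves are in place. -/
def MovesUpTo (G : Data) (δ : ℕ) (f : ℕ → ℕ) (J : ℕ) (σ : State) : Prop :=
  ∀ j < J, σ.arr .fr j = G.fr j ∧ σ.arr .tgt j = G.tgt j ∧ σ.arr .tok j = G.tok δ f j

/-- The three stores change neither variables nor the array `lab`. The values of the expressions are
therefore required in every state that agrees with `σ` in these respects, and remain valid between
the stores. -/
theorem entryStmt_spec {f : ℕ → ℕ} {J : ℕ} {j x y z : Expr} {T : ℕ} (hI : MovesUpTo G δ f J σ)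
    (hj : ∀ τ : State, τ.var = σ.var → j.eval τ = J)
    (hx : ∀ τ : State, τ.var = σ.var → x.eval τ = G.fr J)
    (hy : ∀ τ : State, τ.var = σ.var → y.eval τ = G.tgt J)
    (hz : ∀ τ : State, τ.var = σ.var → τ.arr .lab = σ.arr .lab → z.eval τ = G.tok δ f J)
    (hxV : G.fr J ≤ V) (hyV : G.tgt J ≤ V) (hzV : G.tok δ f J ≤ V)
    (hT : 3 * j.cost + x.cost + y.cost + z.cost + 18 ≤ T) :
    Spec inp L V (entryStmt j x y z) σ T fun τ => MovesUpTo G δ f (J + 1) τ ∧ τ.var = σ.var ∧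
      τ.arr .lab = σ.arr .lab := by
  refine Spec.of_le (Spec.store_seq ?_ <| Spec.store_seq ?_ <| Spec.store ?_ ⟨?_, rfl, ?_⟩)
    (by omega)
  · exact (hx σ rfl).trans_le hxV
  · exact le_of_eq_of_le (hy _ (by rfl)) hyV
  · refine le_of_eq_of_le (hz _ (by rfl) ?_) hzV
    funext q
    simp
  · rw [hj σ rfl, hx σ rfl, hj (σ.put .fr J (G.fr J)) rfl, hy (σ.put .fr J (G.fr J)) rfl,
      hj ((σ.put .fr J (G.fr J)).put .tgt J (G.tgt J)) rfl,
      hz ((σ.put .fr J (G.fr J)).put .tgt J (G.tgt J)) rfl (by funext q; simp)]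
    intro q hq
    simp only [State.put_arr, reduceCtorEq, false_and, true_and, if_false]
    by_cases h : q = J
    · subst h; simp
    · simp only [h, if_false]
      exact hI q (by omega)
  · funext q
    simp

theorem Data.fr_edge {e : ℕ} (he : e < G.m) :
    G.fr (4 * e) = G.u e ∧ G.fr (4 * e + 1) = G.v e ∧ G.fr (4 * e + 2) = G.u e ∧
      G.fr (4 * e + 3) = G.v e := by
  refine ⟨?_, ?_, ?_, ?_⟩ <;> rw [fr, if_pos (by omega)]
  · rw [if_pos (by omega)]; congr 1; omega
  · rw [if_neg (by omega)]; congr 1; omega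
  · rw [if_pos (by omega)]; congr 1; omega
  · rw [if_neg (by omega)]; congr 1; omega

theorem Data.tgt_edge {e : ℕ} (he : e < G.m) :
    G.tgt (4 * e) = G.v e ∧ G.tgt (4 * e + 1) = G.u e ∧ G.tgt (4 * e + 2) = G.u e ∧
      G.tgt (4 * e + 3) = G.v e := by
  refine ⟨?_, ?_, ?_, ?_⟩ <;> rw [tgt, if_pos (by omega)]
  · rw [if_pos (by omega)]; congr 1; omega
  · rw [if_neg (by omega)]; congr 1; omega
  · rw [if_neg (by omega)]; congr 1; omega
  · rw [if_pos (by omega)]; congr 1; omega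

theorem Data.tok_edge (f : ℕ → ℕ) {e : ℕ} (he : e < G.m) :
    G.tok δ f (4 * e) = 2 * G.A + 2 * e ∧ G.tok δ f (4 * e + 1) = 2 * G.A + 2 * e + δ ∧
      G.tok δ f (4 * e + 2) = G.A + f (G.u e) ∧ G.tok δ f (4 * e + 3) = G.A + f (G.v e) := by
  obtain ⟨-, -, h3, h4⟩ := Data.tgt_edge he
  refine ⟨?_, ?_, ?_, ?_⟩ <;> rw [tok]
  · rw [if_pos (by omega), show 4 * e / 4 = e by omega, show 4 * e % 4 = 0 by omega, mul_zero]; rfl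
  · rw [if_pos (by omega), show (4 * e + 1) / 4 = e by omega, show (4 * e + 1) % 4 = 1 by omega,
      mul_one]
  · rw [if_neg (by omega), h3]
  · rw [if_neg (by omega), h4]

theorem Data.start_move (f : ℕ → ℕ) (a : ℕ) :
    G.fr (4 * G.m + a) = G.s a ∧ G.tgt (4 * G.m + a) = G.s a ∧
      G.tok δ f (4 * G.m + a) = G.A + f (G.s a) := by
  have h : G.tgt (4 * G.m + a) = G.s a := by
    rw [tgt, if_neg (by omega)]; congr 1; omega
  refine ⟨?_, h, ?_⟩
  · rw [fr, if_neg (by omega)]; congr 1; omega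
  · rw [tok, if_neg (by omega), h]

theorem edgeMovesStmt_spec (hδ : δ ≤ 1) {f : ℕ → ℕ} (hf : G.IsLabelling f)
    (hr : Reads inp L o G) (haa : σ.var .aa = G.A) (hAV : 3 * G.A ≤ V) (hnV : G.n ≤ V) {e : ℕ}
    (he : σ.var .e = e) (hem : e < G.m) (hlab : σ.arr .lab = f)
    (hI : MovesUpTo G δ f (4 * e) σ) :
    Spec inp L V (edgeMovesStmt o δ) σ 196 fun τ =>
      MovesUpTo G δ f (4 * (e + 1)) τ ∧ τ.arr .lab = f := by
  have hlen := hr.len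
  have hu := hr.u e hem
  have hv := hr.v e hem
  obtain ⟨f0, f1, f2, f3⟩ := Data.fr_edge hem
  obtain ⟨g0, g1, g2, g3⟩ := Data.tgt_edge hem
  obtain ⟨t0, t1, t2, t3⟩ := Data.tok_edge (δ := δ) f hem
  have bf : ∀ j < 4 * G.m + G.k, G.fr j ≤ V := fun j hj => (Data.fr_lt hj).le.trans hnV
  have bg : ∀ j < 4 * G.m + G.k, G.tgt j ≤ V := fun j hj => (Data.tgt_lt hj).le.trans hnV
  have bt : ∀ j < 4 * G.m + G.k, G.tok δ f j ≤ V := fun j hj =>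
    (G.tok_lt hδ hf hj).le.trans hAV
  refine Spec.of_le (Spec.input_seq ?_ <| Spec.input_seq ?_ <|
    Spec.seq (entryStmt_spec (T := 37) (J := 4 * e) (f := f) (G := G) (δ := δ) hI ?_ ?_ ?_ ?_
      (bf _ (by omega)) (bg _ (by omega)) (bt _ (by omega)) (by simp)) (T₂ := 135)
      fun τ hτ => ?_) (by simp)
  · simp [he]; omega
  · simp [he]; omega
  · intro τ h; simp [h, he]
  · intro τ h; simp [h, he, hu, f0]
  · intro τ h; simp [h, he, hv, g0]
  · intro τ h h'; simp [h, he, haa, t0]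
  obtain ⟨hI1, hvar1, hlab1⟩ := hτ
  refine Spec.of_le (Spec.seq (entryStmt_spec (T := 45) (J := 4 * e + 1) (f := f) (G := G)
    (δ := δ) hI1 ?_ ?_ ?_ ?_ (bf _ (by omega)) (bg _ (by omega)) (bt _ (by omega)) (by simp))
    (T₂ := 90) fun τ' hτ => ?_) (by simp)
  · intro τ h; simp [h, hvar1, he]
  · intro τ h; simp [h, hvar1, he, hv, f1]
  · intro τ h; simp [h, hvar1, he, hu, g1]
  · intro τ h h'; simp [h, hvar1, he, haa, t1]
  obtain ⟨hI2, hvar2, hlab2⟩ := hτ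
  refine Spec.of_le (Spec.seq (entryStmt_spec (T := 45) (J := 4 * e + 2) (f := f) (G := G)
    (δ := δ) hI2 ?_ ?_ ?_ ?_ (bf _ (by omega)) (bg _ (by omega)) (bt _ (by omega)) (by simp))
    (T₂ := 45) fun τ'' hτ => ?_) (by simp)
  · intro τ h; simp [h, hvar2, hvar1, he]
  · intro τ h; simp [h, hvar2, hvar1, he, hu, f2]
  · intro τ h; simp [h, hvar2, hvar1, he, hu, g2]
  · intro τ h h'; simp [h, h', hvar2, hvar1, hlab1, hlab2, hlab, he, haa, hu, t2]
  obtain ⟨hI3, hvar3, hlab3⟩ := hτ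
  refine (entryStmt_spec (T := 45) (J := 4 * e + 3) (f := f) (G := G)
    (δ := δ) hI3 ?_ ?_ ?_ ?_ (bf _ (by omega)) (bg _ (by omega)) (bt _ (by omega))
    (by simp)).mono le_rfl ?_
  · intro τ h; simp [h, hvar3, hvar2, hvar1, he]
  · intro τ h; simp [h, hvar3, hvar2, hvar1, he, hv, f3]
  · intro τ h; simp [h, hvar3, hvar2, hvar1, he, hv, g3]
  · intro τ h h'
    simp [h, h', hvar3, hvar2, hvar1, hlab1, hlab2, hlab3, hlab, he, haa, hv, t3]
  · rintro ρ ⟨h1, -, h2⟩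
    exact ⟨h1, by rw [h2, hlab3, hlab2, hlab1, State.set_arr, State.set_arr, hlab]⟩

theorem startMovesStmt_spec (hδ : δ ≤ 1) {f : ℕ → ℕ} (hf : G.IsLabelling f)
    (hr : Reads inp L o G) (haa : σ.var .aa = G.A) (hm : σ.var .m = G.m) (hAV : 3 * G.A ≤ V)
    (hnV : G.n ≤ V) {a : ℕ} (ha : σ.var .a = a) (hak : a < G.k) (hlab : σ.arr .lab = f)
    (hI : MovesUpTo G δ f (4 * G.m + a) σ) :
    Spec inp L V (startMovesStmt o) σ 60 fun τ =>
      MovesUpTo G δ f (4 * G.m + (a + 1)) τ ∧ τ.arr .lab = f := by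
  have hlen := hr.len
  have hs := hr.s a hak
  obtain ⟨h1, h2, h3⟩ := Data.start_move (δ := δ) (G := G) f a
  refine Spec.of_le (Spec.input_seq (T := 47) ?_ <| (entryStmt_spec (T := 47) (J := 4 * G.m + a)
    (f := f) (G := G) (δ := δ) ?_ ?_ ?_ ?_ ?_ ((Data.fr_lt (by omega)).le.trans hnV)
      ((Data.tgt_lt (by omega)).le.trans hnV) ((G.tok_lt hδ hf (by omega)).le.trans hAV)
      ?_).mono le_rfl ?_) (by simp)
  · simp [ha, hm]; omega
  · exact hI
  · intro τ h; simp [h, ha, hm]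
  · intro τ h; simp [h, ha, hm, hs, h1]
  · intro τ h; simp [h, ha, hm, hs, h2]
  · intro τ h h'; simp [h, h', ha, hm, haa, hlab, hs, h3]
  · simp
  · rintro ρ ⟨h1, -, h2⟩
    exact ⟨h1, by rw [h2, State.set_arr, hlab]⟩

theorem movesStmt_spec (hδ : δ ≤ 1) {f : ℕ → ℕ} (hf : G.IsLabelling f) (hr : Reads inp L o G)
    (hc : Consts G σ) (hAV : 3 * G.A ≤ V) (hnV : G.n ≤ V) (hlab : σ.arr .lab = f) :
    Spec inp L V (movesStmt o δ) σ (G.m * 200 + G.k * 64 + 6) fun τ =>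
      MovesUpTo G δ f (4 * G.m + G.k) τ ∧ τ.arr .lab = f := by
  refine Spec.of_le (Spec.seq (Spec.loop (fun t τ => MovesUpTo G δ f (4 * t) τ ∧ τ.arr .lab = f)
    196 ?_ ⟨fun j hj => by omega, hlab⟩ ?_ fun τ hfr hI => And.intro hI hfr)
    (T₂ := G.k * 64 + 3) ?_) ?_
  · simp [Stmt.vars, edgeMovesStmt, entryStmt]
  · rintro t τ ht hte hfr ⟨h1, h2⟩
    rw [hc.m] at ht
    have e1 := hfr.var .aa (by simp [Stmt.vars, edgeMovesStmt, entryStmt])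
    rw [hc.aa] at e1
    exact edgeMovesStmt_spec hδ hf hr e1 hAV hnV hte ht h2 h1
  · rintro τ ⟨⟨h1, h2⟩, hfr⟩
    rw [hc.m] at h1
    have e1 := hfr.var .aa (by simp [Stmt.vars, edgeMovesStmt, entryStmt])
    have e2 := hfr.var .m (by simp [Stmt.vars, edgeMovesStmt, entryStmt])
    have e3 := hfr.var .k (by simp [Stmt.vars, edgeMovesStmt, entryStmt])
    rw [hc.aa] at e1
    rw [hc.m] at e2
    rw [hc.k] at e3
    refine Spec.of_le (Spec.loop (fun t τ => MovesUpTo G δ f (4 * G.m + t) τ ∧ τ.arr .lab = f)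
      60 ?_ ⟨h1, h2⟩ ?_ ?_) (by rw [e3])
    · simp [Stmt.vars, startMovesStmt, entryStmt]
    · rintro t ρ ht hta hfr' ⟨k1, k2⟩
      have e4 := hfr'.var .aa (by simp [Stmt.vars, startMovesStmt, entryStmt])
      have e5 := hfr'.var .m (by simp [Stmt.vars, startMovesStmt, entryStmt])
      rw [e1] at e4
      rw [e2] at e5
      rw [e3] at ht
      exact startMovesStmt_spec hδ hf hr e4 e5 hAV hnV hta ht k2 k1
    · rintro ρ - hI
      rwa [e3] at hI
  · rw [hc.m]; omega

/-! ### The whole algorithm for valid instances -/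

/-- The case `k = 0` is answered at once. Otherwise `n` and `N = 3 * (2 * m + k) * l` are positive,
as block storage and Bertrand's postulate need. -/
def coreStmt (o δ : ℕ) : Stmt :=
  readStmt o ;; .ite Var.k 1 (.len ≔ 1)
    (constStmt ;; sieveStmt ;; primeStmt ;; labelStmt o ;; movesStmt o δ ;; searchStmt o)

/-- The cost of the sieve and the search for a prime. -/
def primeCost (N : ℕ) : ℕ := 2 * N * (18 * Nat.log 2 (2 * N) + 60) + N * 30

/-- The cost of the whole algorithm. -/
def coreCost (G : Data) (K : ℕ) : ℕ :=
  primeCost (3 * G.A * G.l) + G.m * 254 + G.k * 94 +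
    (G.k * (2 ^ K * 2 ^ K * 34 + G.l * ((4 * G.m + G.k) * (2 ^ K * (rowCost K + 4) + 84) + 14) + 84) +
      2 ^ K * 40) + K * 8 + 140

theorem Data.solvable_of_k_eq_zero (h : G.k = 0) : G.Solvable δ :=
  ⟨fun _ _ => 0, by simp [h], by simp [h], by simp [h]⟩

theorem coreStmt_spec_of_k_eq_zero (hr : Reads inp L o G) (hk : G.k = 0) (hV : 1 ≤ V) :
    Spec inp L V (coreStmt o δ) σ 14 fun τ =>
      (G.Solvable δ ∧ τ.var .len = 1) ∨ (¬ G.Solvable δ ∧ τ.var .len = 0) := by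
  refine Spec.of_le (Spec.seq (readStmt_spec_of_reads hr) (T₂ := 6) fun σ₁ hσ₁ => ?_) (by omega)
  refine Spec.of_le (Spec.ite (T := 2) (fun hlt => ?_) (fun hge => ?_)) (by simp)
  · exact Spec.of_le (Spec.assign (by simpa using hV)
      (.inl ⟨Data.solvable_of_k_eq_zero hk, by simp⟩)) (by simp)
  · simp [hσ₁.2.2.1, hk] at hge

theorem coreStmt_spec {K : ℕ} (hδ : δ ≤ 1) (hr : Reads inp L o G)
    (hs : ∀ e < G.m, ∀ e' < e, ¬ G.Joins e (G.u e') (G.v e')) (hl : 0 < G.l) (hge : 0 < G.k)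
    (hK : K = 2 * (G.k * G.l)) (hV : 1 ≤ V)
    (hNV : 2 * (3 * G.A * G.l) ≤ V)
    (hgV : (G.k * (G.l + 1) + 3) * G.n * (2 ^ K * 2 ^ K) ≤ V)
    (hmark : ∀ q, σ.arr .mark q = 0) (hblk : ∀ q, σ.arr .blk q = 0) :
    Spec inp L V (coreStmt o δ) σ (coreCost G K) fun τ =>
      (G.Solvable δ ∧ τ.var .len = 1) ∨ (¬ G.Solvable δ ∧ τ.var .len = 0) := by
  refine Spec.of_le (Spec.seq (readStmt_spec_of_reads hr).frame (T₂ := coreCost G K - 8)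
    fun σ₁ hσ₁ => ?_) (by simp only [coreCost]; omega)
  obtain ⟨⟨hn, hm, hk, hl'⟩, hfr₁⟩ := hσ₁
  refine Spec.of_le (Spec.ite (T := coreCost G K - 16) (fun hlt => ?_) (fun _ => ?_))
    (by simp only [coreCost]; simp; omega)
  · simp only [Expr.eval_var, Expr.eval_ofNat, hk] at hlt
    omega
  have hn0 : 0 < G.n := (Nat.zero_le _).trans_lt (G.s_lt 0 hge)
  have h1D : 1 ≤ 2 ^ K := Nat.one_le_two_pow
  have hDDV : 2 ^ K * 2 ^ K ≤ V :=
    (Nat.le_mul_of_pos_left _ (Nat.mul_pos (by omega) hn0)).trans hgV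
  have hDV : 2 ^ K ≤ V := (Nat.le_mul_of_pos_right _ h1D).trans hDDV
  have hKV : K ≤ V := Nat.lt_two_pow_self.le.trans hDV
  have hnV : G.n ≤ V := (Nat.le_mul_of_pos_left _ (by omega)).trans
    ((Nat.le_mul_of_pos_right _ (Nat.mul_pos h1D h1D)).trans hgV)
  have hAl : 3 * G.A ≤ 3 * G.A * G.l := Nat.le_mul_of_pos_right _ hl
  have hA : 2 * G.m + G.k = G.A := rfl
  set N := 3 * G.A * G.l with hN
  refine Spec.of_le (Spec.seq (constStmt_spec hn hm hk hl' (by omega) hl (by rwa [← hK])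
    hNV).frame (T₂ := coreCost G K - (K * 8 + 60) - 16) fun σ₂ hσ₂ => ?_) (by
      simp only [coreCost, ← hK]; omega)
  obtain ⟨hc₂, hfr₂⟩ := hσ₂
  refine Spec.of_le (Spec.seq (sieveStmt_spec hc₂.n2 hNV hV ?_).frame
    (T₂ := N * 30 + 3 + (G.m * 254 + G.k * 94 + 12 + (G.k * (2 ^ K * 2 ^ K * 34 +
      G.l * ((4 * G.m + G.k) * (2 ^ K * (rowCost K + 4) + 84) + 14) + 84) + 2 ^ K * 40 + 40)))
      fun σ₃ hσ₃ => ?_) (by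
      simp only [coreCost, primeCost, ← hN]; omega)
  · intro q
    rw [hfr₂.arr _ (by decide), hfr₁.arr _ (by simp [readStmt, Stmt.arrs]), hmark]
  obtain ⟨hp₃, hfr₃⟩ := hσ₃
  have hc₃ := hc₂.of_frame hfr₃ (by decide)
  refine Spec.seq (primeStmt_spec hc₃.nn (by omega) hNV hp₃).frame fun σ₄ hσ₄ => ?_
  obtain ⟨⟨hp, hNp, hpN⟩, hfr₄⟩ := hσ₄
  have hc₄ := hc₃.of_frame hfr₄ (by decide)
  refine Spec.of_le (Spec.seq (labelStmt_spec hr hc₄ (by omega)).frame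
    (T₂ := G.m * 200 + G.k * 64 + 6 + (G.k * (2 ^ K * 2 ^ K * 34 +
      G.l * ((4 * G.m + G.k) * (2 ^ K * (rowCost K + 4) + 84) + 14) + 84) + 2 ^ K * 40 + 40))
      fun σ₅ hσ₅ => ?_) (by omega)
  obtain ⟨hf, hfr₅⟩ := hσ₅
  have hc₅ := hc₄.of_frame hfr₅ (by simp [labelStmt, Stmt.vars])
  refine Spec.seq (movesStmt_spec hδ hf hr hc₅ (by omega) hnV rfl).frame fun σ₆ hσ₆ => ?_
  obtain ⟨⟨hmv, hlab⟩, hfr₆⟩ := hσ₆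
  have hc₆ := hc₅.of_frame hfr₆ (by
    simp [movesStmt, edgeMovesStmt, startMovesStmt, entryStmt, Stmt.vars])
  have hp₆ : σ₆.var .p = σ₄.var .p := by
    rw [hfr₆.var _ (by simp [movesStmt, edgeMovesStmt, startMovesStmt, entryStmt, Stmt.vars]),
      hfr₅.var _ (by simp [labelStmt, Stmt.vars])]
  have : Fact (σ₄.var .p).Prime := ⟨hp⟩
  have hc : Ctx (G.moves δ hδ _ hf) (σ₄.var .p) K G.m σ₆ := by
    refine ⟨hp₆, ?_, ?_, ?_, hc₆.n, hc₆.m, hc₆.k, hc₆.l, hc₆.rr, hc₆.uu, fun j hj => (hmv j hj).1,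
      fun j hj => (hmv j hj).2.1, fun j hj => (hmv j hj).2.2, fun j hj => ?_⟩
    · rw [hK, hc₆.kk]
    · rw [hK, hc₆.d]
    · rw [hK, hc₆.dd]
    · rw [hlab]; rfl
  refine (searchStmt_spec (o := o) hc (by omega) hDV hgV ?_ hge hK (fun a ha => ⟨?_, hr.s a ha⟩)
    (fun a ha => ⟨?_, hr.t a ha⟩) fun q => ?_).mono ?_ fun τ hτ => ?_
  -- All tokens lie below `l * U = N`, and the prime found exceeds `N`.
  · change G.l * (3 * G.A) < _
    rw [mul_comm]; omega
  · have := hr.len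
    change a < G.k at ha
    omega
  · have := hr.len
    change a < G.k at ha
    change o + 4 + 2 * G.m + G.k + a < L
    omega
  · rw [hfr₆.arr _ (by simp [movesStmt, edgeMovesStmt, startMovesStmt, entryStmt, Stmt.arrs]),
      hfr₅.arr _ (by simp [labelStmt, Stmt.arrs]), hfr₄.arr _ (by decide),
      hfr₃.arr _ (by decide), hfr₂.arr _ (by decide),
      hfr₁.arr _ (by simp [readStmt, Stmt.arrs]), hblk]
  · rfl
  · have hiff := Data.exists_nodup_iff_solvable hδ hf hs
    rcases hτ with ⟨h, h'⟩ | ⟨h, h'⟩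
    · exact .inl ⟨hiff.1 h, h'⟩
    · exact .inr ⟨fun hsol => h (hiff.2 hsol), h'⟩

end

end RAM

namespace RAM

/-! ### From instances to data -/

/-- The instance `I` with edge list `E`, over the natural numbers. -/
def Data.ofInstance {n k : ℕ} (I : MAPFInstance (Fin n) (Fin k)) (E : List (Fin n × Fin n)) :
    Data where
  n := n
  m := E.length
  k := k
  l := I.ℓ
  u e := if h : e < E.length then E[e].1 else 0
  v e := if h : e < E.length then E[e].2 else 0
  s a := if h : a < k then I.s₀ ⟨a, h⟩ else 0
  t a := if h : a < k then I.t ⟨a, h⟩ else 0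
  u_lt e he := by simp [he]
  v_lt e he := by simp [he]
  s_lt a ha := by simp [ha]
  t_lt a ha := by simp [ha]

/-- `1` if swaps are allowed. -/
def swapBit : SwapRule → ℕ
  | .swaps => 1
  | .noSwaps => 0

theorem swapBit_le_one (r : SwapRule) : swapBit r ≤ 1 := by cases r <;> simp [swapBit]

section
variable {n k : ℕ} {I : MAPFInstance (Fin n) (Fin k)} {E : List (Fin n × Fin n)}

theorem Data.ofInstance_joins {e x y : ℕ} (he : e < E.length) :
    (Data.ofInstance I E).Joins e x y ↔ (x = E[e].1 ∧ y = E[e].2) ∨ (x = E[e].2 ∧ y = E[e].1) := by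
  simp [Joins, ofInstance, he]

theorem Data.ofInstance_simple (hE : MAPFInstance.IsEdgeList I.G E) :
    ∀ e < E.length, ∀ e' < e, ¬ (Data.ofInstance I E).Joins e ((Data.ofInstance I E).u e')
      ((Data.ofInstance I E).v e') := by
  intro e he e' he' h
  have he'' : e' < E.length := he'.trans he
  rw [ofInstance_joins he] at h
  simp only [ofInstance, he'', dite_true, Fin.val_inj] at h
  have hl : (E.map fun e => s(e.1, e.2)).length = E.length := List.length_map _
  have := (List.Nodup.getElem_inj_iff hE.1 (i := e') (j := e) (hi := by omega) (hj := by omega)).1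
    (by simp only [List.getElem_map, Sym2.eq_iff]; exact h)
  omega

theorem Data.exists_joins_iff (hE : MAPFInstance.IsEdgeList I.G E) (x y : Fin n) :
    (∃ e < E.length, (Data.ofInstance I E).Joins e x y) ↔ I.G.Adj x y := by
  rw [← SimpleGraph.mem_edgeSet, ← hE.2, List.mem_map]
  constructor
  · rintro ⟨e, he, h⟩
    rw [ofInstance_joins he] at h
    simp only [Fin.val_inj] at h
    exact ⟨E[e], List.getElem_mem he, by rw [Sym2.eq_iff]; tauto⟩
  · rintro ⟨p, hp, h⟩
    obtain ⟨e, he, rfl⟩ := List.getElem_of_mem hp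
    refine ⟨e, he, ?_⟩
    rw [ofInstance_joins he]
    simp only [Fin.val_inj]
    rw [Sym2.eq_iff] at h
    tauto

theorem Data.ofInstance_solvable (hE : MAPFInstance.IsEdgeList I.G E) (r : SwapRule) :
    (Data.ofInstance I E).Solvable (swapBit r) ↔ I.Solvable r := by
  have hδ : swapBit r = 0 ↔ r = .noSwaps := by cases r <;> simp [swapBit]
  constructor
  · rintro ⟨w, h0, hl, hw⟩
    change ∀ a < k, _ at h0
    change ∀ a < k, w I.ℓ a = _ at hl
    change ∀ i < I.ℓ, (∀ a < k, _ ∨ ∃ e < E.length, _) ∧ (∀ a < k, ∀ b < k, _) ∧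
      (_ → ∀ a < k, ∀ b < k, _) at hw
    -- A schedule over the natural numbers stays among the vertices, since it begins there and edges
    -- lead nowhere else.
    have hlt : ∀ i ≤ I.ℓ, ∀ a < k, w i a < n := by
      intro i
      induction i with
      | zero =>
        intro _ a ha
        rw [h0 a ha]
        exact (Data.ofInstance I E).s_lt a ha
      | succ i ih =>
        intro hi a ha
        rcases (hw i hi).1 a ha with h | ⟨e, he, h⟩
        · rw [h]; exact ih (by omega) a ha
        · rw [ofInstance_joins he] at h
          rcases h with ⟨-, h⟩ | ⟨-, h⟩ <;> rw [h] <;> exact Fin.is_lt _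
    -- Positions after the makespan are irrelevant; the target serves as a default value.
    let S : ℕ → Fin k → Fin n := fun i a =>
      if h : i ≤ I.ℓ then ⟨w i a, hlt i h a a.2⟩ else I.t a
    have hS : ∀ i ≤ I.ℓ, ∀ a, (S i a : ℕ) = w i a := fun i hi a => by simp [S, hi]
    refine ⟨S, funext fun a => Fin.ext ?_, funext fun a => Fin.ext ?_, fun i hi => ⟨fun a => ?_,
      fun a b hab => ?_, fun hr => ?_⟩⟩
    · rw [hS 0 (by omega), h0 a a.2]
      simp [ofInstance]
    · rw [hS _ le_rfl, hl a a.2]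
      simp [ofInstance]
    · rcases (hw i hi).1 a a.2 with h | h
      · left
        apply Fin.ext
        rw [hS _ (by omega), hS _ (by omega), h]
      · right
        rw [← Data.exists_joins_iff hE, hS _ (by omega), hS _ (by omega)]
        exact h
    · by_contra hne
      refine (hw i hi).2.1 a a.2 b b.2 (fun h => hne (Fin.ext h)) ?_
      rw [← hS _ (by omega), ← hS _ (by omega), hab]
    · rintro ⟨a, b, hab, h1, h2⟩
      refine (hw i hi).2.2 (hδ.2 hr) a a.2 b b.2 (fun h => hab (Fin.ext h)) ?_ ?_
      · rw [← hS _ (by omega), ← hS _ (by omega), h1]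
      · rw [← hS _ (by omega), ← hS _ (by omega), h2]
  · rintro ⟨S, h0, hl, hS⟩
    let w : ℕ → ℕ → ℕ := fun i a => if h : a < k then S i ⟨a, h⟩ else 0
    have hw : ∀ i a, ∀ h : a < k, w i a = S i ⟨a, h⟩ := fun i a h => by simp [w, h]
    refine ⟨w, fun a ha => ?_, fun a ha => ?_, fun i hi => ⟨fun a ha => ?_, fun a ha b hb hab h => ?_,
      fun hr a ha b hb hab h1 h2 => ?_⟩⟩
    · change a < k at ha
      rw [hw _ _ ha, h0]
      simp [ofInstance, ha]
    · change a < k at ha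
      change w I.ℓ a = _
      rw [hw _ _ ha, hl]
      simp [ofInstance, ha]
    · change a < k at ha
      rw [hw _ _ ha, hw _ _ ha]
      rcases (hS i hi).1 ⟨a, ha⟩ with h | h
      · left; rw [h]
      · right; exact (Data.exists_joins_iff hE _ _).2 h
    · change a < k at ha
      change b < k at hb
      rw [hw _ _ ha, hw _ _ hb, Fin.val_inj] at h
      have := (hS i hi).2.1 h
      simp only [Fin.mk.injEq] at this
      exact hab this
    · change a < k at ha
      change b < k at hb
      rw [hw _ _ ha, hw _ _ hb, Fin.val_inj] at h1 h2
      exact (hS i hi).2.2 (hδ.1 hr) ⟨_, _, by simpa using hab, h1, h2⟩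

/-! ### Reading the encoding -/

theorem length_flatMap_pair {α : Type*} (f g : α → ℕ) (E : List α) :
    (E.flatMap fun e => [f e, g e]).length = 2 * E.length := by
  induction E with
  | nil => rfl
  | cons a E ih => simp [ih]; omega

theorem getD_flatMap_pair {α : Type*} (f g : α → ℕ) (E : List α) {e : ℕ} (he : e < E.length) :
    (E.flatMap fun e => [f e, g e]).getD (2 * e) 0 = f E[e] ∧
      (E.flatMap fun e => [f e, g e]).getD (2 * e + 1) 0 = g E[e] := by
  induction E generalizing e with
  | nil => simp at he
  | cons a E ih =>
    cases e with
    | zero => simp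
    | succ e =>
      have := ih (e := e) (by simpa using he)
      rw [List.flatMap_cons, show 2 * (e + 1) = 2 * e + 1 + 1 by ring]
      simpa using this

theorem length_encode : (I.encode E).length = 4 + 2 * E.length + 2 * k := by
  simp only [MAPFInstance.encode, List.length_append, length_flatMap_pair, List.length_ofFn,
    List.length_cons, List.length_nil]
  omega

theorem reads_encode {inp : ℕ → ℕ} {L o : ℕ} (hinp : ∀ j, inp (o + j) = (I.encode E).getD j 0)
    (hL : o + (I.encode E).length ≤ L) : Reads inp L o (Data.ofInstance I E) := by
  have hlen := length_flatMap_pair (fun e : Fin n × Fin n => (e.1 : ℕ)) (fun e => (e.2 : ℕ)) E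
  rw [length_encode] at hL
  have hd : ∀ j, inp (o + 4 + j) = ((E.flatMap (fun e => [(e.1 : ℕ), (e.2 : ℕ)]) ++
      List.ofFn (fun a => (I.s₀ a : ℕ))) ++ List.ofFn (fun a => (I.t a : ℕ))).getD j 0 := by
    intro j
    rw [add_assoc, hinp, MAPFInstance.encode, List.append_assoc, List.append_assoc,
      List.getD_append_right _ _ _ _ (by simp)]
    simp
  refine ⟨?_, ?_, ?_, ?_, ?_, ?_, ?_, ?_, ?_⟩
  · change o + 4 + 2 * E.length + 2 * k ≤ L
    omega
  · have := hinp 0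
    simpa [MAPFInstance.encode, Data.ofInstance] using this
  · have := hinp 1
    simpa [MAPFInstance.encode, Data.ofInstance] using this
  · have := hinp 2
    simpa [MAPFInstance.encode, Data.ofInstance] using this
  · have := hinp 3
    simpa [MAPFInstance.encode, Data.ofInstance] using this
  · intro e he
    change e < E.length at he
    rw [hd, List.append_assoc, List.getD_append _ _ _ _ (by omega),
      (getD_flatMap_pair _ _ E he).1]
    simp [Data.ofInstance, he]
  · intro e he
    change e < E.length at he
    rw [add_assoc, hd, List.append_assoc, List.getD_append _ _ _ _ (by omega),
      (getD_flatMap_pair _ _ E he).2]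
    simp [Data.ofInstance, he]
  · intro a ha
    change a < k at ha
    change inp (o + 4 + 2 * E.length + a) = _
    rw [add_assoc, hd, List.getD_append _ _ _ _ (by
      simp only [List.length_append, hlen, List.length_ofFn]; omega), List.getD_append_right _ _ _ _ (by omega), hlen]
    simp [Data.ofInstance, ha]
  · intro a ha
    change a < k at ha
    change inp (o + 4 + 2 * E.length + k + a) = _
    rw [show o + 4 + 2 * E.length + k + a = o + 4 + (2 * E.length + k + a) by ring, hd,
      List.getD_append_right _ _ _ _ (by
      simp only [List.length_append, hlen, List.length_ofFn]; omega), List.length_append, hlen, List.length_ofFn,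
      show 2 * E.length + k + a - (2 * E.length + k) = a by omega]
    simp [Data.ofInstance, ha]

theorem le_of_mem_encode {z : ℕ} (hz : z ∈ I.encode E) :
    z ≤ n ∨ z = E.length ∨ z = k ∨ z = I.ℓ := by
  simp only [MAPFInstance.encode, List.mem_append, List.mem_flatMap, List.mem_ofFn,
    List.mem_cons, List.not_mem_nil, or_false] at hz
  rcases hz with (((h | h | h | h) | ⟨e, -, h | h⟩) | ⟨a, h⟩) | ⟨a, h⟩
  · exact .inl h.le
  · exact .inr (.inl h)
  · exact .inr (.inr (.inl h))
  · exact .inr (.inr (.inr h))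
  · have := e.1.2; omega
  · have := e.2.2; omega
  · have := (I.s₀ a).2; omega
  · have := (I.t a).2; omega

/-- This turns the logarithm of the number of edges, which the sieve produces, into at most twice
the logarithm of `n` up to a constant. -/
theorem length_edgeList_le (hE : MAPFInstance.IsEdgeList I.G E) : E.length ≤ n * n := by
  have := (hE.1.of_map _).length_le_card
  simpa using this

theorem agents_le (I : MAPFInstance (Fin n) (Fin k)) : k ≤ n := by
  simpa using Fintype.card_le_of_injective _ I.s₀_injective

theorem ncard_edgeSet (hE : MAPFInstance.IsEdgeList I.G E) : I.G.edgeSet.ncard = E.length := by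
  classical
  have : I.G.edgeSet = ((E.map fun e => s(e.1, e.2)).toFinset : Set (Sym2 (Fin n))) := by
    ext e
    rw [← hE.2]
    simp
  rw [this, Set.ncard_coe_finset, List.toFinset_card_of_nodup hE.1, List.length_map]

end

/-! ### Bounds -/

/-- Let `D = 2 ^ (2 * q)` with `q = k * l`. One insertion takes `O(D ^ 2)` steps, so the `D` rows of
a move take `O(D ^ 3)`. With `O(D * M)` moves, at most `D` steps and at most `D` agents this is `O(D
^ 6 * M)`, whence the exponent `12 * q`. The sieve contributes `N * log N` with `N ≤ 9 * D * M`. -/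
theorem coreCost_le {G : Data} (hk : 0 < G.k) (hl : 0 < G.l) (hm : G.m ≤ G.n * G.n) :
    coreCost G (2 * (G.k * G.l)) ≤
      13000 * 2 ^ (12 * (G.k * G.l)) * max 1 G.m * max 1 (Nat.log 2 G.n) := by
  have hq : 1 ≤ G.k * G.l := Nat.mul_pos hk hl
  have hkq : G.k ≤ G.k * G.l := Nat.le_mul_of_pos_right _ hl
  have hlq : G.l ≤ G.k * G.l := Nat.le_mul_of_pos_left _ hk
  have hAeq : G.A = 2 * G.m + G.k := rfl
  simp only [coreCost, primeCost, rowCost]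
  set q := G.k * G.l with hqdef
  set D := 2 ^ (2 * q) with hD
  have hDpow : 2 ^ (12 * q) = D ^ 6 := by rw [hD, ← pow_mul]; ring_nf
  have hKD : 2 * q ≤ D := Nat.lt_two_pow_self.le
  have hn : 1 ≤ G.n := (Nat.zero_le _).trans_lt (G.s_lt 0 hk)
  set M := max 1 G.m with hM
  set g := max 1 (Nat.log 2 G.n) with hg
  have hM1 : 1 ≤ M := le_max_left _ _
  have hmM : G.m ≤ M := le_max_right _ _
  have hMn : M ≤ G.n * G.n := max_le (Nat.mul_pos hn hn) hm
  have hg1 : 1 ≤ g := le_max_left _ _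
  have hlg : Nat.log 2 G.n ≤ g := le_max_right _ _
  have hD1 : 1 ≤ D := by omega
  have hA : G.A ≤ 3 * (q * M) := by
    have h1 : M ≤ q * M := Nat.le_mul_of_pos_left _ hq
    have h2 : q ≤ q * M := Nat.le_mul_of_pos_right _ hM1
    omega
  have hN : 3 * G.A * G.l ≤ 9 * (q * q * M) := by
    calc 3 * G.A * G.l ≤ 3 * (3 * (q * M)) * q := by gcongr
      _ = 9 * (q * q * M) := by ring
  have hqq : q * q ≤ D := by
    have h1 : q ≤ 2 ^ q := Nat.lt_two_pow_self.le
    calc q * q ≤ 2 ^ q * 2 ^ q := Nat.mul_le_mul h1 h1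
      _ = D := by rw [hD, ← pow_add]; ring_nf
  set N := 3 * G.A * G.l with hNdef
  have hND : N ≤ 9 * (D * M) := hN.trans (by gcongr)
  have hlog : Nat.log 2 (2 * N) ≤ 10 * (D * g) := by
    -- The summand `5` comes from `18 < 2 ^ 5`, the summand `2 * q` from `D`, and the rest from `M ≤
    -- n * n`.
    have hlt : 2 * N < 2 ^ (5 + 2 * q + 2 * (Nat.log 2 G.n + 1)) := by
      have h1 := Nat.lt_pow_succ_log_self (b := 2) (by omega) G.n
      calc 2 * N ≤ 18 * (D * (G.n * G.n)) := by
            have : D * M ≤ D * (G.n * G.n) := Nat.mul_le_mul_left _ hMn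
            omega
        _ < 32 * (D * (G.n * G.n)) := by
            have : 0 < D * (G.n * G.n) := Nat.mul_pos hD1 (Nat.mul_pos hn hn)
            omega
        _ ≤ 32 * (D * (2 ^ (Nat.log 2 G.n + 1) * 2 ^ (Nat.log 2 G.n + 1))) := by gcongr
        _ = _ := by rw [hD]; ring
    have h2 := Nat.log_lt_of_lt_pow' (b := 2) (by omega) hlt
    have h3 : g ≤ D * g := Nat.le_mul_of_pos_left _ hD1
    have h4 : D ≤ D * g := Nat.le_mul_of_pos_right _ hg1
    omega
  have hprime : 2 * N * (18 * Nat.log 2 (2 * N) + 60) + N * 30 ≤ 5000 * (D ^ 6 * M * g) := by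
    have hDg : 1 ≤ D * g := Nat.mul_pos hD1 hg1
    have hD2 : D ^ 2 ≤ D ^ 6 := Nat.pow_le_pow_right hD1 (by omega)
    calc 2 * N * (18 * Nat.log 2 (2 * N) + 60) + N * 30
        ≤ 2 * (9 * (D * M)) * (18 * (10 * (D * g)) + 60 * (D * g)) + 9 * (D * M) * 30 * (D * g) := by
          refine Nat.add_le_add ?_
            ((Nat.mul_le_mul_right 30 hND).trans (Nat.le_mul_of_pos_right _ hDg))
          gcongr
          omega
      _ = 4590 * (D ^ 2 * M * g) := by ring
      _ ≤ 5000 * (D ^ 6 * M * g) := by gcongr; omega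
  have hD6 : D ≤ D ^ 6 := Nat.le_self_pow (by omega) D
  have hX1 : D ^ 6 ≤ D ^ 6 * M * g := by
    rw [mul_assoc]; exact Nat.le_mul_of_pos_right _ (Nat.mul_pos hM1 hg1)
  have hXM : M ≤ D ^ 6 * M * g := by
    calc M ≤ D ^ 6 * M := Nat.le_mul_of_pos_left _ (by positivity)
      _ ≤ _ := Nat.le_mul_of_pos_right _ hg1
  have hrow : D * (D * 64 + 228 * (2 * q) + 260) + 60 ≤ 612 * D ^ 2 := by
    calc D * (D * 64 + 228 * (2 * q) + 260) + 60
        ≤ D * (D * 64 + 228 * D + 260 * D) + 60 * D ^ 2 := by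
          gcongr
          · omega
          · have : 1 ≤ D ^ 2 := Nat.one_le_pow _ _ hD1
            omega
      _ = 612 * D ^ 2 := by ring
  have hinner : D * (D * (D * 64 + 228 * (2 * q) + 260) + 60 + 4) + 84 ≤ 700 * D ^ 3 := by
    have h2 : 1 ≤ D ^ 2 := Nat.one_le_pow _ _ hD1
    have h3 : 1 ≤ D ^ 3 := Nat.one_le_pow _ _ hD1
    calc _ ≤ D * (612 * D ^ 2 + 4 * D ^ 2) + 84 * D ^ 3 := by
          gcongr
          · omega
          · omega
      _ = 700 * D ^ 3 := by ring
  have hR : 4 * G.m + G.k ≤ 5 * (D * M) := by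
    have h1 : M ≤ D * M := Nat.le_mul_of_pos_left _ hD1
    have h2 : D ≤ D * M := Nat.le_mul_of_pos_right _ hM1
    omega
  have hagents : G.k * (D * D * 34 + G.l * ((4 * G.m + G.k) *
      (D * (D * (D * 64 + 228 * (2 * q) + 260) + 60 + 4) + 84) + 14) + 84) ≤
        7000 * (D ^ 6 * M * g) := by
    have h2 : 1 ≤ M * g := Nat.mul_pos hM1 hg1
    have hkD : G.k ≤ D := by omega
    have hlD : G.l ≤ D := by omega
    calc _ ≤ D * (D * D * 34 + D * ((5 * (D * M)) * (700 * D ^ 3) + 14) + 84) := by gcongr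
      _ = 34 * D ^ 3 + 3500 * (D ^ 6 * M) + 14 * D ^ 2 + 84 * D := by ring
      _ ≤ 34 * D ^ 6 + 3500 * (D ^ 6 * M) + 14 * D ^ 6 + 84 * D ^ 6 := by
          gcongr <;> omega
      _ ≤ 34 * (D ^ 6 * M * g) + 3500 * (D ^ 6 * M * g) + 14 * (D ^ 6 * M * g) +
          84 * (D ^ 6 * M * g) := by
          have := Nat.le_mul_of_pos_right (D ^ 6 * M) hg1
          omega
      _ ≤ _ := by omega
  rw [hDpow]
  have : 13000 * D ^ 6 * M * g = 13000 * (D ^ 6 * M * g) := by ring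
  rw [this]
  omega

/-- A bound on all numbers that occur. -/
def valueBound (n q l : ℕ) : ℕ := 18 * 2 ^ (6 * q) * ((n + l + 1) * (n + l + 1))

/-- One factor `valueBound` has at most `6 * q + 2 * g + 7` bits, where `g` is the logarithm, since
`18 < 2 ^ 5` and `n + l + 1 ≤ 2 ^ (g + 1)`. The power `64` gives the constant `448 = 64 * 7`. -/
theorem valueBound_pow_lt (n q l : ℕ) :
    valueBound n q l ^ 64 < 2 ^ (448 * (q + Nat.log 2 (n + l) + 1)) := by
  have h1 := Nat.lt_pow_succ_log_self (b := 2) (by omega) (n + l)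
  set g := Nat.log 2 (n + l)
  have h2 : n + l + 1 ≤ 2 ^ (g + 1) := h1
  have h3 : valueBound n q l < 2 ^ (6 * q + 2 * g + 7) := by
    calc valueBound n q l ≤ 18 * 2 ^ (6 * q) * (2 ^ (g + 1) * 2 ^ (g + 1)) := by
          rw [valueBound]; gcongr
      _ < 32 * 2 ^ (6 * q) * (2 ^ (g + 1) * 2 ^ (g + 1)) := by gcongr; omega
      _ = 2 ^ (6 * q + 2 * g + 7) := by
          ring
  calc valueBound n q l ^ 64 < (2 ^ (6 * q + 2 * g + 7)) ^ 64 := Nat.pow_lt_pow_left h3 (by omega)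
    _ = 2 ^ ((6 * q + 2 * g + 7) * 64) := by rw [← pow_mul]
    _ ≤ _ := Nat.pow_le_pow_right (by omega) (by ring_nf; omega)

section
variable {n k : ℕ} {I : MAPFInstance (Fin n) (Fin k)} {E : List (Fin n × Fin n)}

theorem le_valueBound (n q l : ℕ) : 18 * (n * n + n + l + 1) ≤ valueBound n q l := by
  have h : 1 ≤ 2 ^ (6 * q) := Nat.one_le_two_pow
  calc 18 * (n * n + n + l + 1) ≤ 18 * 1 * ((n + l + 1) * (n + l + 1)) := by
        ring_nf
        nlinarith [Nat.zero_le (n * l), Nat.zero_le (l ^ 2), Nat.zero_le n]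
    _ ≤ _ := by rw [valueBound]; gcongr

/-- The core of the algorithm on a valid instance. -/
theorem coreStmt_spec_encode (hE : MAPFInstance.IsEdgeList I.G E) (r : SwapRule) {inp : ℕ → ℕ}
    {L o V : ℕ} {σ : State} (hinp : ∀ j, inp (o + j) = (I.encode E).getD j 0)
    (hL : o + (I.encode E).length ≤ L) (hV : valueBound n (k * I.ℓ) I.ℓ ≤ V)
    (hmark : ∀ q, σ.arr .mark q = 0) (hblk : ∀ q, σ.arr .blk q = 0) :
    Spec inp L V (coreStmt o (swapBit r)) σ
      (13000 * 2 ^ (12 * (k * I.ℓ)) * max 1 E.length * max 1 (Nat.log 2 n)) fun τ =>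
      (I.Solvable r ∧ τ.var .len = 1) ∨ (¬ I.Solvable r ∧ τ.var .len = 0) := by
  have hr := reads_encode hinp hL
  have hV1 : 1 ≤ V := by have := le_valueBound n (k * I.ℓ) I.ℓ; omega
  rw [← Data.ofInstance_solvable hE]
  rcases Nat.eq_zero_or_pos k with hk | hk
  · refine Spec.of_le (coreStmt_spec_of_k_eq_zero hr hk hV1) ?_
    have h1 : 0 < 2 ^ (12 * (k * I.ℓ)) * max 1 E.length * max 1 (Nat.log 2 n) := by positivity
    calc 14 ≤ 13000 * (2 ^ (12 * (k * I.ℓ)) * max 1 E.length * max 1 (Nat.log 2 n)) := by omega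
      _ = _ := by ring
  · have hm := length_edgeList_le hE
    have hl := I.ℓ_pos
    have hkl : 1 ≤ k * I.ℓ := Nat.mul_pos hk hl
    have hD : k * I.ℓ ≤ 2 ^ (k * I.ℓ) := Nat.lt_two_pow_self.le
    have hkn := agents_le I
    refine Spec.of_le (coreStmt_spec (swapBit_le_one r) hr (Data.ofInstance_simple hE) hl hk rfl
      hV1 (le_trans ?_ hV) (le_trans ?_ hV) hmark hblk) (coreCost_le hk hl hm)
    · change 2 * (3 * (2 * E.length + k) * I.ℓ) ≤ _
      have h1 : I.ℓ ≤ k * I.ℓ := Nat.le_mul_of_pos_left _ hk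
      calc 2 * (3 * (2 * E.length + k) * I.ℓ) ≤ 2 * (3 * (2 * (n * n) + n * n) * (k * I.ℓ)) := by
            gcongr
            exact hkn.trans (Nat.le_mul_of_pos_left _ (by omega))
        _ = 18 * (k * I.ℓ) * (n * n) := by ring
        _ ≤ 18 * 2 ^ (6 * (k * I.ℓ)) * ((n + I.ℓ + 1) * (n + I.ℓ + 1)) := by
            gcongr
            · exact hD.trans (Nat.pow_le_pow_right (by omega) (by omega))
            · omega
            · omega
    -- This product bounds the extent of the block storage: generations times vertices times the
    -- square of `2 ^ (2 * (k * ℓ))`. The number of generations is absorbed by one more power of `2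
    -- ^ (k * ℓ)`.
    · change (k * (I.ℓ + 1) + 3) * n * _ ≤ _
      have h1 : k ≤ k * I.ℓ := Nat.le_mul_of_pos_right _ hl
      have e1 : 2 ^ (2 * (k * I.ℓ)) = (2 ^ (k * I.ℓ)) ^ 2 := by rw [← pow_mul]; ring_nf
      have e2 : 2 ^ (6 * (k * I.ℓ)) = (2 ^ (k * I.ℓ)) ^ 6 := by rw [← pow_mul]; ring_nf
      have h2 : k * (I.ℓ + 1) + 3 ≤ 5 * (k * I.ℓ) := by
        rw [mul_add, mul_one]; omega
      change (k * (I.ℓ + 1) + 3) * n * (2 ^ (2 * (k * I.ℓ)) * 2 ^ (2 * (k * I.ℓ))) ≤ _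
      rw [valueBound, e1, e2]
      set D := 2 ^ (k * I.ℓ)
      calc (k * (I.ℓ + 1) + 3) * n * (D ^ 2 * D ^ 2) ≤ 5 * D * n * (D ^ 2 * D ^ 2) := by
            gcongr; omega
        _ = 5 * D ^ 5 * (n * 1) := by ring
        _ ≤ 18 * D ^ 6 * ((n + I.ℓ + 1) * (n + I.ℓ + 1)) := by
            gcongr <;> omega

/-- Deciding valid instances. -/
theorem coreStmt_decidesWithin (hE : MAPFInstance.IsEdgeList I.G E) (r : SwapRule) :
    (coreStmt 0 (swapBit r)).program.DecidesWithin (I.encode E) (I.Solvable r)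
      (13001 * 2 ^ (13001 * (k * I.ℓ)) * max 1 I.G.edgeSet.ncard * max 1 (Nat.log 2 n))
      (13001 * (k * I.ℓ + Nat.log 2 (n + I.ℓ) + 1)) := by
  have hb := le_valueBound n (k * I.ℓ) I.ℓ
  have hm := length_edgeList_le hE
  have hkn := agents_le I
  have hspec := coreStmt_spec_encode hE r (inp := fun j => (I.encode E).getD j 0) (o := 0)
    (σ := .start (I.encode E).length) (by simp) (zero_add _).le le_rfl
    (fun _ => rfl) (fun _ => rfl)
  refine Stmt.decidesWithin _ (by cases r <;> decide) _ _ (V := valueBound n (k * I.ℓ) I.ℓ)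
    (by omega) ?_ ?_ hspec.safe ?_ ?_ hspec.post
  · rw [length_encode]; omega
  · intro y hy
    have := le_of_mem_encode hy
    omega
  · have hc := hspec.cost
    rw [ncard_edgeSet hE]
    have h1 : 0 < 2 ^ (12 * (k * I.ℓ)) * max 1 E.length * max 1 (Nat.log 2 n) := by positivity
    calc _ ≤ 13000 * 2 ^ (12 * (k * I.ℓ)) * max 1 E.length * max 1 (Nat.log 2 n) +
          2 ^ (12 * (k * I.ℓ)) * max 1 E.length * max 1 (Nat.log 2 n) := Nat.add_le_add hc h1
      _ = 13001 * 2 ^ (12 * (k * I.ℓ)) * max 1 E.length * max 1 (Nat.log 2 n) := by ring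
      _ ≤ _ := by gcongr <;> omega
  · refine (valueBound_pow_lt _ _ _).trans_le (Nat.pow_le_pow_right (by omega) ?_)
    gcongr
    omega

end

end RAM

namespace RAM

/-! ### Checking the input -/

/-- Clears `ok` if `e₁ < e₂`. -/
def failIf (e₁ e₂ : Expr) : Stmt := .ite e₁ e₂ (.ok ≔ 0) .skip

/-- The distance of two values. -/
def Expr.dist (e₁ e₂ : Expr) : Expr := (e₁ - e₂) + (e₂ - e₁)

/-- Compares the edge `e` with the edge `j`. -/
def edgePairStmt : Stmt :=
  .input .u2 (5 + 2 * Var.j) ;; .input .v2 (5 + 2 * Var.j + 1) ;;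
  failIf (.dist Var.u Var.u2 + .dist Var.v Var.v2) 1 ;;
  failIf (.dist Var.u Var.v2 + .dist Var.v Var.u2) 1

def edgeCheckStmt : Stmt :=
  .input .u (5 + 2 * Var.e) ;; .input .v (5 + 2 * Var.e + 1) ;;
  failIf Var.n (Var.u + 1) ;; failIf Var.n (Var.v + 1) ;; failIf (.dist Var.u Var.v) 1 ;;
  .loop .j .e edgePairStmt

/-- Compares the agent `a` with the agent `b`. -/
def agentPairStmt : Stmt :=
  .input .u2 (5 + 2 * Var.m + Var.b) ;; .input .v2 (5 + 2 * Var.m + Var.k + Var.b) ;;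
  failIf (.dist Var.u Var.u2) 1 ;; failIf (.dist Var.v Var.v2) 1

def agentCheckStmt : Stmt :=
  .input .u (5 + 2 * Var.m + Var.a) ;; .input .v (5 + 2 * Var.m + Var.k + Var.a) ;;
  failIf Var.n (Var.u + 1) ;; failIf Var.n (Var.v + 1) ;; .loop .b .a agentPairStmt

def checkStmt : Stmt := .loop .e .m edgeCheckStmt ;; .loop .a .k agentCheckStmt

/-- Sets `ok` to `1` if the input is a parameter followed by the encoding of an instance with
this parameter. -/
def validStmt : Stmt :=
  .ok ≔ 0 ;; .ite Var.len 5 .skip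
    (readStmt 1 ;; .input .kap 0 ;; .ite (.dist Var.len (5 + 2 * Var.m + 2 * Var.k)) 1
      (.ite 0 Var.l (.ite (.dist (Var.k + Var.l) Var.kap) 1 (.ok ≔ 1 ;; checkStmt) .skip) .skip)
      .skip)

def fptStmt (δ : ℕ) : Stmt := validStmt ;; .ite 0 Var.ok (coreStmt 1 δ) (.len ≔ 0)

/-- `ok` holds the truth value of `P`. -/
def Chk (P : Prop) (σ : State) : Prop := (P ∧ σ.var .ok = 1) ∨ (¬ P ∧ σ.var .ok = 0)

theorem Chk.congr {P Q : Prop} {σ τ : State} (h : Chk P σ) (hPQ : P ↔ Q)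
    (hok : τ.var .ok = σ.var .ok) : Chk Q τ := by
  rw [Chk, ← hPQ, hok]; exact h

/-! ### Correctness of the input check -/

section
variable {inp : ℕ → ℕ} {L V : ℕ} {σ : State}

@[simp] theorem Expr.cost_dist (e₁ e₂ : Expr) :
    (Expr.dist e₁ e₂).cost = 2 * (e₁.cost + e₂.cost + 1) + 1 := by
  simp [Expr.dist]; omega

/-- The flag `ok` is only ever cleared, so a sequence of such tests accumulates a conjunction. -/
theorem failIf_spec {e₁ e₂ : Expr} {P Q : Prop} {T : ℕ} (h : Chk P σ)
    (hQ : Q ↔ ¬ e₁.eval σ < e₂.eval σ) (hT : e₁.cost + e₂.cost + 4 ≤ T) :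
    Spec inp L V (failIf e₁ e₂) σ T fun τ =>
      Chk (P ∧ Q) τ ∧ ∀ y, y ≠ .ok → τ.var y = σ.var y := by
  refine Spec.of_le (Spec.ite (T := 2) (fun hlt => ?_) (fun hge => ?_)) (by omega)
  · refine Spec.of_le (Spec.assign (by simp) ⟨.inr ⟨fun hPQ => hQ.1 hPQ.2 hlt, by simp⟩,
      fun y hy => by simp [hy]⟩) (by simp)
  · refine Spec.of_le (Spec.skip ⟨h.congr ?_ rfl, fun _ _ => rfl⟩) (by omega)
    rw [hQ, not_lt]
    tauto

/-- The edges `e` and `j` of the input differ. -/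
def EdgesDiffer (inp : ℕ → ℕ) (e j : ℕ) : Prop :=
  ¬ (inp (5 + 2 * e) = inp (5 + 2 * j) ∧ inp (5 + 2 * e + 1) = inp (5 + 2 * j + 1)) ∧
  ¬ (inp (5 + 2 * e) = inp (5 + 2 * j + 1) ∧ inp (5 + 2 * e + 1) = inp (5 + 2 * j))

/-- The edge `e` of the input is proper and differs from the earlier ones. -/
structure EdgeOK (inp : ℕ → ℕ) (n e : ℕ) : Prop where
  u_lt : inp (5 + 2 * e) < n
  v_lt : inp (5 + 2 * e + 1) < n
  ne : inp (5 + 2 * e) ≠ inp (5 + 2 * e + 1)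
  differ : ∀ j < e, EdgesDiffer inp e j

/-- The agents `a` and `b` of the input differ. -/
def AgentsDiffer (inp : ℕ → ℕ) (m k a b : ℕ) : Prop :=
  inp (5 + 2 * m + a) ≠ inp (5 + 2 * m + b) ∧ inp (5 + 2 * m + k + a) ≠ inp (5 + 2 * m + k + b)

/-- The ends of agent `a` are proper and differ from those of the earlier ones. -/
structure AgentOK (inp : ℕ → ℕ) (n m k a : ℕ) : Prop where
  s_lt : inp (5 + 2 * m + a) < n
  t_lt : inp (5 + 2 * m + k + a) < n
  differ : ∀ b < a, AgentsDiffer inp m k a b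

/-- The input is a parameter followed by an instance with this parameter. -/
structure ValidInput (inp : ℕ → ℕ) (L : ℕ) : Prop where
  five_le : 5 ≤ L
  length : L = 5 + 2 * inp 2 + 2 * inp 3
  l_pos : 0 < inp 4
  param : inp 3 + inp 4 = inp 0
  edge : ∀ e < inp 2, EdgeOK inp (inp 1) e
  agent : ∀ a < inp 3, AgentOK inp (inp 1) (inp 2) (inp 3) a

theorem forall_lt_succ {P : ℕ → Prop} {t : ℕ} : (∀ j < t + 1, P j) ↔ (∀ j < t, P j) ∧ P t :=
  ⟨fun h => ⟨fun j hj => h j (by omega), h t (by omega)⟩, fun h j hj => by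
    rcases Nat.lt_succ_iff_lt_or_eq.1 hj with hj | rfl
    · exact h.1 j hj
    · exact h.2⟩

theorem edgePairStmt_spec {P : Prop} {e j : ℕ} (hj : σ.var .j = j)
    (hu : σ.var .u = inp (5 + 2 * e)) (hv : σ.var .v = inp (5 + 2 * e + 1))
    (hjL : 5 + 2 * j + 1 < L) (h : Chk P σ) :
    Spec inp L V edgePairStmt σ 60 (Chk (P ∧ EdgesDiffer inp e j)) := by
  refine Spec.of_le (Spec.input_seq ?_ <| Spec.input_seq ?_ <|
    Spec.seq (failIf_spec (T := 20) (P := P)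
      (Q := ¬ (inp (5 + 2 * e) = inp (5 + 2 * j) ∧ inp (5 + 2 * e + 1) = inp (5 + 2 * j + 1)))
      h ?_ (by simp)) (T₂ := 20) fun τ hτ => ?_) (by simp)
  · simp [hj]; omega
  · simp [hj]; omega
  -- A sum of two distances is less than `1` iff both are zero, so one comparison tests two
  -- equalities.
  · simp [hj, hu, hv, Expr.dist]; omega
  · obtain ⟨h1, h2⟩ := hτ
    refine (failIf_spec (T := 20) (Q := ¬ (inp (5 + 2 * e) = inp (5 + 2 * j + 1) ∧
      inp (5 + 2 * e + 1) = inp (5 + 2 * j))) h1 ?_ (by simp)).mono le_rfl fun ρ hρ =>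
        hρ.1.congr (by rw [EdgesDiffer, and_assoc]) rfl
    simp [Expr.dist, h2, hj, hu, hv]; omega

theorem edgeCheckStmt_spec {P : Prop} {n e : ℕ} (he : σ.var .e = e) (hn : σ.var .n = n)
    (heL : 5 + 2 * e + 1 < L) (h : Chk P σ) :
    Spec inp L V edgeCheckStmt σ (e * 64 + 60) (Chk (P ∧ EdgeOK inp n e)) := by
  refine Spec.of_le (Spec.input_seq ?_ <| Spec.input_seq ?_ <|
    Spec.seq (failIf_spec (T := 8) (P := P) (Q := inp (5 + 2 * e) < n) h ?_ (by simp))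
      (T₂ := e * 64 + 30) fun τ hτ => ?_) (by simp; omega)
  · simp [he]; omega
  · simp [he]; omega
  · simp [he, hn]
  obtain ⟨h1, h2⟩ := hτ
  refine Spec.of_le (Spec.seq (failIf_spec (T := 8) (Q := inp (5 + 2 * e + 1) < n) h1 ?_ (by simp))
    (T₂ := e * 64 + 20) fun τ' hτ => ?_) (by omega)
  · simp [h2, he, hn]
  obtain ⟨h1', h2'⟩ := hτ
  refine Spec.of_le (Spec.seq (failIf_spec (T := 12) (Q := inp (5 + 2 * e) ≠ inp (5 + 2 * e + 1))
    h1' ?_ (by simp)) (T₂ := e * 64 + 3) fun ω hω => ?_) (by omega)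
  · simp [h2, h2', he, Expr.dist]; omega
  obtain ⟨h1'', h2''⟩ := hω
  have hvar : ∀ y, y ≠ .ok → y ≠ .u → y ≠ .v → ω.var y = σ.var y := fun y hy hy1 hy2 => by
    rw [h2'' y hy, h2' y hy, h2 y hy]; simp [hy1, hy2]
  have hωe : ω.var .e = e := by rw [hvar _ (by decide) (by decide) (by decide), he]
  have hωu : ω.var .u = inp (5 + 2 * e) := by
    rw [h2'' _ (by decide), h2' _ (by decide), h2 _ (by decide)]; simp [he]
  have hωv : ω.var .v = inp (5 + 2 * e + 1) := by
    rw [h2'' _ (by decide), h2' _ (by decide), h2 _ (by decide)]; simp [he]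
  refine Spec.of_le (Spec.loop (fun t ρ => Chk ((((P ∧ inp (5 + 2 * e) < n) ∧
    inp (5 + 2 * e + 1) < n) ∧ inp (5 + 2 * e) ≠ inp (5 + 2 * e + 1)) ∧
      ∀ j < t, EdgesDiffer inp e j) ρ) 60 (by decide) (h1''.congr (by simp) (by simp)) ?_ ?_) ?_
  · intro t ρ ht hρ hfr hI
    rw [hωe] at ht
    refine (edgePairStmt_spec (e := e) hρ ((hfr.var _ (by decide)).trans hωu)
      ((hfr.var _ (by decide)).trans hωv) (by omega) hI).mono le_rfl fun ρ' hρ' => ?_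
    exact hρ'.congr (by rw [forall_lt_succ, and_assoc]) (by simp)
  · intro ρ _ hI
    rw [hωe] at hI
    refine hI.congr ⟨?_, ?_⟩ rfl
    · rintro ⟨⟨⟨⟨a, b⟩, c⟩, d⟩, e⟩
      exact ⟨a, b, c, d, e⟩
    · rintro ⟨a, b, c, d, e⟩
      exact ⟨⟨⟨⟨a, b⟩, c⟩, d⟩, e⟩
  · rw [hωe]

theorem agentPairStmt_spec {P : Prop} {m k a b : ℕ} (hb : σ.var .b = b) (hm : σ.var .m = m)
    (hk : σ.var .k = k) (hu : σ.var .u = inp (5 + 2 * m + a))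
    (hv : σ.var .v = inp (5 + 2 * m + k + a)) (hbL : 5 + 2 * m + k + b < L) (h : Chk P σ) :
    Spec inp L V agentPairStmt σ 50 (Chk (P ∧ AgentsDiffer inp m k a b)) := by
  refine Spec.of_le (Spec.input_seq ?_ <| Spec.input_seq ?_ <|
    Spec.seq (failIf_spec (T := 12) (P := P) (Q := inp (5 + 2 * m + a) ≠ inp (5 + 2 * m + b))
      h ?_ (by simp)) (T₂ := 12) fun τ hτ => ?_) (by simp)
  · simp [hb, hm]; omega
  · simp [hb, hm, hk]; omega
  · simp [hb, hm, hu, Expr.dist]; omega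
  · obtain ⟨h1, h2⟩ := hτ
    refine (failIf_spec (T := 12) (Q := inp (5 + 2 * m + k + a) ≠ inp (5 + 2 * m + k + b)) h1 ?_
      (by simp)).mono le_rfl fun ρ hρ => hρ.1.congr (by rw [AgentsDiffer, and_assoc]) rfl
    simp [h2, hb, hm, hk, hv, Expr.dist]; omega

theorem agentCheckStmt_spec {P : Prop} {n m k a : ℕ} (ha : σ.var .a = a) (hn : σ.var .n = n)
    (hm : σ.var .m = m) (hk : σ.var .k = k) (haL : 5 + 2 * m + k + a < L) (h : Chk P σ) :
    Spec inp L V agentCheckStmt σ (a * 54 + 60) (Chk (P ∧ AgentOK inp n m k a)) := by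
  refine Spec.of_le (Spec.input_seq ?_ <| Spec.input_seq ?_ <|
    Spec.seq (failIf_spec (T := 8) (P := P) (Q := inp (5 + 2 * m + a) < n) h ?_ (by simp))
      (T₂ := a * 54 + 20) fun τ hτ => ?_) (by simp; omega)
  · simp [ha, hm]; omega
  · simp [ha, hm, hk]; omega
  · simp [ha, hm, hn]
  obtain ⟨h1, h2⟩ := hτ
  refine Spec.of_le (Spec.seq (failIf_spec (T := 8) (Q := inp (5 + 2 * m + k + a) < n) h1 ?_
    (by simp)) (T₂ := a * 54 + 3) fun ω hω => ?_) (by omega)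
  · simp [h2, ha, hn, hm, hk]
  obtain ⟨h1', h2'⟩ := hω
  have hvar : ∀ y, y ≠ .ok → y ≠ .u → y ≠ .v → ω.var y = σ.var y := fun y hy hy1 hy2 => by
    rw [h2' y hy, h2 y hy]; simp [hy1, hy2]
  have hωa : ω.var .a = a := by rw [hvar _ (by decide) (by decide) (by decide), ha]
  have hωm : ω.var .m = m := by rw [hvar _ (by decide) (by decide) (by decide), hm]
  have hωk : ω.var .k = k := by rw [hvar _ (by decide) (by decide) (by decide), hk]
  have hωu : ω.var .u = inp (5 + 2 * m + a) := by
    rw [h2' _ (by decide), h2 _ (by decide)]; simp [ha, hm]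
  have hωv : ω.var .v = inp (5 + 2 * m + k + a) := by
    rw [h2' _ (by decide), h2 _ (by decide)]; simp [ha, hm, hk]
  refine Spec.of_le (Spec.loop (fun t ρ => Chk (((P ∧ inp (5 + 2 * m + a) < n) ∧
    inp (5 + 2 * m + k + a) < n) ∧ ∀ b < t, AgentsDiffer inp m k a b) ρ) 50 (by decide)
      (h1'.congr (by simp) (by simp)) ?_ ?_) ?_
  · intro t ρ ht hρ hfr hI
    rw [hωa] at ht
    refine (agentPairStmt_spec (a := a) hρ ((hfr.var _ (by decide)).trans hωm)
      ((hfr.var _ (by decide)).trans hωk) ((hfr.var _ (by decide)).trans hωu)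
      ((hfr.var _ (by decide)).trans hωv) (by omega) hI).mono le_rfl fun ρ' hρ' => ?_
    exact hρ'.congr (by rw [forall_lt_succ, and_assoc]) (by simp)
  · intro ρ _ hI
    rw [hωa] at hI
    refine hI.congr ⟨?_, ?_⟩ rfl
    · rintro ⟨⟨⟨a, b⟩, c⟩, d⟩
      exact ⟨a, b, c, d⟩
    · rintro ⟨a, b, c, d⟩
      exact ⟨⟨⟨a, b⟩, c⟩, d⟩
  · rw [hωa]

theorem checkStmt_spec {P : Prop} {n m k : ℕ} (hn : σ.var .n = n)
    (hm : σ.var .m = m) (hk : σ.var .k = k) (hL : L = 5 + 2 * m + 2 * k) (h : Chk P σ) :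
    Spec inp L V checkStmt σ (L * (L * 64 + 68)) (Chk ((P ∧ ∀ e < m, EdgeOK inp n e) ∧
      ∀ a < k, AgentOK inp n m k a)) := by
  refine Spec.of_le (Spec.seq (Spec.loop (fun t ρ => Chk (P ∧ ∀ e < t, EdgeOK inp n e) ρ)
    (L * 64 + 60) (by decide) (h.congr (by simp) (by simp)) ?_ fun τ hfr hI => And.intro hI hfr)
    (T₂ := k * (L * 64 + 64) + 3) ?_) ?_
  · intro t ρ ht hρ hfr hI
    rw [hm] at ht
    refine (edgeCheckStmt_spec hρ ((hfr.var _ (by decide)).trans hn) (by omega) hI).mono (by omega)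
      fun ρ' hρ' => hρ'.congr (by rw [forall_lt_succ, and_assoc]) (by simp)
  · rintro τ ⟨hI, hfr⟩
    rw [hm] at hI
    have hm' : τ.var .m = m := (hfr.var _ (by decide)).trans hm
    have hk' : τ.var .k = k := (hfr.var _ (by decide)).trans hk
    have hn' : τ.var .n = n := (hfr.var _ (by decide)).trans hn
    refine Spec.of_le (Spec.loop (fun t ρ => Chk ((P ∧ ∀ e < m, EdgeOK inp n e) ∧
      ∀ a < t, AgentOK inp n m k a) ρ) (L * 64 + 60) (by decide)
      (hI.congr (by simp) (by simp)) ?_ ?_) (by rw [hk'])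
    · intro t ρ ht hρ hfr' hJ
      rw [hk'] at ht
      refine (agentCheckStmt_spec hρ ((hfr'.var _ (by decide)).trans hn')
        ((hfr'.var _ (by decide)).trans hm') ((hfr'.var _ (by decide)).trans hk') (by omega)
        hJ).mono (by omega) fun ρ' hρ' => hρ'.congr (by rw [forall_lt_succ, and_assoc]) (by simp)
    · intro ρ _ hJ
      rwa [hk'] at hJ
  · rw [hm]
    calc m * (L * 64 + 60 + 4) + 3 + (k * (L * 64 + 64) + 3)
        = (m + k) * (L * 64 + 64) + 6 := by ring
      _ ≤ L * (L * 64 + 64) + L * 4 := by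
          have : (m + k) * (L * 64 + 64) ≤ L * (L * 64 + 64) := Nat.mul_le_mul_right _ (by omega)
          omega
      _ = _ := by ring

/-- The order of the tests matters: the header is read only if there are at least five cells, and
the lists only after their announced lengths match the length of the input. Hence all reads stay
inside the input even for malformed words. -/
theorem validStmt_spec (hV : 1 ≤ V) (hlen : σ.var .len = L) :
    Spec inp L V validStmt σ (L * (L * 64 + 68) + 80) (Chk (ValidInput inp L)) := by
  refine Spec.of_le (Spec.assign_seq (by simp) <| Spec.ite (T := L * (L * 64 + 68) + 60)
    (fun hlt => ?_) (fun hge => ?_)) (by simp; omega)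
  · refine Spec.of_le (Spec.skip (.inr ⟨fun h => ?_, by simp⟩)) (by omega)
    have := h.five_le
    simp [hlen] at hlt
    omega
  simp [hlen] at hge
  refine Spec.of_le (Spec.seq (readStmt_spec (by omega)).frame (T₂ := L * (L * 64 + 68) + 50)
    fun τ hτ => ?_) (by omega)
  obtain ⟨⟨hn, hm, hk, hl⟩, hfr⟩ := hτ
  have hlen' : τ.var .len = L := by
    rw [hfr.var _ (by decide)]; simpa using hlen
  have hok : τ.var .ok = 0 := by
    rw [hfr.var _ (by decide)]; simp
  norm_num at hn hm hk hl
  refine Spec.of_le (Spec.input_seq (by simp; omega) <| Spec.ite (T := L * (L * 64 + 68) + 22)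
    (fun h1 => ?_) (fun h1 => ?_)) (by simp; omega)
  swap
  · refine Spec.of_le (Spec.skip (.inr ⟨fun h => ?_, by simpa using hok⟩)) (by omega)
    have := h.length
    simp [Expr.dist, hlen', hm, hk] at h1
    omega
  simp [Expr.dist, hlen', hm, hk] at h1
  refine Spec.of_le (Spec.ite (T := L * (L * 64 + 68) + 18) (fun h2 => ?_) (fun h2 => ?_))
    (by simp; omega)
  swap
  · refine Spec.of_le (Spec.skip (.inr ⟨fun h => ?_, by simpa using hok⟩)) (by omega)
    have := h.l_pos
    simp [hl] at h2
    omega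
  simp [hl] at h2
  refine Spec.of_le (Spec.ite (T := L * (L * 64 + 68) + 2) (fun h3 => ?_) (fun h3 => ?_))
    (by simp; omega)
  swap
  · refine Spec.of_le (Spec.skip (.inr ⟨fun h => ?_, by simpa using hok⟩)) (by omega)
    have := h.param
    simp [Expr.dist, hl, hk] at h3
    omega
  simp [Expr.dist, hl, hk] at h3
  refine Spec.of_le (Spec.assign_seq (by simpa using hV) <| (checkStmt_spec (P := True)
    (n := inp 1) (m := inp 2) (k := inp 3) ?_ ?_ ?_ (by omega) (.inl ⟨trivial, by simp⟩)).mono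
      le_rfl fun ρ hρ => hρ.congr ⟨?_, ?_⟩ rfl) (by simp; omega)
  · simpa using hn
  · simpa using hm
  · simpa using hk
  · rintro ⟨⟨-, he⟩, ha⟩
    exact ⟨hge, by omega, h2, by omega, he, ha⟩
  · intro h
    exact ⟨⟨trivial, h.edge⟩, h.agent⟩

end

/-! ### Valid inputs are encodings -/

section
variable {n k : ℕ} {I : MAPFInstance (Fin n) (Fin k)} {E : List (Fin n × Fin n)}

theorem validInput_encode (hE : MAPFInstance.IsEdgeList I.G E) {inp : ℕ → ℕ}
    (hinp : ∀ j, inp (1 + j) = (I.encode E).getD j 0) (h0 : inp 0 = k + I.ℓ) :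
    ValidInput inp ((I.encode E).length + 1) := by
  have hr := reads_encode (L := (I.encode E).length + 1) hinp (by omega)
  have hn : inp 1 = n := hr.n
  have hm : inp 2 = E.length := hr.m
  have hk : inp 3 = k := hr.k
  have hl : inp 4 = I.ℓ := hr.l
  have hu : ∀ e, ∀ he : e < E.length, inp (5 + 2 * e) = E[e].1 := fun e he => by
    rw [show 5 + 2 * e = 1 + 4 + 2 * e by ring, hr.u e he]; simp [Data.ofInstance, he]
  have hv : ∀ e, ∀ he : e < E.length, inp (5 + 2 * e + 1) = E[e].2 := fun e he => by
    rw [show 5 + 2 * e + 1 = 1 + 4 + 2 * e + 1 by ring, hr.v e he]; simp [Data.ofInstance, he]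
  have hs : ∀ a, ∀ ha : a < k, inp (5 + 2 * E.length + a) = I.s₀ ⟨a, ha⟩ := fun a ha => by
    rw [show 5 + 2 * E.length + a = 1 + 4 + 2 * E.length + a by ring]
    exact (hr.s a ha).trans (by simp [Data.ofInstance, ha])
  have ht : ∀ a, ∀ ha : a < k, inp (5 + 2 * E.length + k + a) = I.t ⟨a, ha⟩ := fun a ha => by
    rw [show 5 + 2 * E.length + k + a = 1 + 4 + 2 * E.length + k + a by ring]
    exact (hr.t a ha).trans (by simp [Data.ofInstance, ha])
  have hlen := length_encode (I := I) (E := E)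
  refine ⟨by omega, by omega, by rw [hl]; exact I.ℓ_pos, by omega, ?_, ?_⟩
  · intro e he
    rw [hm] at he
    rw [hn]
    refine ⟨by rw [hu e he]; exact Fin.is_lt _, by rw [hv e he]; exact Fin.is_lt _, ?_, ?_⟩
    · rw [hu e he, hv e he, Ne, Fin.val_inj]
      have : s(E[e].1, E[e].2) ∈ I.G.edgeSet :=
        (hE.2 _).1 (List.mem_map.2 ⟨E[e], List.getElem_mem he, rfl⟩)
      exact I.G.ne_of_adj this
    · intro j hj
      have hjE : j < E.length := hj.trans he
      have := Data.ofInstance_simple hE e he j hj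
      rw [Data.ofInstance_joins he] at this
      simp only [Data.ofInstance, hjE, dite_true] at this
      rw [EdgesDiffer, hu e he, hv e he, hu j hjE, hv j hjE]
      exact ⟨fun h => this (.inl ⟨h.1.symm, h.2.symm⟩), fun h => this (.inr ⟨h.2.symm, h.1.symm⟩)⟩
  · intro a ha
    rw [hk] at ha
    rw [hn, hm, hk]
    refine ⟨by rw [hs a ha]; exact Fin.is_lt _, by rw [ht a ha]; exact Fin.is_lt _, ?_⟩
    intro b hb
    have hbk : b < k := hb.trans ha
    rw [AgentsDiffer, hs a ha, ht a ha, hs b hbk, ht b hbk]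
    constructor
    · intro h
      have := I.s₀_injective (Fin.ext h)
      simp only [Fin.mk.injEq] at this
      omega
    · intro h
      have := I.t_injective (Fin.ext h)
      simp only [Fin.mk.injEq] at this
      omega

/-- The data determine every cell of the encoding. This is what turns equality of the decoded data
into equality of words for `ValidInput.exists_encode`. -/
theorem Reads.eq {inp inp' : ℕ → ℕ} {L L' o j : ℕ} {G : Data} (h : Reads inp L o G)
    (h' : Reads inp' L' o G) (hj : j < 4 + 2 * G.m + 2 * G.k) : inp (o + j) = inp' (o + j) := by
  rcases lt_or_ge j 4 with h4 | h4
  · have : j = 0 ∨ j = 1 ∨ j = 2 ∨ j = 3 := by omega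
    rcases this with rfl | rfl | rfl | rfl
    · exact h.n.trans h'.n.symm
    · exact h.m.trans h'.m.symm
    · exact h.k.trans h'.k.symm
    · exact h.l.trans h'.l.symm
  rcases lt_or_ge j (4 + 2 * G.m) with h5 | h5
  · rcases Nat.even_or_odd' j with ⟨e, rfl | rfl⟩
    · have h6 := (h.u (e - 2) (by omega)).trans (h'.u (e - 2) (by omega)).symm
      rwa [show o + 4 + 2 * (e - 2) = o + 2 * e by omega] at h6
    · have h6 := (h.v (e - 2) (by omega)).trans (h'.v (e - 2) (by omega)).symm
      rwa [show o + 4 + 2 * (e - 2) + 1 = o + (2 * e + 1) by omega] at h6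
  rcases lt_or_ge j (4 + 2 * G.m + G.k) with h6 | h6
  · have h7 := (h.s (j - 4 - 2 * G.m) (by omega)).trans (h'.s (j - 4 - 2 * G.m) (by omega)).symm
    rwa [show o + 4 + 2 * G.m + (j - 4 - 2 * G.m) = o + j by omega] at h7
  · have h7 := (h.t (j - 4 - 2 * G.m - G.k) (by omega)).trans
      (h'.t (j - 4 - 2 * G.m - G.k) (by omega)).symm
    rwa [show o + 4 + 2 * G.m + G.k + (j - 4 - 2 * G.m - G.k) = o + j by omega] at h7

end

theorem injective_of_lt {k n : ℕ} {f : Fin k → Fin n}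
    (h : ∀ a b : Fin k, b < a → (f a : ℕ) ≠ f b) : Function.Injective f := by
  intro a b hab
  by_contra hne
  rcases lt_or_gt_of_ne hne with hlt | hlt
  · exact h b a hlt (by rw [hab])
  · exact h a b hlt (by rw [hab])

/-- A valid input encodes an instance. -/
theorem ValidInput.exists_encode {κ : ℕ} {x : List ℕ}
    (h : ValidInput (fun j => (κ :: x).getD j 0) (x.length + 1)) :
    ∃ (n k : ℕ) (I : MAPFInstance (Fin n) (Fin k)) (E : List (Fin n × Fin n)),
      MAPFInstance.IsEdgeList I.G E ∧ x = I.encode E ∧ κ = k + I.ℓ := by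
  set inp : ℕ → ℕ := fun j => (κ :: x).getD j 0 with hinp
  set E : List (Fin (inp 1) × Fin (inp 1)) := List.ofFn fun e : Fin (inp 2) =>
    (⟨inp (5 + 2 * e), (h.edge e e.2).u_lt⟩, ⟨inp (5 + 2 * e + 1), (h.edge e e.2).v_lt⟩) with hEdef
  have hElen : E.length = inp 2 := List.length_ofFn
  have hEget : ∀ e, ∀ he : e < E.length,
      (E[e].1 : ℕ) = inp (5 + 2 * e) ∧ (E[e].2 : ℕ) = inp (5 + 2 * e + 1) := by
    intro e he
    simp [hEdef]
  let I : MAPFInstance (Fin (inp 1)) (Fin (inp 3)) :=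
    -- `SimpleGraph.fromEdgeSet` discards loops, but none are listed, as the check requires
    -- different ends.
    { G := SimpleGraph.fromEdgeSet {e | e ∈ E.map fun e => s(e.1, e.2)}
      s₀ := fun a => ⟨inp (5 + 2 * inp 2 + a), (h.agent a a.2).s_lt⟩
      t := fun a => ⟨inp (5 + 2 * inp 2 + inp 3 + a), (h.agent a a.2).t_lt⟩
      ℓ := inp 4
      s₀_injective := injective_of_lt fun a b hb => ((h.agent a a.2).differ b hb).1
      t_injective := injective_of_lt fun a b hb => ((h.agent a a.2).differ b hb).2
      ℓ_pos := h.l_pos }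
  have hI : MAPFInstance.IsEdgeList I.G E := by
    constructor
    · rw [List.nodup_iff_injective_getElem]
      have hlt : ∀ a b : Fin (E.map fun e => s(e.1, e.2)).length, b < a →
          (E.map fun e => s(e.1, e.2))[a] ≠ (E.map fun e => s(e.1, e.2))[b] := by
        rintro ⟨a, ha⟩ ⟨b, hb⟩ hba heq
        rw [List.length_map] at ha hb
        have hd := (h.edge a (by omega)).differ b hba
        have ga := hEget a ha
        have gb := hEget b hb
        simp only [Fin.getElem_fin, List.getElem_map, Sym2.eq_iff, Fin.ext_iff, ga, gb] at heq
        exact heq.elim hd.1 hd.2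
      intro a b hab
      by_contra hne
      rcases lt_or_gt_of_ne hne with hlt' | hlt'
      · exact hlt b a hlt' hab.symm
      · exact hlt a b hlt' hab
    · intro e
      simp only [I, SimpleGraph.edgeSet_fromEdgeSet]
      constructor
      · intro he
        refine ⟨he, ?_⟩
        obtain ⟨p, hp, rfl⟩ := List.mem_map.1 he
        obtain ⟨j, hj, rfl⟩ := List.getElem_of_mem hp
        have := (h.edge j (by omega)).ne
        rw [← (hEget j hj).1, ← (hEget j hj).2] at this
        intro hd
        exact this (congrArg Fin.val (by simpa using hd))
      · exact fun he => he.1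
  have hlen : x.length = (I.encode E).length := by
    have := h.length
    rw [length_encode, hElen]
    omega
  have hread : Reads inp (x.length + 1) 1 (Data.ofInstance I E) := by
    refine ⟨?_, rfl, hElen.symm, rfl, rfl, ?_, ?_, ?_, ?_⟩
    · rw [hlen, length_encode]
      change 1 + 4 + 2 * E.length + 2 * inp 3 ≤ _
      omega
    · intro e he
      change e < E.length at he
      simp [Data.ofInstance, he, (hEget e he).1]
    · intro e he
      change e < E.length at he
      simp [Data.ofInstance, he, (hEget e he).2]
    · intro a ha
      change a < inp 3 at ha
      change inp (1 + 4 + 2 * E.length + a) = _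
      simp [Data.ofInstance, ha, I, hElen]
    · intro a ha
      change a < inp 3 at ha
      change inp (1 + 4 + 2 * E.length + inp 3 + a) = _
      simp [Data.ofInstance, ha, I, hElen]
  have hread' : Reads (fun j => (κ :: I.encode E).getD j 0) (x.length + 1) 1
      (Data.ofInstance I E) :=
    reads_encode (fun j => by simp [add_comm 1 j]) (by omega)
  refine ⟨inp 1, inp 3, I, E, hI, ?_, h.param.symm⟩
  refine List.ext_getElem hlen fun j hj hj' => ?_
  have := hread.eq hread' (j := j) (by
    change j < 4 + 2 * E.length + 2 * inp 3
    rw [length_encode] at hj'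
    exact hj')
  simp only [hinp, add_comm 1 j, List.getD_cons_succ] at this
  rwa [List.getD_eq_getElem _ _ hj, List.getD_eq_getElem _ _ hj'] at this

/-! ### Fixed-parameter tractability -/

theorem length_le_bitLength (x : List ℕ) : x.length ≤ bitLength x := by
  induction x with
  | nil => simp [bitLength]
  | cons a x ih => simp [bitLength] at ih ⊢; omega

theorem lt_two_pow_bitLength {x : List ℕ} {y : ℕ} (hy : y ∈ x) : y < 2 ^ bitLength x := by
  refine (Nat.lt_size_self y).trans_le (Nat.pow_le_pow_right (by omega) ?_)
  have := List.single_le_sum (l := x.map fun a => Nat.size a + 1) (by simp) (Nat.size y + 1)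
    (List.mem_map.2 ⟨y, hy, rfl⟩)
  rw [bitLength]
  omega

theorem computable_timeBound :
    Computable fun κ : ℕ => 20000 * 2 ^ (12 * (κ * κ + κ + 1)) := by
  have h : Primrec fun κ : ℕ => 12 * (κ * κ + κ + 1) :=
    Primrec.nat_mul.comp (.const 12) (Primrec.nat_add.comp
      (Primrec.nat_add.comp (Primrec.nat_mul.comp .id .id) .id) (.const 1))
  have hpow : Primrec₂ fun a b : ℕ => a ^ b := Primrec₂.unpaired'.1 Nat.Primrec.pow
  exact (Primrec.nat_mul.comp (.const 20000) (hpow.comp (.const 2) h)).to_comp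

/-- The time for the core on a valid input. -/
theorem core_time_le {n k l m κ b : ℕ} (hκ : κ = k + l) (hm : m ≤ b) (hn : n < 2 ^ b) :
    13000 * 2 ^ (12 * (k * l)) * max 1 m * max 1 (Nat.log 2 n) ≤
      13000 * 2 ^ (12 * (κ * κ + κ + 1)) * ((b + 2) * (b + 2)) := by
  rw [mul_assoc]
  have hkl : k * l ≤ κ * κ := Nat.mul_le_mul (by omega) (by omega)
  have hlog : Nat.log 2 n ≤ b := by
    rcases Nat.eq_zero_or_pos n with rfl | h0
    · simp
    · exact (Nat.log_lt_of_lt_pow (by omega) hn).le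
  gcongr
  · omega
  · omega
  · omega
  · omega

/-- The exponent is larger than this bound needs: the same power of two must also dominate the given
parameter `κ`, even when it does not fit the word, and the number `16`. -/
theorem valueBound_le {n k l κ b : ℕ} (hκ : κ = k + l) (hn : n < 2 ^ b) (hl : l < 2 ^ b) :
    valueBound n (k * l) l ≤ 2 ^ (6 * (κ * κ) + κ + 2 * b + 9) := by
  have hkl : k * l ≤ κ * κ := Nat.mul_le_mul (by omega) (by omega)
  calc valueBound n (k * l) l ≤ 32 * 2 ^ (6 * (κ * κ)) * (2 ^ (b + 1) * 2 ^ (b + 1)) := by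
        rw [valueBound]
        have : n + l + 1 ≤ 2 ^ (b + 1) := by rw [pow_succ]; omega
        gcongr <;> omega
    _ = 2 ^ (6 * (κ * κ) + 2 * b + 7) := by ring
    _ ≤ _ := Nat.pow_le_pow_right (by omega) (by omega)

theorem fptStmt_spec (r : SwapRule) (x : List ℕ) (κ : ℕ) :
    Spec (fun j => (κ :: x).getD j 0) (x.length + 1)
      (2 ^ (6 * (κ * κ) + κ + 2 * bitLength x + 9)) (fptStmt (swapBit r)) (.start (x.length + 1))
      (13000 * 2 ^ (12 * (κ * κ + κ + 1)) * ((bitLength x + 2) * (bitLength x + 2)) +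
        (x.length + 1) * ((x.length + 1) * 64 + 68) + 90) fun τ =>
      ((x, κ) ∈ MAPF r ∧ τ.var .len = 1) ∨ ((x, κ) ∉ MAPF r ∧ τ.var .len = 0) := by
  refine Spec.of_le (Spec.seq (validStmt_spec (L := x.length + 1) Nat.one_le_two_pow rfl).frame
    (T₂ := 13000 * 2 ^ (12 * (κ * κ + κ + 1)) * ((bitLength x + 2) * (bitLength x + 2)) + 10)
      fun τ hτ => ?_) (by omega)
  obtain ⟨hchk, hfr⟩ := hτ
  refine Spec.of_le (Spec.ite
    (T := 13000 * 2 ^ (12 * (κ * κ + κ + 1)) * ((bitLength x + 2) * (bitLength x + 2)) + 2)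
    (fun hpos => ?_) (fun hzero => ?_)) (by simp; omega)
  · simp only [Expr.eval_ofNat, Expr.eval_var] at hpos
    have hvalid : ValidInput (fun j => (κ :: x).getD j 0) (x.length + 1) := by
      rcases hchk with h | h
      · exact h.1
      · omega
    -- Membership asks for some solvable instance with this encoding. Choosing a solvable one if
    -- there is any, and otherwise the one provided by validity, avoids proving that the encoding
    -- determines the instance.
    suffices h : ∃ (n k : ℕ) (I : MAPFInstance (Fin n) (Fin k)) (E : List (Fin n × Fin n)),
        MAPFInstance.IsEdgeList I.G E ∧ x = I.encode E ∧ κ = k + I.ℓ ∧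
          (I.Solvable r ↔ (x, κ) ∈ MAPF r) by
      obtain ⟨n, k, I, E, hE, hx, hκ, hiff⟩ := h
      have hmem : n ∈ x ∧ I.ℓ ∈ x := by rw [hx]; simp [MAPFInstance.encode]
      have hm : E.length ≤ bitLength x := by
        have h1 := length_le_bitLength x
        rw [hx, length_encode, ← hx] at h1
        omega
      refine (coreStmt_spec_encode hE r (fun j => ?_) ?_ ?_ (fun q => ?_) (fun q => ?_)).mono
        ((core_time_le hκ hm (lt_two_pow_bitLength hmem.1)).trans (by omega)) fun ρ hρ => ?_
      · simp [add_comm 1 j, hx]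
      · rw [← hx]; omega
      · exact valueBound_le hκ (lt_two_pow_bitLength hmem.1) (lt_two_pow_bitLength hmem.2)
      · rw [hfr.arr _ (by decide)]; rfl
      · rw [hfr.arr _ (by decide)]; rfl
      · rwa [hiff] at hρ
    by_cases hmem : (x, κ) ∈ MAPF r
    · obtain ⟨n, k, I, E, hE, hx, hκ, hsol⟩ := hmem
      exact ⟨n, k, I, E, hE, hx, hκ, fun _ => ⟨n, k, I, E, hE, hx, hκ, hsol⟩, fun _ => hsol⟩
    · obtain ⟨n, k, I, E, hE, hx, hκ⟩ := hvalid.exists_encode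
      exact ⟨n, k, I, E, hE, hx, hκ, fun hsol => ⟨n, k, I, E, hE, hx, hκ, hsol⟩,
        fun h => (hmem h).elim⟩
  · simp only [Expr.eval_ofNat, Expr.eval_var] at hzero
    refine Spec.of_le (Spec.assign (by simp) (.inr ⟨?_, by simp⟩)) (by simp)
    rintro ⟨n, k, I, E, hE, hx, hκ, -⟩
    dsimp only at hx hκ
    have hvalid := validInput_encode hE (inp := fun j => (κ :: x).getD j 0)
      (fun j => by simp [add_comm 1 j, hx]) (by simpa using hκ)
    rw [← hx] at hvalid
    rcases hchk with h | h
    · omega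
    · exact h.1 hvalid

theorem mapf_inFPT (r : SwapRule) : (MAPF r).InFPT := by
  refine ⟨(fptStmt (swapBit r)).program, fun κ => 20000 * 2 ^ (12 * (κ * κ + κ + 1)),
    (Polynomial.X + 2) * (Polynomial.X + 2), computable_timeBound, fun x κ => ?_⟩
  have hspec := fptStmt_spec r x κ
  have hlen := length_le_bitLength x
  have heval : ((Polynomial.X + 2) * (Polynomial.X + 2) : Polynomial ℕ).eval (bitLength x) =
      (bitLength x + 2) * (bitLength x + 2) := by simp
  rw [heval]
  set b := bitLength x with hb
  set F := 2 ^ (12 * (κ * κ + κ + 1)) with hF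
  have hF1 : 12 * (κ * κ + κ + 1) < F := Nat.lt_two_pow_self
  have hb2 : b * b ≤ (b + 2) * (b + 2) := Nat.mul_le_mul (by omega) (by omega)
  have hVpos : ∀ c, 2 ^ c ≤ 2 ^ (6 * (κ * κ) + κ + 2 * b + 9) ↔ c ≤ 6 * (κ * κ) + κ + 2 * b + 9 :=
    fun c => Nat.pow_le_pow_iff_right (by omega)
  refine Stmt.decidesWithin _ (by cases r <;> decide) _ _
    (V := 2 ^ (6 * (κ * κ) + κ + 2 * b + 9)) ?_ ?_ ?_ hspec.safe ?_ ?_ hspec.post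
  · exact (hVpos 4).2 (by omega)
  · have h1 : b < 2 ^ b := Nat.lt_two_pow_self
    rw [List.length_cons]
    exact (show x.length + 1 ≤ 2 ^ b by omega).trans ((hVpos b).2 (by omega))
  · intro y hy
    rcases List.mem_cons.1 hy with rfl | hy
    · exact Nat.lt_two_pow_self.le.trans ((hVpos y).2 (by omega))
    · exact (lt_two_pow_bitLength hy).le.trans ((hVpos b).2 (by omega))
  · have hc := hspec.cost
    have h1 : (x.length + 1) * ((x.length + 1) * 64 + 68) ≤ (b + 2) * (132 * (b + 2)) :=
      Nat.mul_le_mul (by omega) (by omega)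
    have h2 : (b + 2) * (132 * (b + 2)) = 132 * ((b + 2) * (b + 2)) := by ring
    have h3 : 1 ≤ (b + 2) * (b + 2) := Nat.mul_pos (by omega) (by omega)
    have h4 : (b + 2) * (b + 2) ≤ F * ((b + 2) * (b + 2)) :=
      Nat.le_mul_of_pos_left _ (by omega)
    have e1 : 13000 * F * ((b + 2) * (b + 2)) = 13000 * (F * ((b + 2) * (b + 2))) := by ring
    have e2 : 20000 * F * ((b + 2) * (b + 2)) = 20000 * (F * ((b + 2) * (b + 2))) := by ring
    rw [e1] at hc
    rw [e2]
    refine (Nat.add_le_add_right hc 1).trans ?_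
    omega
  · rw [← pow_mul]
    refine Nat.pow_lt_pow_right (by omega) ?_
    -- The number of bits of `V ^ 64` is quadratic in `κ` and linear in `b`, while `F` exceeds its
    -- own exponent `12 * (κ * κ + κ + 1)`; so the time bound also covers the bits.
    have h1 : (6 * (κ * κ) + κ + 2 * b + 9) * 64 < 2000 * (12 * (κ * κ + κ + 1)) * (b + 2) := by
      have : (κ * κ + κ + 1) * 1 ≤ (κ * κ + κ + 1) * (b + 2) := Nat.mul_le_mul_left _ (by omega)
      have h2 : 1 * (b + 2) ≤ (κ * κ + κ + 1) * (b + 2) := Nat.mul_le_mul_right _ (by omega)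
      have e : 2000 * (12 * (κ * κ + κ + 1)) * (b + 2) = 24000 * ((κ * κ + κ + 1) * (b + 2)) := by
        ring
      rw [e]
      omega
    refine h1.trans_le (Nat.mul_le_mul ?_ ?_)
    · change _ ≤ 20000 * F
      omega
    · exact Nat.le_mul_of_pos_left _ (by omega)

end RAM

/-- With or without swaps, multiagent path finding is fixed-parameter tractable with respect to
the number of agents `k` plus the makespan `ℓ`, and it can be solved in
`O(2 ^ O(k ℓ) · m · log n)` steps on words of `O(k ℓ + log (n + ℓ))` bits, for `n` vertices and
`m` edges. -/
theorem mainTheorem1 (r : SwapRule) :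
    (MAPF r).InFPT ∧
    ∃ (P : RAM.Program) (C : ℕ), ∀ (n k : ℕ) (I : MAPFInstance (Fin n) (Fin k))
      (E : List (Fin n × Fin n)), MAPFInstance.IsEdgeList I.G E →
      P.DecidesWithin (I.encode E) (I.Solvable r)
        (C * 2 ^ (C * (k * I.ℓ)) * max 1 I.G.edgeSet.ncard * max 1 (Nat.log 2 n))
        (C * (k * I.ℓ + Nat.log 2 (n + I.ℓ) + 1)) :=
  ⟨RAM.mapf_inFPT r, (RAM.coreStmt 0 (RAM.swapBit r)).program, 13001, fun _ _ _ _ hE =>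
    RAM.coreStmt_decidesWithin hE r⟩
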